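/- Let $so(4,2)$ be the real Lie algebra with conformal basis $J_i,K_i$ ($i=1,2,3$), $P_\mu,C_\mu$ ($\mu=0,\dots,3$), $D$ and non-vanishing brackets $[J_i,J_j]=\epsilon_{ijk}J_k$, $[J_i,K_j]=\epsilon_{ijk}K_k$, $[J_i,P_j]=\epsilon_{ijk}P_k$, $[J_i,C_j]=\epsilon_{ijk}C_k$, $[K_i,K_j]=-\epsilon_{ijk}J_k$, $[K_i,P_i]=P_0$, $[K_i,P_0]=P_i$, $[K_i,C_0]=C_i$, $[K_i,C_i]=C_0$, $[P_0,C_0]=D$, $[P_0,C_i]=-K_i$, $[P_i,C_0]=K_i$, $[P_i,C_j]=-\delta_{ij}D+\epsilon_{ijk}J_k$, $[P_\mu,D]=-P_\mu$, $[C_\mu,D]=C_\mu$ (it is the Lie algebra of the quadratic form of signature $(4,2)$). Let $\mathcal{WP}$ be the Weyl–Poincaré subalgebra spanned by $J_i,K_i,P_\mu,D$. Write $\bar P_\mu$ for the undeformed translations, regarded as elements of $U(so(4,2))[[z]]$, and put there $$H_\pm=\tfrac12(D\pm K_1),\quad T_\pm=\tfrac12(\bar P_0\pm \bar P_1),\quad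 T_2=\tfrac12(\bar P_2-\bar P_3),\quad T_3=\tfrac12(\bar P_2+\bar P_3),$$ $$B_2=\tfrac12(K_2+J_3-K_3+J_2),\ B_3=\tfrac12(K_2+J_3+K_3-J_2),\ A_2=\tfrac12(K_2-J_3-K_3-J_2),\ A_3=\tfrac12(K_2-J_3+K_3+J_2),$$ $$\sigma_-=\ln(1-2zT_-),\qquad T=T_++z(T_2^2+T_3^2)e^{-\sigma_-},\qquad \sigma_+=\ln(1-2zT),$$ $$\Phi_{\mathcal J}=e^{H_-\otimes\sigma_-},\quad \Phi_{\mathcal E}=e^{-2zB_3\otimes T_3e^{-\sigma_- /2}}e^{-2zB_2\otimes T_2e^{-\sigma_- /2}},\quad \Phi_{\mathcal A}=e^{H_+\otimes\sigma_+},\quad \mathcal F=\Phi_{\mathcal A}\Phi_{\mathcal E}\Phi_{\mathcal J},$$ tensor products being $z$-adically completed. Let $U_z(so(4,2))$ be $U(so(4,2))[[z]]$ with its usual product and counit $\epsilon$, the coproduct $\Delta(a)=\mathcal F\Delta_0(a)\mathcal F^{-1}$ and the antipode $S(a)=vS_0(a)v^{-1}$, where $\Delta_0,S_0$ are the undeformed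 coproduct and antipode and $v=\sum f^{(1)}S_0(f^{(2)})$ for $\mathcal F=\sum f^{(1)}\otimes f^{(2)}$. Let $U_z(\mathcal{WP})=U(\mathcal{WP})[[z]]\subset U_z(so(4,2))$. Define in $U_z(\mathcal{WP})$ the elements $$P_0=-\tfrac1{2z}(\sigma_++\sigma_-),\quad P_1=-\tfrac1{2z}(\sigma_+-\sigma_-),\quad P_2=(T_3+T_2)e^{-\sigma_-},\quad P_3=(T_3-T_2)e^{-\sigma_-},$$ $$D=H_++H_-,\quad K_1=H_+-H_-,\quad K_2=\tfrac12(A_3+A_2+B_3+B_2),\quad K_3=\tfrac12(A_3-A_2+B_3-B_2),$$ $$J_2=\tfrac12(A_3-A_2-B_3+B_2),\quad J_3=-\tfrac12(A_3+A_2-B_3-B_2),\quad J_1\text{ unchanged}.$$ Below $i,j,k\in\{1,2,3\}$, $a,b,c\in\{2,3\}$, and repeated indices $k$, $c$ on a right-hand side, as well as $b$ where it does not occur on the left-hand side, are summed over. Then the following hold. (1) $\mathcal F$ is a twisting element: it is invertible, $(\epsilon\otimes id)\mathcal F=(id\otimes\epsilon)\mathcal F=1$ and $\mathcal F_{12}(\Delta_0\otimes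 id)\mathcal F=\mathcal F_{23}(id\otimes\Delta_0)\mathcal F$. With the structure above $U_z(so(4,2))$ is a (topological) Hopf algebra; $\mathcal F\in U_z(\mathcal{WP})\hat\otimes U_z(\mathcal{WP})$, and $U_z(\mathcal{WP})$ is a Hopf subalgebra. (2) The elements $J_i,K_i,P_\mu,D$ lie in $U_z(\mathcal{WP})$ and, with $z$, generate it $z$-adically. The elements $J_i,K_i,D$ are the undeformed ones and $P_\mu\equiv\bar P_\mu$ modulo $z$. The inverse change of basis is $$\sigma_\mp=-z(P_0\mp P_1),\quad T_-=\frac{1-e^{-zP_0}e^{zP_1}}{2z},\quad T=\frac{1-e^{-zP_0}e^{-zP_1}}{2z},\quad T_2=\tfrac12e^{\sigma_-}(P_2-P_3),\quad T_3=\tfrac12e^{\sigma_-}(P_2+P_3),$$ $$T_+=\frac{1-e^{-zP_0}e^{-zP_1}}{2z}-\frac z2e^{-zP_0}e^{zP_1}(P_2^2+P_3^2).$$ (3) The coproduct is $$\Delta(X)=X\otimes1+1\otimes X\ (X=P_0,P_1,J_1),\quad \Delta(P_a)=P_a\otimes e^{-zP_1}+1\otimes P_a,\quad \Delta(J_a)=J_a\otimes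 e^{-zP_1}+1\otimes J_a+zJ_1\otimes P_a,$$ $$\Delta(D)=D\otimes e^{zP_0}\cosh zP_1+1\otimes D+K_1\otimes e^{zP_0}\sinh zP_1+\Theta,\qquad \Delta(K_1)=K_1\otimes e^{zP_0}\cosh zP_1+1\otimes K_1+D\otimes e^{zP_0}\sinh zP_1-\Theta,$$ $$\Theta=z(K_2+J_3)\otimes e^{zP_0}P_2+z(K_3-J_2)\otimes e^{zP_0}P_3+\tfrac{z^2}2(D+K_1)\otimes e^{zP_0}e^{zP_1}(P_2^2+P_3^2),$$ $$\Delta(K_a)=K_a\otimes e^{zP_0}+1\otimes K_a+\epsilon_{1ab}J_b\otimes(e^{zP_0}-e^{-zP_1})-z\epsilon_{1ab}J_1\otimes P_b+z(D+K_1)\otimes e^{zP_0}e^{zP_1}P_a.$$ (4) The commutation relations are $$[J_i,J_j]=\epsilon_{ijk}J_k,\quad [J_i,K_j]=\epsilon_{ijk}K_k,\quad [K_i,K_j]=-\epsilon_{ijk}J_k,\quad [J_1,P_j]=\epsilon_{1jk}P_k,\quad [J_a,P_1]=\epsilon_{a1b}P_b,$$ $$[J_a,P_b]=\epsilon_{1ab}\Big(\frac{1-e^{-2zP_1}}{2z}+\frac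 z2(P_b^2-P_a^2)\Big)+z\delta_{ab}\,\epsilon_{1bc}P_bP_c,$$ $$[K_1,P_0]=\tfrac1ze^{zP_0}\sinh zP_1-\tfrac z2e^{zP_0}e^{zP_1}(P_2^2+P_3^2),\quad [K_1,P_1]=\tfrac1z(e^{zP_0}\cosh zP_1-1)-\tfrac z2e^{zP_0}e^{zP_1}(P_2^2+P_3^2),$$ $$[K_a,P_0]=e^{zP_0}e^{zP_1}P_a,\quad [K_a,P_1]=(e^{zP_0}e^{zP_1}-1)P_a,\quad [K_1,P_a]=(1-e^{zP_0}e^{-zP_1})P_a,$$ $$[K_a,P_b]=\delta_{ab}\Big\{\tfrac1ze^{-zP_1}(e^{zP_0}-\cosh zP_1)+\tfrac z2\epsilon_{1bc}^2(P_b^2-P_c^2)\Big\}+z\epsilon_{1ab}^2P_aP_b,$$ $$[D,P_0]=\tfrac1z(e^{zP_0}\cosh zP_1-1)+\tfrac z2e^{zP_0}e^{zP_1}(P_2^2+P_3^2),\quad [D,P_1]=\tfrac1ze^{zP_0}\sinh zP_1+\tfrac z2e^{zP_0}e^{zP_1}(P_2^2+P_3^2),$$ $$[D,P_a]=e^{zP_0}e^{-zP_1}P_a,$$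 and all other commutators of these generators vanish: $[J_i,P_0]=[D,J_i]=[D,K_i]=[P_\mu,P_\nu]=0$. (5) In this basis $$\Phi_{\mathcal J}=e^{-\frac z2D\otimes P_0}e^{\frac z2D\otimes P_1}e^{\frac z2K_1\otimes P_0}e^{-\frac z2K_1\otimes P_1},\qquad \Phi_{\mathcal A}=e^{-\frac z2D\otimes P_0}e^{-\frac z2D\otimes P_1}e^{-\frac z2K_1\otimes P_0}e^{-\frac z2K_1\otimes P_1},$$ $$\Phi_{\mathcal E}=\exp\{-z(K_2+J_3)\otimes e^{-\frac z2P_0}e^{\frac z2P_1}P_2\}\exp\{-z(K_3-J_2)\otimes e^{-\frac z2P_0}e^{\frac z2P_1}P_3\},$$ and the twisting element takes the compact form $$\mathcal F=\exp\{-z(K_3-J_2)\otimes e^{zP_1}P_3\}\exp\{-z(K_2+J_3)\otimes e^{zP_1}P_2\}\exp(-zK_1\otimes P_1)\exp(-zD\otimes P_0).$$ (6) With $\tau$ the flip of the tensor factors, $\mathcal R=\tau(\mathcal F)\mathcal F^{-1}$ lies in $U_z(\mathcal{WP})\hat\otimes U_z(\mathcal{WP})$ and is a universal $R$-matrix: it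 is invertible, $\mathcal R\,\Delta(a)=\tau(\Delta(a))\,\mathcal R$ for all $a$, $(\Delta\otimes id)\mathcal R=\mathcal R_{13}\mathcal R_{23}$ and $(id\otimes\Delta)\mathcal R=\mathcal R_{13}\mathcal R_{12}$. Moreover $\mathcal R\equiv1+r$ modulo $z^2$, with the classical $r$-matrix (in the undeformed generators, $x\wedge y=x\otimes y-y\otimes x$) $$r=z(D\wedge \bar P_0+K_1\wedge \bar P_1+K_2\wedge \bar P_2+K_3\wedge \bar P_3)+z(J_3\wedge \bar P_2-J_2\wedge \bar P_3).$$ -/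

import Mathlib

open scoped TensorProduct

set_option linter.unusedSimpArgs false
set_option linter.flexible false
set_option linter.unusedSectionVars false

noncomputable section

namespace TwistedConformal

/-! ### The Hopf algebra structure of a universal enveloping algebra -/

section Enveloping

attribute [local instance 100] LieRing.ofAssociativeRing

variable {R L : Type*} [CommRing R] [LieRing L] [LieAlgebra R L]

local notation "𝓤" => UniversalEnvelopingAlgebra

/-- The primitive coproduct `x ↦ x ⊗ 1 + 1 ⊗ x`, as an algebra morphism. -/
def envComul : 𝓤 R L →ₐ[R] 𝓤 R L ⊗[R] 𝓤 R L :=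
  UniversalEnvelopingAlgebra.lift R
    { toFun := fun x => UniversalEnvelopingAlgebra.ι R x ⊗ₜ[R] 1 +
        1 ⊗ₜ[R] UniversalEnvelopingAlgebra.ι R x
      map_add' := fun x y => by
        simp only [map_add, TensorProduct.add_tmul, TensorProduct.tmul_add]; abel
      map_smul' := fun r x => by
        simp only [map_smul, TensorProduct.smul_tmul', TensorProduct.tmul_smul, smul_add,
          RingHom.id_apply]
      map_lie' := fun {x y} => by
        simp only [LieHom.map_lie, LieRing.of_associative_ring_bracket, mul_add, add_mul,
          Algebra.TensorProduct.tmul_mul_tmul, mul_one, one_mul, TensorProduct.sub_tmul,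
          TensorProduct.tmul_sub]
        abel }

/-- The counit `x ↦ 0`, as an algebra morphism. -/
def envCounit : 𝓤 R L →ₐ[R] R := UniversalEnvelopingAlgebra.lift R 0

/-- The antipode `x ↦ -x`, as an algebra morphism to the opposite algebra. -/
def envAntipodeOp : 𝓤 R L →ₐ[R] (𝓤 R L)ᵐᵒᵖ :=
  UniversalEnvelopingAlgebra.lift R
    { toFun := fun x => MulOpposite.op (-UniversalEnvelopingAlgebra.ι R x)
      map_add' := fun x y => by
        rw [map_add, neg_add, MulOpposite.op_add]
      map_smul' := fun r x => by
        simp only [map_smul, RingHom.id_apply, MulOpposite.op_smul, MulOpposite.op_neg, smul_neg]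
      map_lie' := fun {x y} => by
        simp only [LieHom.map_lie, LieRing.of_associative_ring_bracket, ← MulOpposite.op_mul,
          ← MulOpposite.op_sub, neg_mul_neg, neg_sub] }

@[simp] theorem envComul_ι (x : L) :
    envComul (R := R) (UniversalEnvelopingAlgebra.ι R x) =
      UniversalEnvelopingAlgebra.ι R x ⊗ₜ[R] 1 + 1 ⊗ₜ[R] UniversalEnvelopingAlgebra.ι R x :=
  UniversalEnvelopingAlgebra.lift_ι_apply R _ x

@[simp] theorem envCounit_ι (x : L) :
    envCounit (R := R) (UniversalEnvelopingAlgebra.ι R x) = 0 :=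
  UniversalEnvelopingAlgebra.lift_ι_apply R _ x

@[simp] theorem envAntipodeOp_ι (x : L) :
    envAntipodeOp (R := R) (UniversalEnvelopingAlgebra.ι R x) =
      MulOpposite.op (-UniversalEnvelopingAlgebra.ι R x) :=
  UniversalEnvelopingAlgebra.lift_ι_apply R _ x

theorem env_hom_ext {A : Type*} [Ring A] [Algebra R A] {f g : 𝓤 R L →ₐ[R] A}
    (h : ∀ x : L, f (UniversalEnvelopingAlgebra.ι R x) = g (UniversalEnvelopingAlgebra.ι R x)) :
    f = g :=
  UniversalEnvelopingAlgebra.hom_ext R (LieHom.ext h)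

theorem env_induction {p : 𝓤 R L → Prop} (hr : ∀ r : R, p (algebraMap R _ r))
    (hx : ∀ x : L, p (UniversalEnvelopingAlgebra.ι R x))
    (hadd : ∀ a b, p a → p b → p (a + b)) (hmul : ∀ a b, p a → p b → p (a * b))
    (u : 𝓤 R L) : p u := by
  have hs : Function.Surjective (UniversalEnvelopingAlgebra.mkAlgHom R L) :=
    Quotient.mk''_surjective
  obtain ⟨t, rfl⟩ := hs u
  induction t using TensorAlgebra.induction with
  | algebraMap r => simpa only [AlgHom.commutes] using hr r
  | ι x => exact hx x
  | mul a b ha hb => rw [map_mul]; exact hmul _ _ ha hb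
  | add a b ha hb => rw [map_add]; exact hadd _ _ ha hb

instance : Bialgebra R (𝓤 R L) :=
  Bialgebra.ofAlgHom envComul envCounit
    (env_hom_ext fun x => by
      simp [-UniversalEnvelopingAlgebra.ι_apply, TensorProduct.add_tmul, TensorProduct.tmul_add,
        Algebra.TensorProduct.one_def, add_assoc])
    (env_hom_ext fun x => by
      simp [-UniversalEnvelopingAlgebra.ι_apply])
    (env_hom_ext fun x => by
      simp [-UniversalEnvelopingAlgebra.ι_apply])

/-- The antipode `x ↦ -x`, extended as an anti-automorphism. -/
def envAntipode : 𝓤 R L →ₗ[R] 𝓤 R L :=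
  (MulOpposite.opLinearEquiv R).symm.toLinearMap ∘ₗ envAntipodeOp.toLinearMap

theorem envAntipode_mul (a b : 𝓤 R L) :
    envAntipode (R := R) (a * b) = envAntipode (R := R) b * envAntipode (R := R) a := by
  simp [envAntipode]

theorem envAntipode_ι (x : L) : envAntipode (R := R) (UniversalEnvelopingAlgebra.ι R x) =
    -UniversalEnvelopingAlgebra.ι R x := by
  simp [envAntipode, -UniversalEnvelopingAlgebra.ι_apply]

theorem envAntipode_algebraMap (r : R) :
    envAntipode (R := R) (algebraMap R (𝓤 R L) r) = algebraMap R _ r := by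
  simp [envAntipode]

theorem env_antipode_left (u : 𝓤 R L) :
    LinearMap.mul' R (𝓤 R L) ((envAntipode (R := R)).rTensor (𝓤 R L) (envComul (R := R) u)) =
      algebraMap R _ (envCounit (R := R) u) := by
  have key : ∀ (d : 𝓤 R L ⊗[R] 𝓤 R L) (a b : 𝓤 R L),
      LinearMap.mul' R (𝓤 R L) ((envAntipode (R := R)).rTensor (𝓤 R L) (d * a ⊗ₜ b)) =
        envAntipode (R := R) a *
          LinearMap.mul' R (𝓤 R L) ((envAntipode (R := R)).rTensor (𝓤 R L) d) * b := by
    intro d a b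
    induction d with
    | zero => simp
    | tmul x y => simp [envAntipode_mul, mul_assoc]
    | add x y hx hy => simp only [add_mul, map_add, mul_add, hx, hy]
  have key2 : ∀ (d t : 𝓤 R L ⊗[R] 𝓤 R L) (r : R),
      LinearMap.mul' R (𝓤 R L) ((envAntipode (R := R)).rTensor (𝓤 R L) d) = algebraMap R _ r →
      LinearMap.mul' R (𝓤 R L) ((envAntipode (R := R)).rTensor (𝓤 R L) (d * t)) =
        algebraMap R _ r *
          LinearMap.mul' R (𝓤 R L) ((envAntipode (R := R)).rTensor (𝓤 R L) t) := by
    intro d t r h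
    induction t with
    | zero => simp
    | tmul x y => rw [key, h, ← Algebra.commutes]; simp [mul_assoc]
    | add x y hx hy => simp only [mul_add, map_add, hx, hy]
  induction u using env_induction (R := R) with
  | hr r => simp [Algebra.TensorProduct.algebraMap_apply, envAntipode_algebraMap]
  | hx x =>
    rw [envComul_ι, envCounit_ι]
    have h1 := envAntipode_algebraMap (R := R) (L := L) 1
    rw [map_one] at h1
    simp [-UniversalEnvelopingAlgebra.ι_apply, envAntipode_ι, h1]
  | hadd a b ha hb => simp only [map_add, ha, hb]
  | hmul a b ha hb => rw [map_mul, key2 _ _ _ ha, hb, map_mul, map_mul]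

theorem env_antipode_right (u : 𝓤 R L) :
    LinearMap.mul' R (𝓤 R L) ((envAntipode (R := R)).lTensor (𝓤 R L) (envComul (R := R) u)) =
      algebraMap R _ (envCounit (R := R) u) := by
  have key : ∀ (d : 𝓤 R L ⊗[R] 𝓤 R L) (a b : 𝓤 R L),
      LinearMap.mul' R (𝓤 R L) ((envAntipode (R := R)).lTensor (𝓤 R L) (a ⊗ₜ b * d)) =
        a * LinearMap.mul' R (𝓤 R L) ((envAntipode (R := R)).lTensor (𝓤 R L) d) *
          envAntipode (R := R) b := by
    intro d a b
    induction d with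
    | zero => simp
    | tmul x y => simp [envAntipode_mul, mul_assoc]
    | add x y hx hy => simp only [add_mul, map_add, mul_add, hx, hy]
  have key2 : ∀ (d t : 𝓤 R L ⊗[R] 𝓤 R L) (r : R),
      LinearMap.mul' R (𝓤 R L) ((envAntipode (R := R)).lTensor (𝓤 R L) d) = algebraMap R _ r →
      LinearMap.mul' R (𝓤 R L) ((envAntipode (R := R)).lTensor (𝓤 R L) (t * d)) =
        algebraMap R _ r *
          LinearMap.mul' R (𝓤 R L) ((envAntipode (R := R)).lTensor (𝓤 R L) t) := by
    intro d t r h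
    induction t with
    | zero => simp
    | tmul x y => rw [key, h, ← Algebra.commutes]; simp [mul_assoc]
    | add x y hx hy => simp only [mul_add, add_mul, map_add, hx, hy]
  induction u using env_induction (R := R) with
  | hr r =>
    have h1 := envAntipode_algebraMap (R := R) (L := L) 1
    rw [map_one] at h1
    simp [Algebra.TensorProduct.algebraMap_apply, h1]
  | hx x =>
    rw [envComul_ι, envCounit_ι]
    have h1 := envAntipode_algebraMap (R := R) (L := L) 1
    rw [map_one] at h1
    simp [-UniversalEnvelopingAlgebra.ι_apply, envAntipode_ι, h1]
  | hadd a b ha hb => simp only [map_add, ha, hb]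
  | hmul a b ha hb => rw [map_mul, key2 _ _ _ hb, ha, map_mul, ← map_mul, mul_comm, map_mul]

instance : HopfAlgebra R (𝓤 R L) where
  antipode := envAntipode
  mul_antipode_rTensor_comul := LinearMap.ext env_antipode_left
  mul_antipode_lTensor_comul := LinearMap.ext env_antipode_right

end Enveloping

/-! ### Formal power series in `z` with noncommutative coefficients -/

section Formal

variable {A B : Type*} [Ring A] [Algebra ℝ A] [Ring B] [Algebra ℝ B]

/-- The `z`-linear extension of a linear map to formal power series, coefficient by coefficient. -/
def mapCoeff (φ : A →ₗ[ℝ] B) (f : PowerSeries A) : PowerSeries B :=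
  PowerSeries.mk fun n => φ (PowerSeries.coeff n f)

/-- The `z`-linear and `z`-adically continuous extension of a linear map with values in formal
power series. -/
def extCoeff (φ : A →ₗ[ℝ] PowerSeries B) (f : PowerSeries A) : PowerSeries B :=
  PowerSeries.mk fun n => ∑ p ∈ Finset.HasAntidiagonal.antidiagonal n,
    PowerSeries.coeff p.2 (φ (PowerSeries.coeff p.1 f))

/-- `exp f = ∑ fᵏ / k!`, for `f` without constant term: the powers `fᵏ` with `k > n` do not
contribute to the coefficient of `zⁿ`. -/
def zexp (f : PowerSeries A) : PowerSeries A :=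
  PowerSeries.mk fun n => ∑ k ∈ Finset.range (n + 1),
    ((k.factorial : ℝ)⁻¹) • PowerSeries.coeff n (f ^ k)

/-- `ln (1 + f) = ∑_{k ≥ 1} (-1)ᵏ⁺¹ fᵏ / k`, for `f` without constant term. -/
def zlog (f : PowerSeries A) : PowerSeries A :=
  PowerSeries.mk fun n => ∑ k ∈ Finset.Icc 1 n,
    ((-1 : ℝ) ^ (k + 1) / k) • PowerSeries.coeff n (f ^ k)

/-- `cosh f = (exp f + exp (-f)) / 2`. -/
def zcosh (f : PowerSeries A) : PowerSeries A := (1 / 2 : ℝ) • (zexp f + zexp (-f))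

/-- `sinh f = (exp f - exp (-f)) / 2`. -/
def zsinh (f : PowerSeries A) : PowerSeries A := (1 / 2 : ℝ) • (zexp f - zexp (-f))

/-- `z⁻¹ f`, for `f` without constant term. -/
def zdiv (f : PowerSeries A) : PowerSeries A :=
  PowerSeries.mk fun n => PowerSeries.coeff (n + 1) f

theorem X_mul_zdiv (f : PowerSeries A) (hf : PowerSeries.constantCoeff f = 0) :
    PowerSeries.X * zdiv f = f := by
  ext n
  cases n with
  | zero => simpa using hf.symm
  | succ n => simp [zdiv, PowerSeries.coeff_succ_X_mul]

/-- The pure tensor `f ⊗ g` in the completed tensor product `A[[z]] ⊗ A[[z]] = (A ⊗ A)[[z]]`. -/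
def ztmul (f g : PowerSeries A) : PowerSeries (A ⊗[ℝ] A) :=
  PowerSeries.mapAlgHom (R := ℝ) Algebra.TensorProduct.includeLeft f *
    PowerSeries.mapAlgHom (R := ℝ) Algebra.TensorProduct.includeRight g

end Formal

infixl:75 " ⊠ " => ztmul

/-! ### Drinfeld twists of a Hopf algebra `A`, over formal power series

The completed tensor powers of `A[[z]]` are `(A ⊗ A)[[z]]` and `(A ⊗ A ⊗ A)[[z]]`. -/

section Twist

variable {A : Type*} [Ring A] [HopfAlgebra ℝ A]

/-- `a ⊗ b ↦ a ⊗ b ⊗ 1`. -/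
def leg12 : PowerSeries (A ⊗[ℝ] A) →ₐ[ℝ] PowerSeries (A ⊗[ℝ] (A ⊗[ℝ] A)) :=
  PowerSeries.mapAlgHom
    (Algebra.TensorProduct.map (AlgHom.id ℝ A) Algebra.TensorProduct.includeLeft)

/-- `a ⊗ b ↦ a ⊗ 1 ⊗ b`. -/
def leg13 : PowerSeries (A ⊗[ℝ] A) →ₐ[ℝ] PowerSeries (A ⊗[ℝ] (A ⊗[ℝ] A)) :=
  PowerSeries.mapAlgHom
    (Algebra.TensorProduct.map (AlgHom.id ℝ A) Algebra.TensorProduct.includeRight)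

/-- `a ⊗ b ↦ 1 ⊗ a ⊗ b`. -/
def leg23 : PowerSeries (A ⊗[ℝ] A) →ₐ[ℝ] PowerSeries (A ⊗[ℝ] (A ⊗[ℝ] A)) :=
  PowerSeries.mapAlgHom Algebra.TensorProduct.includeRight

/-- The flip `τ : a ⊗ b ↦ b ⊗ a`. -/
def zflip : PowerSeries (A ⊗[ℝ] A) →ₐ[ℝ] PowerSeries (A ⊗[ℝ] A) :=
  PowerSeries.mapAlgHom (Algebra.TensorProduct.comm ℝ A A).toAlgHom

/-- The undeformed coproduct `Δ`. -/
def zcomul : PowerSeries A →ₐ[ℝ] PowerSeries (A ⊗[ℝ] A) :=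
  PowerSeries.mapAlgHom (Bialgebra.comulAlgHom ℝ A)

/-- `Δ ⊗ id`. -/
def zcomulLeft : PowerSeries (A ⊗[ℝ] A) →ₐ[ℝ] PowerSeries (A ⊗[ℝ] (A ⊗[ℝ] A)) :=
  PowerSeries.mapAlgHom ((Algebra.TensorProduct.assoc ℝ ℝ ℝ A A A).toAlgHom.comp
    (Algebra.TensorProduct.map (Bialgebra.comulAlgHom ℝ A) (AlgHom.id ℝ A)))

/-- `id ⊗ Δ`. -/
def zcomulRight : PowerSeries (A ⊗[ℝ] A) →ₐ[ℝ] PowerSeries (A ⊗[ℝ] (A ⊗[ℝ] A)) :=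
  PowerSeries.mapAlgHom
    (Algebra.TensorProduct.map (AlgHom.id ℝ A) (Bialgebra.comulAlgHom ℝ A))

/-- The counit `ε`, with values in `ℝ[[z]] ⊆ A[[z]]`. -/
def zcounit : PowerSeries A →ₐ[ℝ] PowerSeries A :=
  PowerSeries.mapAlgHom ((Algebra.ofId ℝ A).comp (Bialgebra.counitAlgHom ℝ A))

/-- `ε ⊗ id : a ⊗ b ↦ ε(a) b`. -/
def zcounitLeft : PowerSeries (A ⊗[ℝ] A) →ₐ[ℝ] PowerSeries A :=
  PowerSeries.mapAlgHom ((Algebra.TensorProduct.lid ℝ A).toAlgHom.comp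
    (Algebra.TensorProduct.map (Bialgebra.counitAlgHom ℝ A) (AlgHom.id ℝ A)))

/-- `id ⊗ ε : a ⊗ b ↦ a ε(b)`. -/
def zcounitRight : PowerSeries (A ⊗[ℝ] A) →ₐ[ℝ] PowerSeries A :=
  PowerSeries.mapAlgHom ((Algebra.TensorProduct.rid ℝ ℝ A).toAlgHom.comp
    (Algebra.TensorProduct.map (AlgHom.id ℝ A) (Bialgebra.counitAlgHom ℝ A)))

/-- `F` is a twisting element: it is invertible, `(ε ⊗ id) F = (id ⊗ ε) F = 1` and
`F₁₂ (Δ ⊗ id) F = F₂₃ (id ⊗ Δ) F`. -/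
structure IsTwist (F : PowerSeries (A ⊗[ℝ] A)) : Prop where
  isUnit : IsUnit F
  counit_left : zcounitLeft F = 1
  counit_right : zcounitRight F = 1
  cocycle : leg12 F * zcomulLeft F = leg23 F * zcomulRight F

/-- The twisted coproduct `Δ_F a = F (Δ a) F⁻¹`. -/
def twComul (F : PowerSeries (A ⊗[ℝ] A)) (a : PowerSeries A) : PowerSeries (A ⊗[ℝ] A) :=
  F * zcomul a * Ring.inverse F

/-- `Δ_F ⊗ id`, that is, `x ↦ F₁₂ ((Δ ⊗ id) x) F₁₂⁻¹`. -/
def twComulLeft (F x : PowerSeries (A ⊗[ℝ] A)) : PowerSeries (A ⊗[ℝ] (A ⊗[ℝ] A)) :=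
  leg12 F * zcomulLeft x * Ring.inverse (leg12 F)

/-- `id ⊗ Δ_F`, that is, `x ↦ F₂₃ ((id ⊗ Δ) x) F₂₃⁻¹`. -/
def twComulRight (F x : PowerSeries (A ⊗[ℝ] A)) : PowerSeries (A ⊗[ℝ] (A ⊗[ℝ] A)) :=
  leg23 F * zcomulRight x * Ring.inverse (leg23 F)

/-- The element `v = ∑ f⁽¹⁾ S(f⁽²⁾)` of a twisting element `F = ∑ f⁽¹⁾ ⊗ f⁽²⁾`. -/
def twElt (F : PowerSeries (A ⊗[ℝ] A)) : PowerSeries A :=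
  mapCoeff (LinearMap.mul' ℝ A ∘ₗ (HopfAlgebra.antipode ℝ (A := A)).lTensor A) F

/-- The twisted antipode `S_F a = v S(a) v⁻¹`. -/
def twAntipode (F : PowerSeries (A ⊗[ℝ] A)) (a : PowerSeries A) : PowerSeries A :=
  twElt F * mapCoeff (HopfAlgebra.antipode ℝ (A := A)) a * Ring.inverse (twElt F)

/-- `a ↦ a` as a linear map from `A` to `A[[z]]`. -/
def constLin : A →ₗ[ℝ] PowerSeries A where
  toFun a := PowerSeries.C a
  map_add' a b := map_add _ a b
  map_smul' r a := by
    ext n; by_cases hn : n = 0 <;> simp [PowerSeries.coeff_C, hn]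

/-- The restriction of `S_F` to `A`, as a linear map. -/
def twAntipodeLin (F : PowerSeries (A ⊗[ℝ] A)) : A →ₗ[ℝ] PowerSeries A where
  toFun a := twAntipode F (PowerSeries.C a)
  map_add' a b := by
    have h : mapCoeff (HopfAlgebra.antipode ℝ (A := A)) (PowerSeries.C (a + b)) =
        mapCoeff (HopfAlgebra.antipode ℝ (A := A)) (PowerSeries.C a) +
        mapCoeff (HopfAlgebra.antipode ℝ (A := A)) (PowerSeries.C b) := by
      ext n; simp [mapCoeff]
    simp only [twAntipode, h, mul_add, add_mul]
  map_smul' r a := by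
    have h : mapCoeff (HopfAlgebra.antipode ℝ (A := A)) (PowerSeries.C (r • a)) =
        r • mapCoeff (HopfAlgebra.antipode ℝ (A := A)) (PowerSeries.C a) := by
      ext n; by_cases hn : n = 0 <;> simp [mapCoeff, PowerSeries.coeff_C, hn]
    simp [twAntipode, h]

/-- `m (S_F ⊗ id) : a ⊗ b ↦ S_F(a) b`. -/
def mulAntipodeLeft (F : PowerSeries (A ⊗[ℝ] A)) : PowerSeries (A ⊗[ℝ] A) → PowerSeries A :=
  extCoeff (LinearMap.mul' ℝ (PowerSeries A) ∘ₗ TensorProduct.map (twAntipodeLin F) constLin)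

/-- `m (id ⊗ S_F) : a ⊗ b ↦ a S_F(b)`. -/
def mulAntipodeRight (F : PowerSeries (A ⊗[ℝ] A)) : PowerSeries (A ⊗[ℝ] A) → PowerSeries A :=
  extCoeff (LinearMap.mul' ℝ (PowerSeries A) ∘ₗ TensorProduct.map constLin (twAntipodeLin F))

/-- The algebra `A[[z]]` with the coproduct `Δ_F`, the counit `ε` and the antipode `S_F` is a
(topological) Hopf algebra. -/
structure IsTwistedHopfAlgebra (F : PowerSeries (A ⊗[ℝ] A)) : Prop where
  comul_one : twComul F 1 = 1
  comul_mul : ∀ a b, twComul F (a * b) = twComul F a * twComul F b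
  coassoc : ∀ a, twComulLeft F (twComul F a) = twComulRight F (twComul F a)
  counit_left : ∀ a, zcounitLeft (twComul F a) = a
  counit_right : ∀ a, zcounitRight (twComul F a) = a
  antipode_left : ∀ a, mulAntipodeLeft F (twComul F a) = zcounit a
  antipode_right : ∀ a, mulAntipodeRight F (twComul F a) = zcounit a

/-- `ℛ` is a universal `R`-matrix (quasitriangular structure) of the twisted Hopf algebra. -/
structure IsUniversalRMatrix (F ℛ : PowerSeries (A ⊗[ℝ] A)) : Prop where
  isUnit : IsUnit ℛ
  intertwines : ∀ a, ℛ * twComul F a = zflip (twComul F a) * ℛ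
  comul_left : twComulLeft F ℛ = leg13 ℛ * leg23 ℛ
  comul_right : twComulRight F ℛ = leg13 ℛ * leg12 ℛ

/-- The image of `B[[z]]` in `A[[z]]`. -/
def formalImage {B : Type*} [Ring B] [Algebra ℝ B] (g : B →ₐ[ℝ] A) :
    Subalgebra ℝ (PowerSeries A) :=
  (PowerSeries.mapAlgHom g).range

/-- The image of `(B ⊗ B)[[z]]` in `(A ⊗ A)[[z]]`. -/
def formalImage₂ {B : Type*} [Ring B] [Algebra ℝ B] (g : B →ₐ[ℝ] A) :
    Subalgebra ℝ (PowerSeries (A ⊗[ℝ] A)) :=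
  (PowerSeries.mapAlgHom (Algebra.TensorProduct.map g g)).range

end Twist

/-! ### The Lie algebra `so(4,2)` in the conformal basis -/

section Conformal

attribute [local instance 100] LieRing.ofAssociativeRing

/-- The real Lie algebra `so(4,2)` of the quadratic form of signature `(+,+,+,+,-,-)`. -/
def SO42 : Type := LieAlgebra.Orthogonal.so' (Fin 4) (Fin 2) ℝ

instance : LieRing SO42 := inferInstanceAs (LieRing (LieAlgebra.Orthogonal.so' (Fin 4) (Fin 2) ℝ))

instance : LieAlgebra ℝ SO42 :=
  inferInstanceAs (LieAlgebra ℝ (LieAlgebra.Orthogonal.so' (Fin 4) (Fin 2) ℝ))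

/-- The signature of the quadratic form. -/
def sgn : Fin 4 ⊕ Fin 2 → ℝ := Sum.elim (fun _ => 1) fun _ => -1

/-- The infinitesimal rotation in the `(a, b)`-plane. -/
def rotM (a b : Fin 4 ⊕ Fin 2) : SO42 :=
  ⟨Matrix.single a b (sgn b) - Matrix.single b a (sgn a), by
    simp only [LieAlgebra.Orthogonal.so', mem_skewAdjointMatricesLieSubalgebra,
      mem_skewAdjointMatricesSubmodule, Matrix.IsSkewAdjoint, Matrix.IsAdjointPair,
      LieAlgebra.Orthogonal.indefiniteDiagonal]
    ext i j
    simp only [Matrix.transpose_sub, Matrix.transpose_single, Matrix.mul_diagonal,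
      Matrix.diagonal_mul, Matrix.sub_apply, Matrix.neg_apply, Matrix.single_apply]
    by_cases h1 : b = i <;> by_cases h2 : a = j <;> by_cases h3 : a = i <;>
      by_cases h4 : b = j <;> simp_all [sgn]⟩

theorem rotM_self (a : Fin 4 ⊕ Fin 2) : rotM a a = 0 := Subtype.ext (sub_self _)

theorem rotM_swap (a b : Fin 4 ⊕ Fin 2) : rotM b a = -rotM a b :=
  Subtype.ext (neg_sub _ _).symm

theorem rotM_lie (a b c d : Fin 4 ⊕ Fin 2) :
    ⁅rotM a b, rotM c d⁆ = (if b = c then sgn b else 0) • rotM a d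
      - (if a = c then sgn a else 0) • rotM b d - (if b = d then sgn b else 0) • rotM a c
      + (if a = d then sgn a else 0) • rotM b c := by
  have key : ∀ a b c d : Fin 4 ⊕ Fin 2,
      ⁅Matrix.single a b (sgn b) - Matrix.single b a (sgn a),
        Matrix.single c d (sgn d) - Matrix.single d c (sgn c)⁆ =
      (if b = c then sgn b else 0) • (Matrix.single a d (sgn d) - Matrix.single d a (sgn a))
      - (if a = c then sgn a else 0) • (Matrix.single b d (sgn d) - Matrix.single d b (sgn b))
      - (if b = d then sgn b else 0) • (Matrix.single a c (sgn c) - Matrix.single c a (sgn a))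
      + (if a = d then sgn a else 0) •
        (Matrix.single b c (sgn c) - Matrix.single c b (sgn b)) := by
    intro a b c d
    rw [LieRing.of_associative_ring_bracket]
    by_cases h1 : b = c <;> by_cases h2 : a = c <;> by_cases h3 : b = d <;>
      by_cases h4 : a = d <;>
      simp_all [sub_mul, mul_sub, Matrix.single_mul_single_same, Matrix.single_mul_single_of_ne,
        eq_comm, smul_sub, Matrix.smul_single, mul_comm] <;> try abel
  exact Subtype.ext (key a b c d)

/-- The Levi-Civita symbol on three indices; the addition of indices is modulo `3`. -/
def eps (i j k : Fin 3) : ℝ :=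
  if j = i + 1 ∧ k = i + 2 then 1 else if j = i + 2 ∧ k = i + 1 then -1 else 0

/-- The coordinate directions `x⁰, x¹, x², x³` of Minkowski space. -/
def dir : Fin 4 → Fin 4 ⊕ Fin 2 := ![.inr 0, .inl 0, .inl 1, .inl 2]

/-- The rotations `J₁, J₂, J₃`. -/
def rotJ : Fin 3 → SO42 := ![rotM (dir 3) (dir 2), rotM (dir 1) (dir 3), rotM (dir 2) (dir 1)]

/-- The boosts `K₁, K₂, K₃`. -/
def boostK (i : Fin 3) : SO42 := rotM (dir 0) (dir i.succ)

/-- The dilation `D`. -/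
def dil : SO42 := rotM (.inr 1) (.inl 3)

/-- The translations `P₀, P₁, P₂, P₃`. -/
def transP (μ : Fin 4) : SO42 := rotM (dir μ) (.inl 3) + rotM (dir μ) (.inr 1)

/-- The conformal transformations `C₀, C₁, C₂, C₃`. -/
def confC (μ : Fin 4) : SO42 :=
  (1 / 2 : ℝ) • (rotM (dir μ) (.inl 3) - rotM (dir μ) (.inr 1))

theorem dir_inj {μ ν : Fin 4} : dir μ = dir ν ↔ μ = ν := by
  revert μ ν; decide

theorem dir_ne_inl (μ : Fin 4) : dir μ ≠ .inl 3 := by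
  revert μ; decide

theorem dir_ne_inr (μ : Fin 4) : dir μ ≠ .inr 1 := by
  revert μ; decide

theorem sgn_dir_zero : sgn (dir 0) = -1 := rfl

theorem sgn_dir_succ (i : Fin 3) : sgn (dir i.succ) = 1 := by
  fin_cases i <;> rfl

/-- The commutation relations of `so(4,2)` in the conformal basis. -/
theorem so42_relations (i j : Fin 3) :
    ⁅rotJ i, rotJ j⁆ = ∑ k, eps i j k • rotJ k ∧
    ⁅rotJ i, boostK j⁆ = ∑ k, eps i j k • boostK k ∧
    ⁅rotJ i, transP j.succ⁆ = ∑ k : Fin 3, eps i j k • transP k.succ ∧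
    ⁅rotJ i, confC j.succ⁆ = ∑ k : Fin 3, eps i j k • confC k.succ ∧
    ⁅boostK i, boostK j⁆ = -∑ k, eps i j k • rotJ k ∧
    ⁅transP i.succ, confC j.succ⁆ =
      -(if i = j then dil else 0) + ∑ k : Fin 3, eps i j k • rotJ k := by
  have hl := dir_ne_inl
  have hr := dir_ne_inr
  have hl' := fun μ => (dir_ne_inl μ).symm
  have hr' := fun μ => (dir_ne_inr μ).symm
  have h0 := sgn_dir_zero
  have h1 : sgn (dir 1) = 1 := rfl
  have h2 : sgn (dir 2) = 1 := rfl
  have h3 : sgn (dir 3) = 1 := rfl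
  have h4 : sgn (.inl 3) = 1 := rfl
  have h5 : sgn (.inr 1) = -1 := rfl
  refine ⟨?_, ?_, ?_, ?_, ?_, ?_⟩
  all_goals
    fin_cases i <;> fin_cases j
  all_goals
    simp only [rotJ, boostK, dil, transP, confC, lie_add, add_lie, lie_sub, sub_lie, lie_smul,
      smul_lie, Fin.sum_univ_three]
    simp [rotM_lie, dir_inj, rotM_self, eps, hl, hr, hl', hr', h0, h1, h2, h3, h4, h5,
      rotM_swap (.inl 3) (.inr 1), rotM_swap (dir 0) (dir 1), rotM_swap (dir 0) (dir 2), rotM_swap (dir 0) (dir 3),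
      rotM_swap (dir 1) (dir 2), rotM_swap (dir 1) (dir 3), rotM_swap (dir 2) (dir 3)]
    try module

/-- The remaining commutation relations of `so(4,2)` in the conformal basis. -/
theorem so42_relations' (i j : Fin 3) (μ ν : Fin 4) :
    ⁅rotJ i, transP 0⁆ = 0 ∧ ⁅rotJ i, confC 0⁆ = 0 ∧ ⁅rotJ i, dil⁆ = 0 ∧
    ⁅boostK i, transP j.succ⁆ = (if i = j then transP 0 else 0) ∧
    ⁅boostK i, confC j.succ⁆ = (if i = j then confC 0 else 0) ∧
    ⁅boostK i, transP 0⁆ = transP i.succ ∧ ⁅boostK i, confC 0⁆ = confC i.succ ∧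
    ⁅boostK i, dil⁆ = 0 ∧
    ⁅transP 0, confC 0⁆ = dil ∧ ⁅transP 0, confC i.succ⁆ = -boostK i ∧
    ⁅transP i.succ, confC 0⁆ = boostK i ∧
    ⁅transP μ, dil⁆ = -transP μ ∧ ⁅confC μ, dil⁆ = confC μ ∧
    ⁅transP μ, transP ν⁆ = 0 ∧ ⁅confC μ, confC ν⁆ = 0 := by
  have hl := dir_ne_inl
  have hr := dir_ne_inr
  have hl' := fun μ => (dir_ne_inl μ).symm
  have hr' := fun μ => (dir_ne_inr μ).symm
  have h0 := sgn_dir_zero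
  have h1 := sgn_dir_succ
  have h2 : sgn (.inl 3) = 1 := rfl
  have h3 : sgn (.inr 1) = -1 := rfl
  have hz : ∀ i : Fin 3, (0 : Fin 4) ≠ i.succ := fun i => (Fin.succ_ne_zero i).symm
  refine ⟨?_, ?_, ?_, ?_, ?_, ?_, ?_, ?_, ?_, ?_, ?_, ?_, ?_, ?_, ?_⟩
  · fin_cases i <;> simp [rotJ, transP, rotM_lie, dir_inj, hl, hr]
  · fin_cases i <;> simp [rotJ, confC, rotM_lie, dir_inj, hl, hr]
  · fin_cases i <;> simp [rotJ, dil, rotM_lie, hl, hr]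
  all_goals
    simp only [boostK, dil, transP, confC, lie_add, add_lie, lie_sub, sub_lie, lie_smul, smul_lie]
    simp [rotM_lie, dir_inj, rotM_self, hl, hr, hl', hr', h0, h1, h2, h3, hz,
      rotM_swap (.inl 3) (.inr 1), rotM_swap (.inl 3) (dir _), rotM_swap (.inr 1) (dir _)]
  all_goals try rw [rotM_swap (dir 0) (dir i.succ)]
  all_goals (try split_ifs) <;> module

/-- The Weyl–Poincaré subalgebra, generated by rotations, boosts, translations and the dilation. -/
def weylPoincare : LieSubalgebra ℝ SO42 :=
  LieSubalgebra.lieSpan ℝ SO42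
    (Set.range rotJ ∪ Set.range boostK ∪ Set.range transP ∪ {dil})

/-- The universal enveloping algebra of `so(4,2)`. -/
abbrev U42 : Type := UniversalEnvelopingAlgebra ℝ SO42

/-- The inclusion of a Lie algebra element in the enveloping algebra. -/
def toU (x : SO42) : U42 := UniversalEnvelopingAlgebra.ι ℝ x

/-- The map `U(𝒲𝒫) → U(so(4,2))` induced by the inclusion. -/
def weylPoincareToU : UniversalEnvelopingAlgebra ℝ weylPoincare →ₐ[ℝ] U42 :=
  UniversalEnvelopingAlgebra.lift ℝ
    ((UniversalEnvelopingAlgebra.ι ℝ : SO42 →ₗ⁅ℝ⁆ U42).comp weylPoincare.incl)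

end Conformal

/-! ### The twisted algebra `U_z(so(4,2))` in the null-plane basis -/

/-- `U(so(4,2))[[z]]`, the underlying algebra of `U_z(so(4,2))`. -/
abbrev Uz : Type := PowerSeries U42

/-- The underlying algebra of the completed tensor square of `U_z(so(4,2))`. -/
abbrev Uz₂ : Type := PowerSeries (U42 ⊗[ℝ] U42)

/-- An element of `so(4,2)`, as an element of `U_z(so(4,2))`. -/
def emb (x : SO42) : Uz := PowerSeries.C (toU x)

/-- The deformation parameter. -/
def z : Uz := PowerSeries.X

/-- The deformation parameter in the tensor square. -/
def z₂ : Uz₂ := PowerSeries.X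

/-- The twisted Weyl–Poincaré algebra `U_z(𝒲𝒫) = U(𝒲𝒫)[[z]]` inside `U_z(so(4,2))`. -/
def UzWP : Subalgebra ℝ Uz := formalImage weylPoincareToU

/-- The completed tensor square of `U_z(𝒲𝒫)` inside that of `U_z(so(4,2))`. -/
def UzWP₂ : Subalgebra ℝ Uz₂ := formalImage₂ weylPoincareToU

namespace NullPlane

/-! The null-plane generators `H₊, H₋, T₊, T₋, T₂, T₃, B₂, B₃, A₂, A₃` as linear combinations of the
conformal ones; recall that `boostK 1` is `K₂`, `rotJ 2` is `J₃`, and so on. -/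

def Hp : Uz := emb ((1 / 2 : ℝ) • (dil + boostK 0))
def Hm : Uz := emb ((1 / 2 : ℝ) • (dil - boostK 0))
def Tp : Uz := emb ((1 / 2 : ℝ) • (transP 0 + transP 1))
def Tm : Uz := emb ((1 / 2 : ℝ) • (transP 0 - transP 1))
def T2 : Uz := emb ((1 / 2 : ℝ) • (transP 2 - transP 3))
def T3 : Uz := emb ((1 / 2 : ℝ) • (transP 2 + transP 3))
def B2 : Uz := emb ((1 / 2 : ℝ) • (boostK 1 + rotJ 2 - boostK 2 + rotJ 1))
def B3 : Uz := emb ((1 / 2 : ℝ) • (boostK 1 + rotJ 2 + boostK 2 - rotJ 1))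
def A2 : Uz := emb ((1 / 2 : ℝ) • (boostK 1 - rotJ 2 - boostK 2 - rotJ 1))
def A3 : Uz := emb ((1 / 2 : ℝ) • (boostK 1 - rotJ 2 + boostK 2 + rotJ 1))

/-- `σ₋ = ln(1 - 2 z T₋)`. -/
def σm : Uz := zlog (-((2 : ℝ) • (z * Tm)))

/-- `T = T₊ + z (T₂² + T₃²) exp(-σ₋)`. -/
def T : Uz := Tp + z * (T2 ^ 2 + T3 ^ 2) * zexp (-σm)

/-- `σ₊ = ln(1 - 2 z T)`. -/
def σp : Uz := zlog (-((2 : ℝ) • (z * T)))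

/-- `Φ_𝒥 = exp(H₋ ⊗ σ₋)`. -/
def ΦJ : Uz₂ := zexp (Hm ⊠ σm)

/-- `Φ_ℰ = exp(-2 z B₃ ⊗ T₃ exp(-σ₋/2)) exp(-2 z B₂ ⊗ T₂ exp(-σ₋/2))`. -/
def ΦE : Uz₂ :=
  zexp (-((2 : ℝ) • (z₂ * (B3 ⊠ (T3 * zexp (-((1 / 2 : ℝ) • σm))))))) *
  zexp (-((2 : ℝ) • (z₂ * (B2 ⊠ (T2 * zexp (-((1 / 2 : ℝ) • σm)))))))

/-- `Φ_𝒜 = exp(H₊ ⊗ σ₊)`. -/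
def ΦA : Uz₂ := zexp (Hp ⊠ σp)

/-- The twisting element `ℱ = Φ_𝒜 Φ_ℰ Φ_𝒥`. -/
def twist : Uz₂ := ΦA * ΦE * ΦJ

end NullPlane

/-! ### The deformed conformal generators, obtained by the nonlinear change of basis -/

open NullPlane in
/-- The deformed translations `P₀, P₁, P₂, P₃`. -/
def Pz : Fin 4 → Uz :=
  ![-((1 / 2 : ℝ) • zdiv (σp + σm)), -((1 / 2 : ℝ) • zdiv (σp - σm)),
    (T3 + T2) * zexp (-σm), (T3 - T2) * zexp (-σm)]

open NullPlane in
/-- The dilation `D`. -/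
def Dz : Uz := Hp + Hm

open NullPlane in
/-- The boosts `K₁, K₂, K₃`. -/
def Kz : Fin 3 → Uz :=
  ![Hp - Hm, (1 / 2 : ℝ) • (A3 + A2 + B3 + B2), (1 / 2 : ℝ) • (A3 - A2 + B3 - B2)]

open NullPlane in
/-- The rotations `J₁, J₂, J₃`. -/
def Jz : Fin 3 → Uz :=
  ![emb (rotJ 0), (1 / 2 : ℝ) • (A3 - A2 - B3 + B2), -((1 / 2 : ℝ) • (A3 + A2 - B3 - B2))]

/-- `x ∧ y = x ⊗ y - y ⊗ x` for `x, y` in `so(4,2)`. -/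
def wedge (x y : SO42) : U42 ⊗[ℝ] U42 := toU x ⊗ₜ[ℝ] toU y - toU y ⊗ₜ[ℝ] toU x

/-- The classical `r`-matrix, divided by the deformation parameter. -/
def classicalR : U42 ⊗[ℝ] U42 :=
  wedge dil (transP 0) + wedge (boostK 0) (transP 1) + wedge (boostK 1) (transP 2) +
    wedge (boostK 2) (transP 3) + (wedge (rotJ 2) (transP 2) - wedge (rotJ 1) (transP 3))

end TwistedConformal

end

open TwistedConformal TwistedConformal.NullPlane

/-!
The second legs of all exponents in `Φ_𝒥`, `Φ_ℰ`, `Φ_𝒜` are formal series in the translations, and the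
translations commute. Such series form a commutative ring `Cz`, embedded in `U_z(so(4,2))` by `val`,
so that every identity below becomes one between sums of tensors `S ⊗ p` with `S` in `U_z(so(4,2))`
and `p` in `Cz`, hence one between coefficients in a commutative ring.

*The change of basis.* The elements `σ₋` and `σ₊` are logarithms, so `P₀` and `P₁` are defined by
`e^{σ∓} = e^{-z P₀} e^{±z P₁}`, and the undeformed translations become polynomials in the four
exponentials `e^{±z P₀}`, `e^{±z P₁}` and in `P₂`, `P₃`, divided by `z` (`two_mul_X_mul_tP_zero`,
`tP_two`). Commutation with a generator is a derivation, so the deformed commutators follow from the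
undeformed ones by the chain rule for `exp` and `ln` (`brk_cPz`).

*The compact form.* The generators `K₂ + J₃` and `K₃ - J₂` are eigenvectors of `ad H₊`. Moving `Φ_ℰ`
past `Φ_𝒜` therefore only rescales its exponents, and `Φ_𝒜 Φ_𝒥` recombines into exponentials of
`K₁ ⊗ P₁` and `D ⊗ P₀`. This gives `F` as a product of four exponentials (`twist_eq`), with
exponents `x ⊗ p` in which `x` is primitive.

*The coproduct.* Conjugation by each of the four factors is elementary: a commuting element is fixed,
an eigenvector of `ad x` is rescaled (`conj_of_eigen`), and for the nilpotent `K₂ + J₃`, `K₃ - J₂` the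
adjoint series stops after two terms (`conj_of_nilpotent`). Conjugating `x ⊗ 1` and `1 ⊗ x` gives the
coproducts of the Lorentz generators and of `D`. For the translations, `e^{σ₋}` and `e^{σ₊}` turn out
to be group-like (`dl_em`, `dl_ep`), and since the exponential is injective on series without constant
term, `P₀` and `P₁` are primitive.

*The cocycle identity.* The first legs being primitive and the second legs commuting,
`(Δ₀ ⊗ id)F = F₁₃ F₂₃` (`zcomulLeft_twist`). On the other side, `F₂₃ (id ⊗ Δ₀)F F₂₃⁻¹` is `F` with the
twisted coproducts of the translations in its exponents, which is `F₁₂ F₁₃` by the formulas for those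
coproducts (`twist_cocycle`). From the cocycle identity, general arguments give the Hopf algebra
structure (`IsTwist.isTwistedHopfAlgebra`) and, as `U(so(4,2))` is cocommutative, the universal
`R`-matrix (`IsTwist.isUniversalRMatrix`). The classical `r`-matrix is read off from the coefficient
of `z` in the compact form (`coeff_one_twist`).

*The Weyl–Poincaré subalgebra.* All four exponents have legs in it, so `F` is the image of an
element `1 + O(z)` of the completed tensor square of `U(𝒲𝒫)` (`isUnipotent_twist`), and the twisted
coproduct, the twisted antipode and the `R`-matrix are images of elements formed there. Since the deformed
generators reduce to the undeformed ones at `z = 0`, they generate `U_z(𝒲𝒫)` `z`-adically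
(`exists_approx`).
-/

noncomputable section

namespace TwistedConformal

/-! ### Substitution of a formal series without constant term into a real power series -/

section Substitution

variable {A B : Type*} [Ring A] [Algebra ℝ A] [Ring B] [Algebra ℝ B]

open PowerSeries (coeff constantCoeff X)

/-- A series without constant term is divisible by `X`, so its `k`-th power vanishes below order
`k`; this makes all the sums below finite in each degree. -/
theorem coeff_pow_eq_zero_of_lt {f : PowerSeries A} (hf : constantCoeff f = 0) {n k : ℕ}
    (h : n < k) : coeff n (f ^ k) = 0 := by
  rw [← X_mul_zdiv f hf, (PowerSeries.commute_X (zdiv f)).symm.mul_pow,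
    PowerSeries.coeff_X_pow_mul', if_neg (by omega)]

/-- The substitution `p ↦ p(f) = ∑ pₖ fᵏ`, for `f` without constant term. The coefficients of `A`
need not commute, so that `PowerSeries.subst` is not available. -/
def zev (f : PowerSeries A) (p : PowerSeries ℝ) : PowerSeries A :=
  PowerSeries.mk fun n => ∑ k ∈ Finset.range (n + 1), coeff k p • coeff n (f ^ k)

theorem coeff_zev {f : PowerSeries A} (hf : constantCoeff f = 0) (p : PowerSeries ℝ) {n N : ℕ}
    (h : n < N) : coeff n (zev f p) = ∑ k ∈ Finset.range N, coeff k p • coeff n (f ^ k) := by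
  rw [zev, PowerSeries.coeff_mk]
  refine Finset.sum_subset (Finset.range_mono h) fun k _ hk => ?_
  rw [coeff_pow_eq_zero_of_lt hf (by simpa using hk), smul_zero]

theorem coeff_smul_real (r : ℝ) (n : ℕ) (f : PowerSeries A) : coeff n (r • f) = r • coeff n f :=
  rfl

/-- Up to order `N`, the substitution into a power series is the evaluation of a polynomial. -/
theorem coeff_zev_eq_aeval {f : PowerSeries A} (hf : constantCoeff f = 0) (p : PowerSeries ℝ)
    (P : Polynomial ℝ) {n N : ℕ} (hP : ∀ k < N, P.coeff k = coeff k p) (h : n < N) :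
    coeff n (zev f p) = coeff n (Polynomial.aeval f P) := by
  rw [Polynomial.aeval_eq_sum_range' (n := max N (P.natDegree + 1)) (by omega),
    coeff_zev hf p (N := max N (P.natDegree + 1)) (by omega), map_sum]
  refine Finset.sum_congr rfl fun k _ => ?_
  rw [coeff_smul_real]
  by_cases hk : k < N
  · rw [hP k hk]
  · rw [coeff_pow_eq_zero_of_lt hf (by omega), smul_zero, smul_zero]

theorem coeff_zev_eq_aeval_trunc {f : PowerSeries A} (hf : constantCoeff f = 0)
    (p : PowerSeries ℝ) {n N : ℕ} (h : n < N) :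
    coeff n (zev f p) = coeff n (Polynomial.aeval f (p.trunc N)) :=
  coeff_zev_eq_aeval hf p _ (fun k hk => by simp [PowerSeries.coeff_trunc, hk]) h

theorem coeff_mul_congr {f f' g g' : PowerSeries A} {n : ℕ}
    (hf : ∀ k < n + 1, coeff k f = coeff k f') (hg : ∀ k < n + 1, coeff k g = coeff k g') :
    coeff n (f * g) = coeff n (f' * g') := by
  rw [PowerSeries.coeff_mul, PowerSeries.coeff_mul]
  refine Finset.sum_congr rfl fun x hx => ?_
  rw [Finset.HasAntidiagonal.mem_antidiagonal] at hx
  rw [hf _ (by omega), hg _ (by omega)]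

theorem zev_mul {f : PowerSeries A} (hf : constantCoeff f = 0) (p q : PowerSeries ℝ) :
    zev f (p * q) = zev f p * zev f q := by
  ext n
  have h1 : coeff n (zev f (p * q)) =
      coeff n (Polynomial.aeval f (p.trunc (n + 1) * q.trunc (n + 1))) :=
    coeff_zev_eq_aeval hf _ _ (N := n + 1) (fun k hk => by
      rw [← Polynomial.coeff_coe, Polynomial.coe_mul]
      refine coeff_mul_congr (fun j hj => ?_) fun j hj => ?_ <;>
      · rw [Polynomial.coeff_coe, PowerSeries.coeff_trunc, if_pos (by omega)]) n.lt_succ_self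
  rw [h1, map_mul]
  exact coeff_mul_congr (fun k hk => (coeff_zev_eq_aeval_trunc hf p hk).symm)
    fun k hk => (coeff_zev_eq_aeval_trunc hf q hk).symm

/-- The substitution of a fixed `f` without constant term, as an algebra morphism in the series
that `f` is substituted into. -/
def zevHom (f : PowerSeries A) (hf : constantCoeff f = 0) : PowerSeries ℝ →ₐ[ℝ] PowerSeries A :=
  AlgHom.ofLinearMap
    { toFun := zev f
      map_add' := fun p q => by
        ext n; simp [zev, add_smul, Finset.sum_add_distrib]
      map_smul' := fun r p => by
        ext n; simp [zev, Finset.smul_sum, smul_smul] }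
    (by
      ext n
      simp only [zev, LinearMap.coe_mk, AddHom.coe_mk, PowerSeries.coeff_mk, PowerSeries.coeff_one,
        ite_smul, one_smul, zero_smul]
      simp [Finset.sum_ite_eq', PowerSeries.coeff_one])
    (zev_mul hf)

theorem zevHom_apply (f : PowerSeries A) (hf : constantCoeff f = 0) (p : PowerSeries ℝ) :
    zevHom f hf p = zev f p := rfl

theorem constantCoeff_zev (f : PowerSeries A) (p : PowerSeries ℝ) :
    constantCoeff (zev f p) = algebraMap ℝ A (constantCoeff p) := by
  rw [← PowerSeries.coeff_zero_eq_constantCoeff_apply, zev, PowerSeries.coeff_mk]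
  simp [Algebra.algebraMap_eq_smul_one]

theorem zev_X {f : PowerSeries A} (hf : constantCoeff f = 0) : zev f X = f := by
  ext n
  rw [coeff_zev hf _ (N := n + 2) (by omega), Finset.sum_eq_single 1]
  · simp
  · intro k _ hk; simp [PowerSeries.coeff_X, hk]
  · intro h; simp at h

theorem zev_zev {f : PowerSeries A} (hf : constantCoeff f = 0) {q : PowerSeries ℝ}
    (hq : constantCoeff q = 0) (p : PowerSeries ℝ) : zev (zev f q) p = zev f (zev q p) := by
  have hfq : constantCoeff (zev f q) = 0 := by rw [constantCoeff_zev, hq, map_zero]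
  ext n
  rw [coeff_zev_eq_aeval_trunc hfq p n.lt_succ_self, ← zevHom_apply f hf,
    Polynomial.aeval_algHom_apply, zevHom_apply, zev, zev, PowerSeries.coeff_mk,
    PowerSeries.coeff_mk]
  refine Finset.sum_congr rfl fun k hk => ?_
  rw [coeff_zev_eq_aeval_trunc hq p (Finset.mem_range.1 hk)]

/-- `f x = x g` implies `p(f) x = x p(g)`; for `p = exp` this turns additive commutation rules into
multiplicative ones. -/
theorem zev_intertwine {f g x : PowerSeries A} (hf : constantCoeff f = 0)
    (hg : constantCoeff g = 0) (h : f * x = x * g) (p : PowerSeries ℝ) :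
    zev f p * x = x * zev g p := by
  have key : ∀ P : Polynomial ℝ, Polynomial.aeval f P * x = x * Polynomial.aeval g P := by
    intro P
    induction P using Polynomial.induction_on' with
    | add P Q hP hQ => rw [map_add, map_add, add_mul, mul_add, hP, hQ]
    | monomial n a =>
      have : ∀ n : ℕ, f ^ n * x = x * g ^ n := by
        intro n
        induction n with
        | zero => simp
        | succ n ih => rw [pow_succ', pow_succ', mul_assoc, ih, ← mul_assoc, h, mul_assoc]
      rw [Polynomial.aeval_monomial, Polynomial.aeval_monomial, mul_assoc, this,
        Algebra.left_comm]
  ext n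
  refine (coeff_mul_congr (fun k hk => coeff_zev_eq_aeval_trunc hf p hk) fun _ _ => rfl).trans ?_
  rw [key]
  exact (coeff_mul_congr (fun _ _ => rfl) fun k hk => coeff_zev_eq_aeval_trunc hg p hk).symm

theorem commute_zev_right {f x : PowerSeries A} (hf : constantCoeff f = 0) (h : Commute x f)
    (p : PowerSeries ℝ) : Commute x (zev f p) :=
  (zev_intertwine hf hf h.symm.eq p).symm

theorem map_zev (φ : A →ₐ[ℝ] B) (f : PowerSeries A) (p : PowerSeries ℝ) :
    PowerSeries.mapAlgHom φ (zev f p) = zev (PowerSeries.mapAlgHom φ f) p := by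
  ext n
  simp only [PowerSeries.mapAlgHom_apply, PowerSeries.coeff_map, zev, PowerSeries.coeff_mk,
    map_sum, RingHom.coe_coe, map_smul, ← map_pow]

/-- Commuting `p(f)` past `x` when `[f, x] = c`, `[f, c] = d` and `[f, d] = 0`: the Taylor formula
`p(f) x = x p(f) + c p'(f) + ½ d p''(f)`. -/
theorem zev_mul_of_ad {f x c d : PowerSeries A} (hf : constantCoeff f = 0)
    (hx : f * x = x * f + c) (hc : f * c = c * f + d) (hd : f * d = d * f) (p : PowerSeries ℝ) :
    zev f p * x = x * zev f p + c * zev f (PowerSeries.derivative ℝ p) +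
      (1 / 2 : ℝ) • (d * zev f (PowerSeries.derivative ℝ (PowerSeries.derivative ℝ p))) := by
  have key : ∀ P : Polynomial ℝ, Polynomial.aeval f P * x = x * Polynomial.aeval f P +
      c * Polynomial.aeval f (Polynomial.derivative P) +
      (1 / 2 : ℝ) • (d * Polynomial.aeval f (Polynomial.derivative (Polynomial.derivative P))) := by
    intro P
    induction P using Polynomial.induction_on with
    | C a => simp [Algebra.commutes]
    | add P Q hP hQ =>
      simp only [map_add, add_mul, hP, hQ, mul_add, smul_add]; abel
    | monomial n a ih =>
      have h1 : (Polynomial.C a * Polynomial.X ^ (n + 1) : Polynomial ℝ) =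
        Polynomial.X * (Polynomial.C a * Polynomial.X ^ n) := by ring
      rw [h1]
      generalize (Polynomial.C a * Polynomial.X ^ n : Polynomial ℝ) = Q at ih
      have h2 : Polynomial.derivative (Polynomial.X * Q) =
          Q + Polynomial.X * Polynomial.derivative Q := by
        rw [Polynomial.derivative_mul, Polynomial.derivative_X, one_mul]
      have h3 : Polynomial.derivative (Polynomial.derivative (Polynomial.X * Q)) =
          (2 : ℝ) • Polynomial.derivative Q +
            Polynomial.X * Polynomial.derivative (Polynomial.derivative Q) := by
        rw [h2, map_add, Polynomial.derivative_mul, Polynomial.derivative_X, one_mul, two_smul]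
        abel
      rw [h3, h2]
      simp only [map_add, map_mul, Polynomial.aeval_X, map_smul]
      rw [mul_assoc, ih]
      simp only [mul_add, mul_smul_comm, ← mul_assoc, hx, hc, hd, add_mul, smul_add]
      module
  have hP : ∀ n : ℕ, ∀ k < n + 1, (Polynomial.derivative (p.trunc (n + 3))).coeff k =
      coeff k (PowerSeries.derivative ℝ p) := fun n k hk => by
    rw [Polynomial.coeff_derivative, PowerSeries.coeff_trunc, if_pos (by omega)]
    exact (PowerSeries.coeff_derivative _ _).symm
  have hP' : ∀ n : ℕ, ∀ k < n + 1,
      (Polynomial.derivative (Polynomial.derivative (p.trunc (n + 3)))).coeff k =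
      coeff k (PowerSeries.derivative ℝ (PowerSeries.derivative ℝ p)) := fun n k hk => by
    rw [Polynomial.coeff_derivative, Polynomial.coeff_derivative, PowerSeries.coeff_trunc,
      if_pos (by omega)]
    refine Eq.symm ((PowerSeries.coeff_derivative _ _).trans ?_)
    congr 1
    exact PowerSeries.coeff_derivative _ _
  ext n
  refine (coeff_mul_congr (f' := Polynomial.aeval f (p.trunc (n + 3)))
    (fun k hk => coeff_zev_eq_aeval_trunc hf p (by omega)) fun _ _ => rfl).trans ?_
  rw [key]
  simp only [map_add, coeff_smul_real]
  congr 1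
  · congr 1
    · exact (coeff_mul_congr (fun _ _ => rfl)
        fun k hk => coeff_zev_eq_aeval_trunc hf p (by omega)).symm
    · exact (coeff_mul_congr (fun _ _ => rfl)
        fun k hk => coeff_zev_eq_aeval hf _ _ (hP n) hk).symm
  · congr 1
    exact (coeff_mul_congr (fun _ _ => rfl)
        fun k hk => coeff_zev_eq_aeval hf _ _ (hP' n) hk).symm

/-- The chain rule. -/
theorem derivative_zev {q : PowerSeries ℝ} (hq : constantCoeff q = 0) (p : PowerSeries ℝ) :
    PowerSeries.derivative ℝ (zev q p) =
      zev q (PowerSeries.derivative ℝ p) * PowerSeries.derivative ℝ q := by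
  have key : ∀ P : Polynomial ℝ, PowerSeries.derivative ℝ (Polynomial.aeval q P) =
      Polynomial.aeval q (Polynomial.derivative P) * PowerSeries.derivative ℝ q := by
    intro P
    exact ((PowerSeries.derivative ℝ).map_aeval P q).trans (smul_eq_mul _ _)
  ext n
  have h1 : coeff n (PowerSeries.derivative ℝ (zev q p)) =
      coeff n (PowerSeries.derivative ℝ (Polynomial.aeval q (p.trunc (n + 2)))) := by
    refine (PowerSeries.coeff_derivative _ _).trans
      (Eq.trans ?_ (PowerSeries.coeff_derivative _ _).symm)
    rw [coeff_zev_eq_aeval_trunc hq p (Nat.lt_succ_self (n + 1))]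
  rw [h1, key]
  refine (coeff_mul_congr (fun k hk => coeff_zev_eq_aeval hq _ _ (N := n + 1) (fun j hj => ?_) hk)
    fun _ _ => rfl).symm
  rw [Polynomial.coeff_derivative, PowerSeries.coeff_trunc, if_pos (by omega)]
  exact (PowerSeries.coeff_derivative _ _).symm

end Substitution

/-! ### Exponential and logarithm -/

section ExpLog

variable {A B : Type*} [Ring A] [Algebra ℝ A] [Ring B] [Algebra ℝ B]

open PowerSeries (coeff constantCoeff X)

theorem zexp_eq_zev (f : PowerSeries A) : zexp f = zev f (PowerSeries.exp ℝ) := by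
  ext n; simp [zexp, zev, PowerSeries.coeff_exp]

theorem zlog_eq_zev (f : PowerSeries A) : zlog f = zev f (PowerSeries.log ℝ) := by
  ext n
  rw [zlog, zev, PowerSeries.coeff_mk, PowerSeries.coeff_mk, Finset.range_eq_Ico,
    Finset.sum_eq_sum_Ico_succ_bot (by omega)]
  simp only [PowerSeries.coeff_log, if_true, zero_smul, zero_add]
  refine Finset.sum_congr rfl fun k hk => ?_
  rw [if_neg (by have := Finset.mem_Icc.1 hk; omega)]
  simp

theorem derivative_exp_real :
    PowerSeries.derivative ℝ (PowerSeries.exp ℝ) = PowerSeries.exp ℝ :=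
  PowerSeries.derivative_exp ℝ

/-- `exp(ln(1 + X)) = 1 + X`: the left-hand side `y` solves `(1 + X) y' = y`, whose solutions are
determined by their constant term. -/
theorem zev_log_exp : zev (PowerSeries.log ℝ) (PowerSeries.exp ℝ) = 1 + X := by
  set y := zev (PowerSeries.log ℝ) (PowerSeries.exp ℝ) with hy
  have h0 : coeff 0 y = 1 := by
    rw [PowerSeries.coeff_zero_eq_constantCoeff_apply, hy, constantCoeff_zev,
      PowerSeries.constantCoeff_exp, map_one]
  have hd : PowerSeries.derivative ℝ y = y * PowerSeries.derivative ℝ (PowerSeries.log ℝ) := by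
    rw [hy, derivative_zev PowerSeries.constantCoeff_log, derivative_exp_real]
  have hl : PowerSeries.derivative ℝ (PowerSeries.log ℝ) * (1 + X) = 1 := by
    have h : PowerSeries.derivative ℝ (PowerSeries.log ℝ) =
      PowerSeries.mk fun n ↦ algebraMap ℚ ℝ ((-1 : ℚ) ^ n) := PowerSeries.deriv_log
    rw [h, mul_add, mul_one]
    ext n
    cases n with
    | zero => simp
    | succ n => simp [PowerSeries.coeff_succ_mul_X, PowerSeries.coeff_one, pow_succ]
  have hode : PowerSeries.derivative ℝ y * (1 + X) = y := by rw [hd, mul_assoc, hl, mul_one]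
  have hrec : ∀ n, coeff (n + 2) y * (n + 2) + coeff (n + 1) y * (n + 1) = coeff (n + 1) y := by
    intro n
    have h := congrArg (coeff (n + 1)) hode
    rw [mul_add, mul_one, map_add, PowerSeries.coeff_succ_mul_X] at h
    have e1 : coeff (n + 1) (PowerSeries.derivative ℝ y) = coeff (n + 2) y * (n + 2) := by
      refine (PowerSeries.coeff_derivative _ _).trans ?_
      push_cast; ring
    have e2 : coeff n (PowerSeries.derivative ℝ y) = coeff (n + 1) y * (n + 1) :=
      PowerSeries.coeff_derivative _ _
    rwa [e1, e2] at h
  have h1 : coeff 1 y = 1 := by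
    have h := congrArg (coeff 0) hode
    rw [mul_add, mul_one, map_add, PowerSeries.coeff_zero_mul_X, add_zero, h0] at h
    have e2 : coeff 0 (PowerSeries.derivative ℝ y) = coeff 1 y * ((0 : ℕ) + 1) :=
      PowerSeries.coeff_derivative _ _
    rw [e2] at h; simpa using h
  have h2 : ∀ n, coeff (n + 2) y = 0 := by
    intro n
    have hn : (n : ℝ) + 2 ≠ 0 := by positivity
    induction n with
    | zero => have := hrec 0; simp at this; exact this
    | succ n ih =>
      have := hrec (n + 1)
      rw [show n + 1 + 1 = n + 2 by ring, ih (by positivity)] at this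
      have hn' : (n : ℝ) + 1 + 2 ≠ 0 := by positivity
      simpa [hn'] using this
  ext n
  rcases n with _ | _ | n
  · simpa using h0
  · simpa [PowerSeries.coeff_one] using h1
  · simp [h2, PowerSeries.coeff_one, PowerSeries.coeff_X]

theorem constantCoeff_zexp (f : PowerSeries A) : constantCoeff (zexp f) = 1 := by
  rw [zexp_eq_zev, constantCoeff_zev, PowerSeries.constantCoeff_exp, map_one]

theorem constantCoeff_zlog (f : PowerSeries A) : constantCoeff (zlog f) = 0 := by
  rw [zlog_eq_zev, constantCoeff_zev, PowerSeries.constantCoeff_log, map_zero]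

theorem zexp_zlog {f : PowerSeries A} (hf : constantCoeff f = 0) : zexp (zlog f) = 1 + f := by
  rw [zexp_eq_zev, zlog_eq_zev, zev_zev hf PowerSeries.constantCoeff_log, zev_log_exp,
    ← zevHom_apply f hf, map_add, map_one, zevHom_apply, zev_X hf]

theorem map_zexp (φ : A →ₐ[ℝ] B) (f : PowerSeries A) :
    PowerSeries.mapAlgHom φ (zexp f) = zexp (PowerSeries.mapAlgHom φ f) := by
  rw [zexp_eq_zev, zexp_eq_zev, map_zev]

theorem map_zlog (φ : A →ₐ[ℝ] B) (f : PowerSeries A) :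
    PowerSeries.mapAlgHom φ (zlog f) = zlog (PowerSeries.mapAlgHom φ f) := by
  rw [zlog_eq_zev, zlog_eq_zev, map_zev]

theorem map_zdiv (φ : A →ₐ[ℝ] B) (f : PowerSeries A) :
    PowerSeries.mapAlgHom φ (zdiv f) = zdiv (PowerSeries.mapAlgHom φ f) := by
  ext n; simp [zdiv, PowerSeries.mapAlgHom_apply]

theorem zexp_zero : zexp (0 : PowerSeries A) = 1 := by
  ext n
  rw [zexp, PowerSeries.coeff_mk, Finset.sum_range_succ']
  simp

theorem zlog_zero : zlog (0 : PowerSeries A) = 0 := by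
  ext n
  rw [zlog, PowerSeries.coeff_mk]
  refine Finset.sum_eq_zero fun k hk => ?_
  rw [zero_pow (by have := Finset.mem_Icc.1 hk; omega)]; simp

theorem zexp_add {f g : PowerSeries A} (hf : constantCoeff f = 0) (hg : constantCoeff g = 0)
    (h : Commute f g) : zexp (f + g) = zexp f * zexp g := by
  have hfg : constantCoeff (f + g) = 0 := by rw [map_add, hf, hg, add_zero]
  have hcoeff : ∀ {f : PowerSeries A} (_ : constantCoeff f = 0) {n N : ℕ} (_ : n < N),
      coeff n (zexp f) =
        coeff n (∑ k ∈ Finset.range N, ((k.factorial : ℝ)⁻¹) • f ^ k) := by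
    intro f hf n N hn
    rw [zexp_eq_zev, coeff_zev hf _ hn, map_sum]
    simp [PowerSeries.coeff_exp, coeff_smul_real]
  have hvan : ∀ i j n : ℕ, n < i + j → coeff n (f ^ i * g ^ j) = 0 := by
    intro i j n hn
    rw [← X_mul_zdiv f hf, ← X_mul_zdiv g hg, (PowerSeries.commute_X (zdiv f)).symm.mul_pow,
      (PowerSeries.commute_X (zdiv g)).symm.mul_pow, mul_assoc, ← mul_assoc (zdiv f ^ i),
      ((PowerSeries.commute_X (zdiv f ^ i)).pow_right j).eq, mul_assoc, ← mul_assoc, ← pow_add,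
      PowerSeries.coeff_X_pow_mul', if_neg (by omega)]
  ext n
  rw [coeff_mul_congr (fun k hk => hcoeff hf hk) (fun k hk => hcoeff hg hk),
    hcoeff hfg n.lt_succ_self]
  have e1 : ∀ m, ((m.factorial : ℝ)⁻¹) • (f + g) ^ m = ∑ k ∈ Finset.range (m + 1),
      ((k.factorial : ℝ)⁻¹ * ((m - k).factorial : ℝ)⁻¹) • (f ^ k * g ^ (m - k)) := by
    intro m
    rw [h.add_pow, Finset.smul_sum]
    refine Finset.sum_congr rfl fun k hk => ?_
    rw [← nsmul_eq_mul', ← Nat.cast_smul_eq_nsmul ℝ, smul_smul]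
    congr 1
    rw [Nat.cast_choose ℝ (by have := Finset.mem_range.1 hk; omega)]
    have := Nat.factorial_ne_zero m
    field_simp
  rw [Finset.sum_congr rfl fun m _ => e1 m,
    Finset.sum_range_diag_flip (n + 1)
      (fun i j => ((i.factorial : ℝ)⁻¹ * (j.factorial : ℝ)⁻¹) • (f ^ i * g ^ j)),
    Finset.sum_mul_sum, map_sum, map_sum]
  refine Finset.sum_congr rfl fun i hi => ?_
  rw [map_sum, map_sum]
  -- the double sum over the square exceeds the one over the triangle only by terms of high order
  refine Eq.trans (Finset.sum_subset (Finset.range_mono (Nat.sub_le _ _)) fun j _ hj => ?_) ?_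
  · rw [coeff_smul_real, hvan _ _ _ (by simp at hj; omega), smul_zero]
  · refine Finset.sum_congr rfl fun j _ => ?_
    rw [smul_mul_smul_comm]

theorem zexp_neg_mul {f : PowerSeries A} (hf : constantCoeff f = 0) :
    zexp (-f) * zexp f = 1 := by
  rw [← zexp_add (by simpa using hf) hf (Commute.refl f).neg_left, neg_add_cancel, zexp_zero]

theorem zexp_mul_neg {f : PowerSeries A} (hf : constantCoeff f = 0) :
    zexp f * zexp (-f) = 1 := by
  rw [← zexp_add hf (by simpa using hf) (Commute.refl f).neg_right, add_neg_cancel, zexp_zero]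

theorem isUnit_zexp {f : PowerSeries A} (hf : constantCoeff f = 0) : IsUnit (zexp f) :=
  ⟨⟨zexp f, zexp (-f), zexp_mul_neg hf, zexp_neg_mul hf⟩, rfl⟩

theorem inverse_eq_of_mul_eq_one {R : Type*} [Ring R] {a b : R} (h1 : a * b = 1) (h2 : b * a = 1) :
    Ring.inverse a = b :=
  Ring.inverse_unit (⟨a, b, h1, h2⟩ : Rˣ)

theorem zexp_intertwine {f g x : PowerSeries A} (hf : constantCoeff f = 0)
    (hg : constantCoeff g = 0) (h : f * x = x * g) : zexp f * x = x * zexp g := by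
  rw [zexp_eq_zev, zexp_eq_zev]; exact zev_intertwine hf hg h _

theorem commute_zexp_right {f x : PowerSeries A} (hf : constantCoeff f = 0) (h : Commute x f) :
    Commute x (zexp f) := by
  rw [zexp_eq_zev]; exact commute_zev_right hf h _

theorem commute_zexp_zexp {f g : PowerSeries A} (hf : constantCoeff f = 0)
    (hg : constantCoeff g = 0) (h : Commute f g) : Commute (zexp f) (zexp g) :=
  commute_zexp_right hg (commute_zexp_right hf h.symm).symm

/-- `exp(f) x = (x + c + ½ d) exp(f)` when `[f, x] = c`, `[f, c] = d` and `[f, d] = 0`. -/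
theorem zexp_mul_of_ad_two {f x c d : PowerSeries A} (hf : constantCoeff f = 0)
    (hx : f * x = x * f + c) (hc : f * c = c * f + d) (hd : f * d = d * f) :
    zexp f * x = (x + c + (1 / 2 : ℝ) • d) * zexp f := by
  rw [zexp_eq_zev, zev_mul_of_ad hf hx hc hd, derivative_exp_real, derivative_exp_real, add_mul,
    add_mul, smul_mul_assoc]

/-- `exp(f) x = (x + c) exp(f)` when `[f, x] = c` commutes with `f`. -/
theorem zexp_mul_of_ad_one {f x c : PowerSeries A} (hf : constantCoeff f = 0)
    (hx : f * x = x * f + c) (hc : f * c = c * f) : zexp f * x = (x + c) * zexp f := by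
  have h := zexp_mul_of_ad_two (d := 0) hf hx (by rw [hc, add_zero]) (by simp)
  rwa [smul_zero, add_zero] at h

/-- The exponential is injective on series without constant term: in the lowest degree where `f`
and `g` differ, `exp f - exp g` agrees with `f - g`. -/
theorem zexp_injective {f g : PowerSeries A} (hf : constantCoeff f = 0)
    (hg : constantCoeff g = 0) (h : zexp f = zexp g) : f = g := by
  have key : ∀ n, ∀ k < n, coeff k f = coeff k g := by
    intro n
    induction n with
    | zero => intro k hk; omega
    | succ n ih =>
      intro k hk
      rcases Nat.lt_succ_iff_lt_or_eq.1 hk with hk' | rfl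
      · exact ih k hk'
      rcases Nat.eq_zero_or_pos k with rfl | hpos
      · rw [PowerSeries.coeff_zero_eq_constantCoeff_apply,
          PowerSeries.coeff_zero_eq_constantCoeff_apply, hf, hg]
      have hpow : ∀ m, ∀ i < k + m, coeff i (f ^ (m + 1)) = coeff i (g ^ (m + 1)) := by
        intro m
        induction m with
        | zero => intro i hi; simpa using ih i (by omega)
        | succ m hm =>
          intro i hi
          have e : ∀ f : PowerSeries A, constantCoeff f = 0 → coeff i (f ^ (m + 1 + 1)) =
              if i = 0 then 0 else coeff (i - 1) (f ^ (m + 1) * zdiv f) := by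
            intro f hf
            rw [pow_succ f (m + 1)]
            nth_rewrite 2 [← X_mul_zdiv f hf]
            rw [← mul_assoc, (PowerSeries.commute_X _).eq, mul_assoc]
            cases i with
            | zero => simp
            | succ i => simp [PowerSeries.coeff_succ_X_mul]
          rw [e f hf, e g hg]
          split_ifs with hi0
          · rfl
          rw [PowerSeries.coeff_mul, PowerSeries.coeff_mul]
          refine Finset.sum_congr rfl fun x hx => ?_
          rw [Finset.HasAntidiagonal.mem_antidiagonal] at hx
          by_cases hx2 : x.2 + 1 < k
          · have h2 : coeff x.2 (zdiv f) = coeff x.2 (zdiv g) := by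
              simpa [zdiv] using ih (x.2 + 1) hx2
            rw [h2, hm x.1 (by omega)]
          · rw [coeff_pow_eq_zero_of_lt hf (show x.1 < m + 1 by omega),
              coeff_pow_eq_zero_of_lt hg (show x.1 < m + 1 by omega), zero_mul, zero_mul]
      have h1 := congrArg (coeff k) h
      rw [zexp, zexp, PowerSeries.coeff_mk, PowerSeries.coeff_mk, Finset.sum_range_succ',
        Finset.sum_range_succ'] at h1
      obtain ⟨k, rfl⟩ : ∃ j, k = j + 1 := ⟨k - 1, by omega⟩
      rw [Finset.sum_range_succ', Finset.sum_range_succ'] at h1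
      have h2 : ∑ j ∈ Finset.range k, (((j + 1 + 1).factorial : ℝ)⁻¹) •
            coeff (k + 1) (f ^ (j + 1 + 1)) =
          ∑ j ∈ Finset.range k, (((j + 1 + 1).factorial : ℝ)⁻¹) •
            coeff (k + 1) (g ^ (j + 1 + 1)) :=
        Finset.sum_congr rfl fun j _ => by rw [hpow (j + 1) (k + 1) (by omega)]
      rw [h2] at h1
      simpa using h1
  ext n
  exact key (n + 1) n n.lt_succ_self

end ExpLog

/-! ### Coefficientwise extension of linear maps and pure tensors -/

section Coefficientwise

variable {A B C D : Type*} [Ring A] [Algebra ℝ A] [Ring B] [Algebra ℝ B] [Ring C] [Algebra ℝ C]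
  [Ring D] [Algebra ℝ D]

open PowerSeries (coeff constantCoeff X mapAlgHom)

theorem coeff_mapAlgHom (φ : A →ₐ[ℝ] B) (f : PowerSeries A) (n : ℕ) :
    coeff n (mapAlgHom φ f) = φ (coeff n f) := by
  rw [PowerSeries.mapAlgHom_apply, PowerSeries.coeff_map]; rfl

theorem constantCoeff_mapAlgHom (φ : A →ₐ[ℝ] B) (f : PowerSeries A) :
    constantCoeff (mapAlgHom φ f) = φ (constantCoeff f) := by
  rw [← PowerSeries.coeff_zero_eq_constantCoeff_apply, coeff_mapAlgHom,
    PowerSeries.coeff_zero_eq_constantCoeff_apply]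

theorem mapAlgHom_X (φ : A →ₐ[ℝ] B) : mapAlgHom φ X = X := by
  rw [PowerSeries.mapAlgHom_apply, PowerSeries.map_X]

theorem mapAlgHom_C (φ : A →ₐ[ℝ] B) (a : A) :
    mapAlgHom φ (PowerSeries.C a) = PowerSeries.C (φ a) := by
  rw [PowerSeries.mapAlgHom_apply, PowerSeries.map_C]; rfl

theorem mapAlgHom_mapAlgHom (φ : B →ₐ[ℝ] C) (ψ : A →ₐ[ℝ] B) (f : PowerSeries A) :
    mapAlgHom φ (mapAlgHom ψ f) = mapAlgHom (φ.comp ψ) f := by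
  ext n; simp only [coeff_mapAlgHom, AlgHom.comp_apply]

theorem mapAlgHom_id (f : PowerSeries A) : mapAlgHom (AlgHom.id ℝ A) f = f := by
  ext n; simp only [coeff_mapAlgHom, AlgHom.id_apply]

theorem mapAlgHom_congr {φ ψ : A →ₐ[ℝ] B} (h : ∀ a, φ a = ψ a) (f : PowerSeries A) :
    mapAlgHom φ f = mapAlgHom ψ f := by
  rw [AlgHom.ext h]

theorem mapAlgHom_eq_self {φ : A →ₐ[ℝ] A} (h : ∀ a, φ a = a) (f : PowerSeries A) :
    mapAlgHom φ f = f := by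
  ext n; rw [coeff_mapAlgHom, h]

theorem X_mul_cancel {f g : PowerSeries A} (h : (X : PowerSeries A) * f = X * g) : f = g := by
  ext n
  simpa [PowerSeries.coeff_succ_X_mul] using congrArg (coeff (n + 1)) h

theorem zdiv_eq_of_X_mul {f g : PowerSeries A} (h : f = X * g) : zdiv f = g := by
  ext n; simp [h, zdiv, PowerSeries.coeff_succ_X_mul]

theorem commute_mapAlgHom {φ : A →ₐ[ℝ] C} {ψ : B →ₐ[ℝ] C} (h : ∀ a b, Commute (φ a) (ψ b))
    (f : PowerSeries A) (g : PowerSeries B) : Commute (mapAlgHom φ f) (mapAlgHom ψ g) := by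
  ext n
  rw [PowerSeries.coeff_mul, PowerSeries.coeff_mul, ← Finset.Nat.sum_antidiagonal_swap]
  refine Finset.sum_congr rfl fun x _ => ?_
  simp only [coeff_mapAlgHom, Prod.fst_swap, Prod.snd_swap]
  exact h _ _

theorem coeff_mapCoeff (φ : A →ₗ[ℝ] B) (f : PowerSeries A) (n : ℕ) :
    coeff n (mapCoeff φ f) = φ (coeff n f) := by
  rw [mapCoeff, PowerSeries.coeff_mk]

/-- An identity `β (x y) = γ x δ y` between linear maps extends to formal power series. -/
theorem mapCoeff_mul {β : C →ₗ[ℝ] D} {γ : A →ₗ[ℝ] D} {δ : B →ₗ[ℝ] D} {φ : A →ₐ[ℝ] C}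
    {ψ : B →ₐ[ℝ] C} (h : ∀ x y, β (φ x * ψ y) = γ x * δ y) (f : PowerSeries A)
    (g : PowerSeries B) :
    mapCoeff β (mapAlgHom φ f * mapAlgHom ψ g) = mapCoeff γ f * mapCoeff δ g := by
  ext n
  simp only [coeff_mapCoeff, PowerSeries.coeff_mul, map_sum, coeff_mapAlgHom, h]

/-- An identity `β (x y) = γ y δ x` between linear maps extends to formal power series. -/
theorem mapCoeff_mul_swap {β : C →ₗ[ℝ] D} {γ : B →ₗ[ℝ] D} {δ : A →ₗ[ℝ] D} {φ : A →ₐ[ℝ] C}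
    {ψ : B →ₐ[ℝ] C} (h : ∀ x y, β (φ x * ψ y) = γ y * δ x) (f : PowerSeries A)
    (g : PowerSeries B) :
    mapCoeff β (mapAlgHom φ f * mapAlgHom ψ g) = mapCoeff γ g * mapCoeff δ f := by
  ext n
  simp only [coeff_mapCoeff, PowerSeries.coeff_mul, map_sum, coeff_mapAlgHom, h]
  rw [← Finset.Nat.sum_antidiagonal_swap]
  rfl

theorem isUnit_of_coeff_zero_eq_one {f : PowerSeries A} (h : coeff 0 f = 1) : IsUnit f := by
  have h' : constantCoeff f = ((1 : Aˣ) : A) := by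
    rw [← PowerSeries.coeff_zero_eq_constantCoeff_apply, h, Units.val_one]
  exact ⟨⟨f, PowerSeries.invOfUnit f 1, PowerSeries.mul_invOfUnit f 1 h',
    MvPowerSeries.invOfUnit_mul f 1 h'⟩, rfl⟩

theorem map_ringInverse {R S : Type*} [Ring R] [Ring S] (φ : R →+* S) {a : R} (h : IsUnit a) :
    φ (Ring.inverse a) = Ring.inverse (φ a) := by
  refine (inverse_eq_of_mul_eq_one ?_ ?_).symm
  · rw [← map_mul, Ring.mul_inverse_cancel _ h, map_one]
  · rw [← map_mul, Ring.inverse_mul_cancel _ h, map_one]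

end Coefficientwise

section PureTensors

variable {A : Type*} [Ring A] [Algebra ℝ A]

open PowerSeries (coeff constantCoeff X mapAlgHom)

/-- `f ↦ f ⊗ 1`. -/
def inLeft : PowerSeries A →ₐ[ℝ] PowerSeries (A ⊗[ℝ] A) :=
  mapAlgHom Algebra.TensorProduct.includeLeft

/-- `f ↦ 1 ⊗ f`. -/
def inRight : PowerSeries A →ₐ[ℝ] PowerSeries (A ⊗[ℝ] A) :=
  mapAlgHom Algebra.TensorProduct.includeRight

theorem ztmul_def (f g : PowerSeries A) : f ⊠ g = inLeft f * inRight g := rfl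

theorem commute_inLeft_inRight (f g : PowerSeries A) : Commute (inLeft f) (inRight g) :=
  commute_mapAlgHom (fun a b => by simp [Commute, SemiconjBy]) f g

theorem ztmul_one (f : PowerSeries A) : f ⊠ 1 = inLeft f := by rw [ztmul_def, map_one, mul_one]

theorem one_ztmul (f : PowerSeries A) : 1 ⊠ f = inRight f := by rw [ztmul_def, map_one, one_mul]

theorem ztmul_mul (f g h k : PowerSeries A) : (f ⊠ g) * (h ⊠ k) = (f * h) ⊠ (g * k) := by
  simp only [ztmul_def, map_mul]
  rw [mul_assoc, ← mul_assoc (inRight g), ← (commute_inLeft_inRight h g).eq, mul_assoc, mul_assoc]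

theorem ztmul_add (f g h : PowerSeries A) : f ⊠ (g + h) = f ⊠ g + f ⊠ h := by
  simp only [ztmul_def, map_add, mul_add]

theorem add_ztmul (f g h : PowerSeries A) : (f + g) ⊠ h = f ⊠ h + g ⊠ h := by
  simp only [ztmul_def, map_add, add_mul]

theorem ztmul_sub (f g h : PowerSeries A) : f ⊠ (g - h) = f ⊠ g - f ⊠ h := by
  simp only [ztmul_def, map_sub, mul_sub]

theorem sub_ztmul (f g h : PowerSeries A) : (f - g) ⊠ h = f ⊠ h - g ⊠ h := by
  simp only [ztmul_def, map_sub, sub_mul]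

theorem ztmul_neg (f g : PowerSeries A) : f ⊠ (-g) = -(f ⊠ g) := by
  simp only [ztmul_def, map_neg, mul_neg]

theorem neg_ztmul (f g : PowerSeries A) : (-f) ⊠ g = -(f ⊠ g) := by
  simp only [ztmul_def, map_neg, neg_mul]

theorem ztmul_zero (f : PowerSeries A) : f ⊠ 0 = 0 := by
  simp only [ztmul_def, map_zero, mul_zero]

theorem zero_ztmul (f : PowerSeries A) : 0 ⊠ f = 0 := by
  simp only [ztmul_def, map_zero, zero_mul]

theorem ztmul_smul (r : ℝ) (f g : PowerSeries A) : f ⊠ (r • g) = r • (f ⊠ g) := by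
  simp only [ztmul_def, map_smul, mul_smul_comm]

theorem smul_ztmul (r : ℝ) (f g : PowerSeries A) : (r • f) ⊠ g = r • (f ⊠ g) := by
  simp only [ztmul_def, map_smul, smul_mul_assoc]

theorem X_mul_ztmul (f g : PowerSeries A) : X * (f ⊠ g) = f ⊠ (X * g) := by
  rw [ztmul_def, ztmul_def, map_mul, ← mul_assoc, ← mul_assoc, inRight, mapAlgHom_X,
    (PowerSeries.commute_X _).eq]

theorem constantCoeff_ztmul {f g : PowerSeries A} (hg : constantCoeff g = 0) :
    constantCoeff (f ⊠ g) = 0 := by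
  rw [ztmul_def, map_mul, inRight, constantCoeff_mapAlgHom, hg, map_zero, mul_zero]

theorem commute_ztmul {f g h k : PowerSeries A} (h1 : Commute f h) (h2 : Commute g k) :
    Commute (f ⊠ g) (h ⊠ k) := by
  rw [Commute, SemiconjBy, ztmul_mul, ztmul_mul, h1.eq, h2.eq]

end PureTensors

section Legs

variable {A : Type*} [Ring A] [HopfAlgebra ℝ A]

open PowerSeries (coeff constantCoeff X mapAlgHom)

/-- `f ↦ f ⊗ 1 ⊗ 1`. -/
def leg1 : PowerSeries A →ₐ[ℝ] PowerSeries (A ⊗[ℝ] (A ⊗[ℝ] A)) :=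
  mapAlgHom Algebra.TensorProduct.includeLeft

theorem leg12_inLeft (f : PowerSeries A) : leg12 (inLeft f) = leg1 f := by
  rw [leg12, inLeft, leg1, mapAlgHom_mapAlgHom]
  exact mapAlgHom_congr (fun a => by simp) f

theorem leg13_inLeft (f : PowerSeries A) : leg13 (inLeft f) = leg1 f := by
  rw [leg13, inLeft, leg1, mapAlgHom_mapAlgHom]
  exact mapAlgHom_congr (fun a => by simp) f

theorem leg12_inRight (f : PowerSeries A) : leg12 (inRight f) = leg23 (inLeft f) := by
  rw [leg12, inRight, leg23, inLeft, mapAlgHom_mapAlgHom, mapAlgHom_mapAlgHom]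
  exact mapAlgHom_congr (fun a => by simp) f

theorem leg13_inRight (f : PowerSeries A) : leg13 (inRight f) = leg23 (inRight f) := by
  rw [leg13, inRight, leg23, mapAlgHom_mapAlgHom, mapAlgHom_mapAlgHom]
  exact mapAlgHom_congr (fun a => by simp) f

theorem zcomulRight_inLeft (f : PowerSeries A) : zcomulRight (inLeft f) = leg1 f := by
  rw [zcomulRight, inLeft, leg1, mapAlgHom_mapAlgHom]
  exact mapAlgHom_congr (fun a => by simp) f

theorem zcomulRight_inRight (f : PowerSeries A) :
    zcomulRight (inRight f) = leg23 (zcomul f) := by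
  rw [zcomulRight, inRight, leg23, zcomul, mapAlgHom_mapAlgHom, mapAlgHom_mapAlgHom]
  exact mapAlgHom_congr (fun a => by simp) f

theorem zcomulLeft_inLeft (f : PowerSeries A) : zcomulLeft (inLeft f) = leg12 (zcomul f) := by
  rw [zcomulLeft, inLeft, leg12, zcomul, mapAlgHom_mapAlgHom, mapAlgHom_mapAlgHom]
  refine mapAlgHom_congr (fun a => ?_) f
  simp only [AlgHom.comp_apply, Algebra.TensorProduct.includeLeft_apply,
    Algebra.TensorProduct.map_tmul, map_one]
  generalize (Bialgebra.comulAlgHom ℝ A) a = t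
  induction t with
  | zero => simp
  | tmul x y => simp
  | add x y hx hy => simp only [TensorProduct.add_tmul, map_add, hx, hy]

theorem zcomulLeft_inRight (f : PowerSeries A) :
    zcomulLeft (inRight f) = leg23 (inRight f) := by
  rw [zcomulLeft, inRight, leg23, mapAlgHom_mapAlgHom, mapAlgHom_mapAlgHom]
  exact mapAlgHom_congr (fun a => by simp [Algebra.TensorProduct.one_def]) f

theorem commute_leg1_leg23 (f : PowerSeries A) (g : PowerSeries (A ⊗[ℝ] A)) :
    Commute (leg1 f) (leg23 g) :=
  commute_mapAlgHom (fun a b => by simp [Commute, SemiconjBy]) f g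

theorem zcounitLeft_inLeft (f : PowerSeries A) : zcounitLeft (inLeft f) = zcounit f := by
  rw [zcounitLeft, inLeft, zcounit, mapAlgHom_mapAlgHom]
  exact mapAlgHom_congr (fun a => by simp [Algebra.algebraMap_eq_smul_one]) f

theorem zcounitRight_inRight (f : PowerSeries A) : zcounitRight (inRight f) = zcounit f := by
  rw [zcounitRight, inRight, zcounit, mapAlgHom_mapAlgHom]
  exact mapAlgHom_congr (fun a => by simp [Algebra.algebraMap_eq_smul_one]) f

theorem zcounitLeft_zcomul (f : PowerSeries A) : zcounitLeft (zcomul f) = f := by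
  rw [zcounitLeft, zcomul, mapAlgHom_mapAlgHom]
  refine mapAlgHom_eq_self (fun a => ?_) f
  have h := Coalgebra.rTensor_counit_comul (R := ℝ) a
  have h2 := congrArg (TensorProduct.lid ℝ A) h
  simp only [TensorProduct.lid_tmul, one_smul] at h2
  exact h2

theorem zcounitRight_zcomul (f : PowerSeries A) : zcounitRight (zcomul f) = f := by
  rw [zcounitRight, zcomul, mapAlgHom_mapAlgHom]
  refine mapAlgHom_eq_self (fun a => ?_) f
  have h := Coalgebra.lTensor_counit_comul (R := ℝ) a
  have h2 := congrArg (TensorProduct.rid ℝ A) h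
  simp only [TensorProduct.rid_tmul, one_smul] at h2
  exact h2

theorem zcomulLeft_zcomul (f : PowerSeries A) :
    zcomulLeft (zcomul f) = zcomulRight (zcomul f) := by
  rw [zcomulLeft, zcomulRight, zcomul, mapAlgHom_mapAlgHom, mapAlgHom_mapAlgHom]
  exact mapAlgHom_congr (fun a => Coalgebra.coassoc_apply (R := ℝ) a) f

end Legs

/-! ### Hopf algebra structure defined by a twisting element -/

section Twist

variable {A : Type*} [Ring A] [HopfAlgebra ℝ A]

open PowerSeries (coeff constantCoeff X mapAlgHom)

theorem twComul_add (F : PowerSeries (A ⊗[ℝ] A)) (a b : PowerSeries A) :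
    twComul F (a + b) = twComul F a + twComul F b := by
  simp only [twComul, map_add, mul_add, add_mul]

theorem twComul_smul (F : PowerSeries (A ⊗[ℝ] A)) (r : ℝ) (a : PowerSeries A) :
    twComul F (r • a) = r • twComul F a := by
  simp only [twComul, map_smul, mul_smul_comm, smul_mul_assoc]

theorem twComul_one {F : PowerSeries (A ⊗[ℝ] A)} (hF : IsUnit F) : twComul F 1 = 1 := by
  rw [twComul, map_one, mul_one, Ring.mul_inverse_cancel _ hF]

theorem twComul_mul {F : PowerSeries (A ⊗[ℝ] A)} (hF : IsUnit F) (a b : PowerSeries A) :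
    twComul F (a * b) = twComul F a * twComul F b := by
  simp only [twComul, map_mul, mul_assoc]
  rw [← mul_assoc (Ring.inverse F) F, Ring.inverse_mul_cancel _ hF, one_mul]

/-- The twisted coproduct as an algebra morphism. -/
def twComulHom (F : PowerSeries (A ⊗[ℝ] A)) (hF : IsUnit F) :
    PowerSeries A →ₐ[ℝ] PowerSeries (A ⊗[ℝ] A) :=
  AlgHom.ofLinearMap
    { toFun := twComul F, map_add' := twComul_add F, map_smul' := twComul_smul F }
    (twComul_one hF) (twComul_mul hF)

/-- The twisted coproduct, without the inverse of `F`. -/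
theorem twComul_eq_iff {F : PowerSeries (A ⊗[ℝ] A)} (hF : IsUnit F) {a : PowerSeries A}
    {b : PowerSeries (A ⊗[ℝ] A)} : twComul F a = b ↔ F * zcomul a = b * F := by
  rw [twComul]
  constructor
  · rintro rfl
    rw [mul_assoc, Ring.inverse_mul_cancel _ hF, mul_one]
  · intro h
    rw [h, mul_assoc, Ring.mul_inverse_cancel _ hF, mul_one]

/-- The linear map `a ⊗ b ↦ (x ↦ a x S(b))`. With values in endomorphisms it is multiplicative
(`actRight_mul`), unlike its evaluation `a ⊗ b ↦ a S(b)` at `1`, which defines `twElt`. -/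
def actRight : A ⊗[ℝ] A →ₗ[ℝ] Module.End ℝ A :=
  TensorProduct.lift (LinearMap.mk₂ ℝ
    (fun a b => LinearMap.mulLeft ℝ a ∘ₗ LinearMap.mulRight ℝ (HopfAlgebra.antipode ℝ b))
    (fun a a' b => by ext x; simp [add_mul])
    (fun r a b => by ext x; simp)
    (fun a b b' => by ext x; simp [mul_add])
    (fun r a b => by ext x; simp))

/-- The linear map `a ⊗ b ↦ (x ↦ S(a) x b)`, which is antimultiplicative (`actLeft_mul`). -/
def actLeft : A ⊗[ℝ] A →ₗ[ℝ] Module.End ℝ A :=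
  TensorProduct.lift (LinearMap.mk₂ ℝ
    (fun a b => LinearMap.mulLeft ℝ (HopfAlgebra.antipode ℝ a) ∘ₗ LinearMap.mulRight ℝ b)
    (fun a a' b => by ext x; simp [add_mul])
    (fun r a b => by ext x; simp)
    (fun a b b' => by ext x; simp [mul_add])
    (fun r a b => by ext x; simp))

theorem actRight_tmul (a b x : A) :
    actRight (a ⊗ₜ[ℝ] b) x = a * (x * HopfAlgebra.antipode ℝ b) := rfl

theorem actLeft_tmul (a b x : A) :
    actLeft (a ⊗ₜ[ℝ] b) x = HopfAlgebra.antipode ℝ a * (x * b) := rfl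

theorem actRight_mul (x y : A ⊗[ℝ] A) : actRight (x * y) = actRight x * actRight y := by
  induction x with
  | zero => simp
  | add x x' hx hx' => simp only [add_mul, map_add, hx, hx']
  | tmul a b =>
    induction y with
    | zero => simp
    | add x x' hx hx' => simp only [mul_add, map_add, hx, hx']
    | tmul c d =>
      refine LinearMap.ext fun u => ?_
      rw [Algebra.TensorProduct.tmul_mul_tmul, Module.End.mul_apply]
      simp only [actRight_tmul, HopfAlgebra.antipode_mul_antidistrib, mul_assoc]

theorem actLeft_mul (x y : A ⊗[ℝ] A) : actLeft (x * y) = actLeft y * actLeft x := by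
  induction x with
  | zero => simp
  | add x x' hx hx' => simp only [add_mul, mul_add, map_add, hx, hx']
  | tmul a b =>
    induction y with
    | zero => simp
    | add x x' hx hx' => simp only [add_mul, mul_add, map_add, hx, hx']
    | tmul c d =>
      refine LinearMap.ext fun u => ?_
      rw [Algebra.TensorProduct.tmul_mul_tmul, Module.End.mul_apply]
      simp only [actLeft_tmul, HopfAlgebra.antipode_mul_antidistrib, mul_assoc]

/-- The evaluation at `1` of endomorphisms. -/
def evOne : Module.End ℝ A →ₗ[ℝ] A := LinearMap.applyₗ 1

theorem evOne_apply (e : Module.End ℝ A) : evOne e = e 1 := rfl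

theorem evOne_actRight (x : A ⊗[ℝ] A) :
    evOne (actRight x) = LinearMap.mul' ℝ A ((HopfAlgebra.antipode ℝ (A := A)).lTensor A x) := by
  induction x with
  | zero => simp
  | add x x' hx hx' => simp only [map_add, hx, hx']
  | tmul a b => simp [evOne_apply, actRight_tmul]

theorem evOne_actLeft (x : A ⊗[ℝ] A) :
    evOne (actLeft x) = LinearMap.mul' ℝ A ((HopfAlgebra.antipode ℝ (A := A)).rTensor A x) := by
  induction x with
  | zero => simp
  | add x x' hx hx' => simp only [map_add, hx, hx']
  | tmul a b => simp [evOne_apply, actLeft_tmul]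

/-- Left multiplications, as endomorphisms. -/
def leftMul : A →ₐ[ℝ] Module.End ℝ A := Algebra.lmul ℝ A

/-- Evaluation at `1` of a composite: `e e' 1 = e (e' 1)`, for formal power series of
endomorphisms. -/
theorem mapCoeff_evOne_mul (e : PowerSeries (Module.End ℝ A))
    (e' : PowerSeries (Module.End ℝ A)) :
    mapCoeff evOne (e * mapAlgHom leftMul (mapCoeff evOne e')) = mapCoeff evOne (e * e') := by
  ext n
  simp only [coeff_mapCoeff, PowerSeries.coeff_mul, map_sum, coeff_mapAlgHom]
  refine Finset.sum_congr rfl fun x _ => ?_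
  simp [evOne_apply, leftMul]

theorem mapCoeff_evOne_mul_zcounit (e : PowerSeries (Module.End ℝ A)) (a : PowerSeries A) :
    mapCoeff evOne (e * mapAlgHom leftMul (zcounit a)) = mapCoeff evOne e * zcounit a := by
  ext n
  simp only [coeff_mapCoeff, PowerSeries.coeff_mul, map_sum, coeff_mapAlgHom, zcounit]
  refine Finset.sum_congr rfl fun x _ => ?_
  simp [evOne_apply, leftMul, Algebra.ofId_apply, Algebra.algebraMap_eq_smul_one]

theorem commute_zcounit (a b : PowerSeries A) : Commute (zcounit a) b := by
  have h := commute_mapAlgHom (φ := (Algebra.ofId ℝ A).comp (Bialgebra.counitAlgHom ℝ A))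
    (ψ := AlgHom.id ℝ A) (fun a b => by
      simpa [Algebra.ofId_apply] using Algebra.commute_algebraMap_left _ b) a b
  rwa [mapAlgHom_id] at h

theorem mapCoeff_actRight_mul (X Y : PowerSeries (A ⊗[ℝ] A)) :
    mapCoeff actRight (X * Y) = mapCoeff actRight X * mapCoeff actRight Y := by
  have h := mapCoeff_mul (β := actRight (A := A)) (γ := actRight) (δ := actRight)
    (φ := AlgHom.id ℝ _) (ψ := AlgHom.id ℝ _) (fun x y => actRight_mul x y) X Y
  rwa [mapAlgHom_id, mapAlgHom_id] at h

theorem mapCoeff_actLeft_mul (X Y : PowerSeries (A ⊗[ℝ] A)) :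
    mapCoeff actLeft (X * Y) = mapCoeff actLeft Y * mapCoeff actLeft X := by
  have h := mapCoeff_mul_swap (β := actLeft (A := A)) (γ := actLeft) (δ := actLeft)
    (φ := AlgHom.id ℝ _) (ψ := AlgHom.id ℝ _) (fun x y => actLeft_mul x y) X Y
  rwa [mapAlgHom_id, mapAlgHom_id] at h

theorem twElt_eq (F : PowerSeries (A ⊗[ℝ] A)) :
    twElt F = mapCoeff evOne (mapCoeff actRight F) := by
  ext n; simp only [twElt, coeff_mapCoeff, evOne_actRight]; rfl

/-- The element `∑ S(g⁽¹⁾) g⁽²⁾`; for `g = F⁻¹` this is the inverse of `twElt F`. -/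
def twEltInv (G : PowerSeries (A ⊗[ℝ] A)) : PowerSeries A :=
  mapCoeff (LinearMap.mul' ℝ A ∘ₗ (HopfAlgebra.antipode ℝ (A := A)).rTensor A) G

theorem twEltInv_eq (G : PowerSeries (A ⊗[ℝ] A)) :
    twEltInv G = mapCoeff evOne (mapCoeff actLeft G) := by
  ext n; simp only [twEltInv, coeff_mapCoeff, evOne_actLeft]; rfl

theorem evOne_actRight_zcomul (a : PowerSeries A) :
    mapCoeff evOne (mapCoeff actRight (zcomul a)) = zcounit a := by
  ext n
  simp only [coeff_mapCoeff, evOne_actRight, zcomul, zcounit, coeff_mapAlgHom]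
  exact HopfAlgebra.mul_antipode_lTensor_comul_apply (R := ℝ) _

theorem evOne_actLeft_zcomul (a : PowerSeries A) :
    mapCoeff evOne (mapCoeff actLeft (zcomul a)) = zcounit a := by
  ext n
  simp only [coeff_mapCoeff, evOne_actLeft, zcomul, zcounit, coeff_mapAlgHom]
  exact HopfAlgebra.mul_antipode_rTensor_comul_apply (R := ℝ) _

/-- `a ⊗ b ⊗ c ↦ a S(b) c`, the map that turns the cocycle identity into the invertibility of
`twElt F`. -/
def mulAntipodeMiddle : A ⊗[ℝ] (A ⊗[ℝ] A) →ₗ[ℝ] A :=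
  LinearMap.mul' ℝ A ∘ₗ LinearMap.lTensor A
    (LinearMap.mul' ℝ A ∘ₗ (HopfAlgebra.antipode ℝ (A := A)).rTensor A)

theorem mulAntipodeMiddle_tmul (a : A) (t : A ⊗[ℝ] A) :
    mulAntipodeMiddle (a ⊗ₜ[ℝ] t) = a * evOne (actLeft t) := by
  rw [evOne_actLeft]; rfl

theorem mulAntipodeMiddle_legs (y x : A ⊗[ℝ] A) :
    mulAntipodeMiddle ((1 : A) ⊗ₜ[ℝ] y * Algebra.TensorProduct.map (AlgHom.id ℝ A)
      (Algebra.TensorProduct.includeLeft (R := ℝ) (S := ℝ) (A := A) (B := A)) x) =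
      evOne (actRight x) * evOne (actLeft y) := by
  induction x with
  | zero => simp
  | add x x' hx hx' => simp only [map_add, mul_add, add_mul, hx, hx']
  | tmul a b =>
    rw [Algebra.TensorProduct.map_tmul, Algebra.TensorProduct.tmul_mul_tmul, one_mul,
      mulAntipodeMiddle_tmul, actLeft_mul, evOne_apply, Module.End.mul_apply,
      Algebra.TensorProduct.includeLeft_apply, actLeft_tmul, evOne_apply, actRight_tmul,
      evOne_apply]
    simp [mul_assoc]

theorem mulAntipodeMiddle_comulRight (x : A ⊗[ℝ] A) (y : A ⊗[ℝ] (A ⊗[ℝ] A)) :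
    mulAntipodeMiddle
      (Algebra.TensorProduct.map (AlgHom.id ℝ A) (Bialgebra.comulAlgHom ℝ A) x * y) =
      ((Algebra.TensorProduct.rid ℝ ℝ A).toAlgHom.comp
        (Algebra.TensorProduct.map (AlgHom.id ℝ A) (Bialgebra.counitAlgHom ℝ A))) x *
      mulAntipodeMiddle y := by
  induction x with
  | zero => simp
  | add x x' hx hx' => simp only [map_add, add_mul, hx, hx']
  | tmul a b =>
    induction y with
    | zero => simp
    | add x x' hx hx' => simp only [map_add, mul_add, hx, hx']
    | tmul c t =>
      have h : evOne (actLeft (Bialgebra.comulAlgHom ℝ A b)) =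
          algebraMap ℝ A (Coalgebra.counit b) := by
        rw [evOne_actLeft]
        exact HopfAlgebra.mul_antipode_rTensor_comul_apply (R := ℝ) b
      rw [Algebra.TensorProduct.map_tmul, Algebra.TensorProduct.tmul_mul_tmul,
        mulAntipodeMiddle_tmul, mulAntipodeMiddle_tmul, actLeft_mul, evOne_apply,
        Module.End.mul_apply, ← evOne_apply (actLeft _), h, Algebra.algebraMap_eq_smul_one,
        map_smul, evOne_apply]
      simp [mul_assoc]

theorem mulAntipodeMiddle_comulLeft (x : A ⊗[ℝ] A) :
    mulAntipodeMiddle (((Algebra.TensorProduct.assoc ℝ ℝ ℝ A A A).toAlgHom.comp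
    (Algebra.TensorProduct.map (Bialgebra.comulAlgHom ℝ A) (AlgHom.id ℝ A))) x) =
      ((Algebra.TensorProduct.lid ℝ A).toAlgHom.comp
        (Algebra.TensorProduct.map (Bialgebra.counitAlgHom ℝ A) (AlgHom.id ℝ A))) x := by
  induction x with
  | zero => simp
  | add x x' hx hx' => simp only [map_add, hx, hx']
  | tmul a b =>
    have h : evOne (actRight (Bialgebra.comulAlgHom ℝ A a)) =
        algebraMap ℝ A (Coalgebra.counit a) := by
      rw [evOne_actRight]
      exact HopfAlgebra.mul_antipode_lTensor_comul_apply (R := ℝ) a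
    have key : ∀ t : A ⊗[ℝ] A, mulAntipodeMiddle
        ((Algebra.TensorProduct.assoc ℝ ℝ ℝ A A A) (t ⊗ₜ[ℝ] b)) = evOne (actRight t) * b := by
      intro t
      induction t with
      | zero => simp
      | add x x' hx hx' => simp only [TensorProduct.add_tmul, map_add, add_mul, hx, hx']
      | tmul x y =>
        rw [Algebra.TensorProduct.assoc_tmul, mulAntipodeMiddle_tmul, evOne_apply, evOne_apply,
          actLeft_tmul, actRight_tmul]
        simp [mul_assoc]
    rw [AlgHom.comp_apply, Algebra.TensorProduct.map_tmul]
    refine (key _).trans ?_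
    rw [h]
    simp [Algebra.smul_def]

/-- The cocycle identity rearranged so that `mulAntipodeMiddle` can be computed on both sides. -/
theorem IsTwist.cocycle_inverse {F : PowerSeries (A ⊗[ℝ] A)} (hF : IsTwist F) :
    leg23 (Ring.inverse F) * leg12 F = zcomulRight F * zcomulLeft (Ring.inverse F) := by
  have h := congrArg (fun x => leg23 (Ring.inverse F) * x * zcomulLeft (Ring.inverse F)) hF.cocycle
  simp only [mul_assoc] at h
  rw [← map_mul zcomulLeft, Ring.mul_inverse_cancel _ hF.isUnit, map_one, mul_one] at h
  rw [h, ← mul_assoc, ← map_mul leg23, Ring.inverse_mul_cancel _ hF.isUnit, map_one, one_mul]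

theorem IsTwist.counit_left_inverse {F : PowerSeries (A ⊗[ℝ] A)} (hF : IsTwist F) :
    zcounitLeft (Ring.inverse F) = 1 := by
  have h := congrArg zcounitLeft (Ring.mul_inverse_cancel F hF.isUnit)
  rwa [map_mul, hF.counit_left, one_mul, map_one] at h

theorem IsTwist.counit_right_inverse {F : PowerSeries (A ⊗[ℝ] A)} (hF : IsTwist F) :
    zcounitRight (Ring.inverse F) = 1 := by
  have h := congrArg zcounitRight (Ring.mul_inverse_cancel F hF.isUnit)
  rwa [map_mul, hF.counit_right, one_mul, map_one] at h

/-- Apply `a ⊗ b ⊗ c ↦ a S(b) c` to `F₂₃⁻¹ F₁₂ = (id ⊗ Δ)F (Δ ⊗ id)F⁻¹`: the left-hand side becomes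
`twElt F * twEltInv F⁻¹`, and the right-hand side collapses to `1` by the antipode axiom. -/
theorem IsTwist.twElt_mul_twEltInv {F : PowerSeries (A ⊗[ℝ] A)} (hF : IsTwist F) :
    twElt F * twEltInv (Ring.inverse F) = 1 := by
  have h1 : mapCoeff mulAntipodeMiddle (leg23 (Ring.inverse F) * leg12 F) =
      twElt F * twEltInv (Ring.inverse F) := by
    refine mapCoeff_mul_swap (fun y x => ?_) _ _
    simp only [LinearMap.comp_apply, ← evOne_actLeft, ← evOne_actRight]
    exact mulAntipodeMiddle_legs y x
  have h2 : mapCoeff mulAntipodeMiddle (zcomulRight F * zcomulLeft (Ring.inverse F)) =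
      zcounitRight F * mapCoeff mulAntipodeMiddle (zcomulLeft (Ring.inverse F)) := by
    have := mapCoeff_mul (β := mulAntipodeMiddle (A := A)) (ψ := AlgHom.id ℝ _)
      (γ := ((Algebra.TensorProduct.rid ℝ ℝ A).toAlgHom.comp
        (Algebra.TensorProduct.map (AlgHom.id ℝ A) (Bialgebra.counitAlgHom ℝ A))).toLinearMap)
      (δ := mulAntipodeMiddle)
      (fun x y => mulAntipodeMiddle_comulRight x y) F (zcomulLeft (Ring.inverse F))
    rw [mapAlgHom_id] at this
    refine this.trans ?_
    congr 1
    ext n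
    rw [coeff_mapCoeff, zcounitRight, coeff_mapAlgHom]
    rfl
  have h3 : mapCoeff mulAntipodeMiddle (zcomulLeft (Ring.inverse F)) =
      zcounitLeft (Ring.inverse F) := by
    ext n
    rw [coeff_mapCoeff, zcounitLeft, zcomulLeft, coeff_mapAlgHom, coeff_mapAlgHom]
    exact mulAntipodeMiddle_comulLeft _
  rw [← h1, hF.cocycle_inverse, h2, h3, hF.counit_right, hF.counit_left_inverse, one_mul]

theorem twElt_coeff_zero {F : PowerSeries (A ⊗[ℝ] A)} (h : coeff 0 F = 1) :
    coeff 0 (twElt F) = 1 := by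
  rw [twElt, coeff_mapCoeff, h, Algebra.TensorProduct.one_def]; simp

/-- If `φ` is `x ↦ ρ(x) v` on constants, then its `z`-linear extension is `X ↦ ρ(X) v`. -/
theorem extCoeff_eq {φ : A ⊗[ℝ] A →ₗ[ℝ] PowerSeries A} {ρ : A ⊗[ℝ] A →ₗ[ℝ] Module.End ℝ A}
    {v : PowerSeries A} (h : ∀ x n, coeff n (φ x) = ρ x (coeff n v))
    (X : PowerSeries (A ⊗[ℝ] A)) :
    extCoeff φ X = mapCoeff evOne (mapCoeff ρ X * mapAlgHom leftMul v) := by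
  ext n
  rw [extCoeff, PowerSeries.coeff_mk, coeff_mapCoeff, PowerSeries.coeff_mul, map_sum]
  refine Finset.sum_congr rfl fun x _ => ?_
  rw [h, coeff_mapCoeff, coeff_mapAlgHom]
  simp [evOne_apply, leftMul]

theorem extCoeff_mul_right (φ : A ⊗[ℝ] A →ₗ[ℝ] PowerSeries A) (v : PowerSeries A)
    (X : PowerSeries (A ⊗[ℝ] A)) :
    extCoeff φ X * v = extCoeff (LinearMap.mulRight ℝ v ∘ₗ φ) X := by
  ext n
  rw [extCoeff, extCoeff, PowerSeries.coeff_mk, PowerSeries.coeff_mul]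
  simp only [PowerSeries.coeff_mk, LinearMap.comp_apply, LinearMap.mulRight_apply,
    PowerSeries.coeff_mul, Finset.sum_mul, Finset.sum_sigma']
  apply Finset.sum_nbij' (fun ⟨⟨_i, j⟩, ⟨k, l⟩⟩ ↦ ⟨(k, l + j), (l, j)⟩)
    (fun ⟨⟨i, _j⟩, ⟨k, l⟩⟩ ↦ ⟨(i + k, l), (i, k)⟩) <;>
    simp +contextual only [Sigma.forall, Prod.forall, Finset.mem_sigma,
      Finset.HasAntidiagonal.mem_antidiagonal, and_imp, Sigma.mk.injEq, Prod.mk.injEq, heq_eq_eq,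
      true_and, and_true, implies_true] <;>
    intros <;> omega

theorem extCoeff_mul_left (φ : A ⊗[ℝ] A →ₗ[ℝ] PowerSeries A) (v : PowerSeries A)
    (X : PowerSeries (A ⊗[ℝ] A)) :
    v * extCoeff φ X = extCoeff (LinearMap.mulLeft ℝ v ∘ₗ φ) X := by
  ext n
  rw [extCoeff, extCoeff, PowerSeries.coeff_mk, PowerSeries.coeff_mul]
  simp only [PowerSeries.coeff_mk, LinearMap.comp_apply, LinearMap.mulLeft_apply,
    PowerSeries.coeff_mul, Finset.mul_sum, Finset.sum_sigma']
  apply Finset.sum_nbij' (fun ⟨⟨i, _j⟩, ⟨k, l⟩⟩ ↦ ⟨(k, i + l), (i, l)⟩)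
    (fun ⟨⟨a, _b⟩, ⟨c, d⟩⟩ ↦ ⟨(c, a + d), (a, d)⟩) <;>
    simp +contextual only [Sigma.forall, Prod.forall, Finset.mem_sigma,
      Finset.HasAntidiagonal.mem_antidiagonal, and_imp, Sigma.mk.injEq, Prod.mk.injEq, heq_eq_eq,
      true_and, and_true, implies_true] <;>
    intros <;> omega

theorem coeff_C_mul_mul_C (a b : A) (v : PowerSeries A) (n : ℕ) :
    coeff n (PowerSeries.C a * (v * PowerSeries.C b)) = a * (coeff n v * b) := by
  rw [PowerSeries.coeff_C_mul, PowerSeries.coeff_mul_C]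

theorem mapCoeff_C (φ : A →ₗ[ℝ] A) (a : A) :
    mapCoeff φ (PowerSeries.C a) = PowerSeries.C (φ a) := by
  ext n
  by_cases hn : n = 0 <;> simp [coeff_mapCoeff, PowerSeries.coeff_C, hn]

/-- With `v = twElt F`, the map `a ⊗ b ↦ a v S₀(b) v⁻¹` multiplied by `v` is the action of `a ⊗ b`
on `v`. -/
theorem mulAntipodeRight_mul_twElt {F : PowerSeries (A ⊗[ℝ] A)} (hv : IsUnit (twElt F))
    (Y : PowerSeries (A ⊗[ℝ] A)) :
    mulAntipodeRight F Y * twElt F =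
      mapCoeff evOne (mapCoeff actRight Y * mapAlgHom leftMul (twElt F)) := by
  rw [mulAntipodeRight, extCoeff_mul_right]
  refine extCoeff_eq (fun x n => ?_) Y
  induction x with
  | zero => simp
  | add x y hx hy => rw [map_add, map_add, hx, hy, map_add]; rfl
  | tmul a b =>
    rw [actRight_tmul, ← coeff_C_mul_mul_C]
    simp only [LinearMap.comp_apply, TensorProduct.map_tmul, LinearMap.mul'_apply,
      LinearMap.mulRight_apply]
    congr 1
    change PowerSeries.C a * (twElt F * mapCoeff (HopfAlgebra.antipode ℝ (A := A))
      (PowerSeries.C b) * Ring.inverse (twElt F)) * twElt F = _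
    rw [mapCoeff_C, mul_assoc, mul_assoc (twElt F * _), Ring.inverse_mul_cancel _ hv, mul_one]

theorem twEltInv_mul_mulAntipodeLeft {F : PowerSeries (A ⊗[ℝ] A)} (hv : IsUnit (twElt F))
    (Y : PowerSeries (A ⊗[ℝ] A)) :
    Ring.inverse (twElt F) * mulAntipodeLeft F Y =
      mapCoeff evOne (mapCoeff actLeft Y * mapAlgHom leftMul (Ring.inverse (twElt F))) := by
  rw [mulAntipodeLeft, extCoeff_mul_left]
  refine extCoeff_eq (fun x n => ?_) Y
  induction x with
  | zero => simp
  | add x y hx hy => rw [map_add, map_add, hx, hy, map_add]; rfl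
  | tmul a b =>
    rw [actLeft_tmul, ← coeff_C_mul_mul_C]
    simp only [LinearMap.comp_apply, TensorProduct.map_tmul, LinearMap.mul'_apply,
      LinearMap.mulLeft_apply]
    congr 1
    change Ring.inverse (twElt F) * (twElt F * mapCoeff (HopfAlgebra.antipode ℝ (A := A))
      (PowerSeries.C a) * Ring.inverse (twElt F) * PowerSeries.C b) = _
    rw [mapCoeff_C]
    simp only [← mul_assoc]
    rw [Ring.inverse_mul_cancel _ hv, one_mul]

/-- Drinfeld's theorem: a twisting element defines a Hopf algebra structure. Coassociativity is the
cocycle identity, and the antipode axioms follow from the invertibility of `v = twElt F`, which is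
`1` at `z = 0`. -/
theorem IsTwist.isTwistedHopfAlgebra {F : PowerSeries (A ⊗[ℝ] A)} (hF : IsTwist F)
    (h0 : coeff 0 F = 1) : IsTwistedHopfAlgebra F := by
  have hv : IsUnit (twElt F) := isUnit_of_coeff_zero_eq_one (twElt_coeff_zero h0)
  have hw : Ring.inverse (twElt F) = twEltInv (Ring.inverse F) := by
    rw [← mul_one (Ring.inverse (twElt F)), ← hF.twElt_mul_twEltInv, ← mul_assoc,
      Ring.inverse_mul_cancel _ hv, one_mul]
  have hFG : F * Ring.inverse F = 1 := Ring.mul_inverse_cancel _ hF.isUnit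
  have hGF : Ring.inverse F * F = 1 := Ring.inverse_mul_cancel _ hF.isUnit
  refine ⟨twComul_one hF.isUnit, twComul_mul hF.isUnit, fun a => ?_, fun a => ?_, fun a => ?_,
    fun a => ?_, fun a => ?_⟩
  · have hi : Ring.inverse (leg12 F) = leg12 (Ring.inverse F) :=
      inverse_eq_of_mul_eq_one (by rw [← map_mul, hFG, map_one]) (by rw [← map_mul, hGF, map_one])
    have hi' : Ring.inverse (leg23 F) = leg23 (Ring.inverse F) :=
      inverse_eq_of_mul_eq_one (by rw [← map_mul, hFG, map_one]) (by rw [← map_mul, hGF, map_one])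
    have hc : zcomulLeft (Ring.inverse F) * leg12 (Ring.inverse F) =
        zcomulRight (Ring.inverse F) * leg23 (Ring.inverse F) := by
      rw [← hi, ← hi']
      have e1 : zcomulLeft (Ring.inverse F) * leg12 (Ring.inverse F) *
          (leg12 F * zcomulLeft F) = 1 := by
        rw [mul_assoc, ← mul_assoc (leg12 _), ← map_mul leg12, hGF, map_one, one_mul, ← map_mul,
          hGF, map_one]
      have e2 : (leg12 F * zcomulLeft F) *
          (zcomulRight (Ring.inverse F) * leg23 (Ring.inverse F)) = 1 := by
        rw [hF.cocycle, mul_assoc, ← mul_assoc (zcomulRight F), ← map_mul zcomulRight, hFG,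
          map_one, one_mul, ← map_mul, hFG, map_one]
      rw [hi, hi']
      exact left_inv_eq_right_inv e1 e2
    simp only [twComulLeft, twComulRight, twComul, map_mul, hi, hi']
    rw [mul_assoc, mul_assoc, mul_assoc, hc, ← mul_assoc, hF.cocycle, zcomulLeft_zcomul]
    simp only [mul_assoc]
  · rw [twComul, map_mul, map_mul, hF.counit_left, hF.counit_left_inverse, one_mul, mul_one,
      zcounitLeft_zcomul]
  · rw [twComul, map_mul, map_mul, hF.counit_right, hF.counit_right_inverse, one_mul, mul_one,
      zcounitRight_zcomul]
  · have key := twEltInv_mul_mulAntipodeLeft hv (twComul F a)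
    rw [hw] at key
    have e : mapCoeff evOne (mapCoeff actLeft (twComul F a) *
        mapAlgHom leftMul (twEltInv (Ring.inverse F))) =
        twEltInv (Ring.inverse F) * zcounit a := by
      rw [twEltInv_eq, mapCoeff_evOne_mul, ← mapCoeff_actLeft_mul, twComul, ← mul_assoc,
        ← mul_assoc, hGF, one_mul, mapCoeff_actLeft_mul, ← mapCoeff_evOne_mul,
        evOne_actLeft_zcomul, mapCoeff_evOne_mul_zcounit]
    rw [e] at key
    have h := congrArg (twElt F * ·) key
    simpa only [← mul_assoc, hF.twElt_mul_twEltInv, one_mul] using h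
  · have key := mulAntipodeRight_mul_twElt hv (twComul F a)
    have e : mapCoeff evOne (mapCoeff actRight (twComul F a) *
        mapAlgHom leftMul (twElt F)) = twElt F * zcounit a := by
      rw [twElt_eq, mapCoeff_evOne_mul, ← mapCoeff_actRight_mul, twComul, mul_assoc,
        hGF, mul_one, mapCoeff_actRight_mul, ← mapCoeff_evOne_mul,
        evOne_actRight_zcomul, mapCoeff_evOne_mul_zcounit]
    rw [e, ← (commute_zcounit a _).eq] at key
    exact hv.mul_right_cancel key

/-! ### The universal `R`-matrix of a twisted cocommutative Hopf algebra -/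

/-- `a ⊗ b ⊗ c ↦ b ⊗ a ⊗ c`. -/
def swap12 : PowerSeries (A ⊗[ℝ] (A ⊗[ℝ] A)) →ₐ[ℝ] PowerSeries (A ⊗[ℝ] (A ⊗[ℝ] A)) :=
  mapAlgHom (Algebra.TensorProduct.leftComm ℝ A A A).toAlgHom

/-- `a ⊗ b ⊗ c ↦ a ⊗ c ⊗ b`. -/
def swap23 : PowerSeries (A ⊗[ℝ] (A ⊗[ℝ] A)) →ₐ[ℝ] PowerSeries (A ⊗[ℝ] (A ⊗[ℝ] A)) :=
  mapAlgHom (Algebra.TensorProduct.map (AlgHom.id ℝ A)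
    (Algebra.TensorProduct.comm ℝ A A).toAlgHom)

theorem mapAlgHom_congr_tensor {B : Type*} [Ring B] [Algebra ℝ B] {φ ψ : A ⊗[ℝ] A →ₐ[ℝ] B}
    (h : ∀ a b, φ (a ⊗ₜ b) = ψ (a ⊗ₜ b)) (F : PowerSeries (A ⊗[ℝ] A)) :
    mapAlgHom φ F = mapAlgHom ψ F := by
  refine mapAlgHom_congr (fun x => ?_) F
  induction x with
  | zero => simp
  | add x y hx hy => rw [map_add, map_add, hx, hy]
  | tmul a b => exact h a b

theorem swap12_leg12 (F : PowerSeries (A ⊗[ℝ] A)) : swap12 (leg12 F) = leg12 (zflip F) := by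
  rw [swap12, leg12, zflip, mapAlgHom_mapAlgHom, mapAlgHom_mapAlgHom]
  exact mapAlgHom_congr_tensor (fun a b => by simp) F

theorem swap12_leg23 (F : PowerSeries (A ⊗[ℝ] A)) : swap12 (leg23 F) = leg13 F := by
  rw [swap12, leg23, leg13, mapAlgHom_mapAlgHom]
  exact mapAlgHom_congr_tensor (fun a b => by simp) F

theorem swap12_leg13 (F : PowerSeries (A ⊗[ℝ] A)) : swap12 (leg13 F) = leg23 F := by
  rw [swap12, leg23, leg13, mapAlgHom_mapAlgHom]
  exact mapAlgHom_congr_tensor (fun a b => by simp) F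

theorem swap23_leg12 (F : PowerSeries (A ⊗[ℝ] A)) : swap23 (leg12 F) = leg13 F := by
  rw [swap23, leg12, leg13, mapAlgHom_mapAlgHom]
  exact mapAlgHom_congr_tensor (fun a b => by simp) F

theorem swap23_leg13 (F : PowerSeries (A ⊗[ℝ] A)) : swap23 (leg13 F) = leg12 F := by
  rw [swap23, leg12, leg13, mapAlgHom_mapAlgHom]
  exact mapAlgHom_congr_tensor (fun a b => by simp) F

theorem swap23_leg23 (F : PowerSeries (A ⊗[ℝ] A)) : swap23 (leg23 F) = leg23 (zflip F) := by
  rw [swap23, leg23, zflip, mapAlgHom_mapAlgHom, mapAlgHom_mapAlgHom]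
  exact mapAlgHom_congr_tensor (fun a b => by simp) F

theorem swap12_zcomulRight (F : PowerSeries (A ⊗[ℝ] A)) :
    swap23 (swap12 (zcomulRight F)) = zcomulLeft (zflip F) := by
  rw [swap23, swap12, zcomulRight, zcomulLeft, zflip, mapAlgHom_mapAlgHom, mapAlgHom_mapAlgHom,
    mapAlgHom_mapAlgHom]
  refine mapAlgHom_congr_tensor (fun a b => ?_) F
  change Algebra.TensorProduct.map (AlgHom.id ℝ A) (Algebra.TensorProduct.comm ℝ A A).toAlgHom
      (Algebra.TensorProduct.leftComm ℝ A A A (a ⊗ₜ[ℝ] Bialgebra.comulAlgHom ℝ A b)) =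
    Algebra.TensorProduct.assoc ℝ ℝ ℝ A A A (Bialgebra.comulAlgHom ℝ A b ⊗ₜ[ℝ] a)
  generalize (Bialgebra.comulAlgHom ℝ A) b = t
  induction t with
  | zero => simp
  | tmul x y => simp
  | add x y hx hy => simp only [TensorProduct.add_tmul, TensorProduct.tmul_add, map_add, hx, hy]

theorem swap12_zcomulLeft (F : PowerSeries (A ⊗[ℝ] A)) :
    swap12 (swap23 (zcomulLeft F)) = zcomulRight (zflip F) := by
  rw [swap23, swap12, zcomulRight, zcomulLeft, zflip, mapAlgHom_mapAlgHom, mapAlgHom_mapAlgHom,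
    mapAlgHom_mapAlgHom]
  refine mapAlgHom_congr_tensor (fun a b => ?_) F
  change Algebra.TensorProduct.leftComm ℝ A A A
      (Algebra.TensorProduct.map (AlgHom.id ℝ A) (Algebra.TensorProduct.comm ℝ A A).toAlgHom
        (Algebra.TensorProduct.assoc ℝ ℝ ℝ A A A (Bialgebra.comulAlgHom ℝ A a ⊗ₜ[ℝ] b))) =
    b ⊗ₜ[ℝ] Bialgebra.comulAlgHom ℝ A a
  generalize (Bialgebra.comulAlgHom ℝ A) a = t
  induction t with
  | zero => simp
  | tmul x y => simp
  | add x y hx hy => simp only [TensorProduct.add_tmul, TensorProduct.tmul_add, map_add, hx, hy]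

theorem swap12_zcomulLeft_of_cocomm
    (hA : ∀ a : A, Algebra.TensorProduct.comm ℝ A A (Bialgebra.comulAlgHom ℝ A a) =
      Bialgebra.comulAlgHom ℝ A a) (F : PowerSeries (A ⊗[ℝ] A)) :
    swap12 (zcomulLeft F) = zcomulLeft F := by
  rw [swap12, zcomulLeft, mapAlgHom_mapAlgHom]
  refine mapAlgHom_congr_tensor (fun a b => ?_) F
  have h : ∀ t : A ⊗[ℝ] A, Algebra.TensorProduct.leftComm ℝ A A A
      (Algebra.TensorProduct.assoc ℝ ℝ ℝ A A A (t ⊗ₜ[ℝ] b)) =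
      Algebra.TensorProduct.assoc ℝ ℝ ℝ A A A
        (Algebra.TensorProduct.comm ℝ A A t ⊗ₜ[ℝ] b) := by
    intro t
    induction t with
    | zero => simp
    | tmul x y => simp
    | add x y hx hy => simp only [TensorProduct.add_tmul, map_add, hx, hy]
  have h' := h (Bialgebra.comulAlgHom ℝ A a)
  rw [hA] at h'
  exact h'

theorem swap23_zcomulRight_of_cocomm
    (hA : ∀ a : A, Algebra.TensorProduct.comm ℝ A A (Bialgebra.comulAlgHom ℝ A a) =
      Bialgebra.comulAlgHom ℝ A a) (F : PowerSeries (A ⊗[ℝ] A)) :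
    swap23 (zcomulRight F) = zcomulRight F := by
  rw [swap23, zcomulRight, mapAlgHom_mapAlgHom]
  refine mapAlgHom_congr_tensor (fun a b => ?_) F
  change a ⊗ₜ[ℝ] Algebra.TensorProduct.comm ℝ A A (Bialgebra.comulAlgHom ℝ A b) =
    a ⊗ₜ[ℝ] Bialgebra.comulAlgHom ℝ A b
  rw [hA]

theorem zflip_zcomul_of_cocomm
    (hA : ∀ a : A, Algebra.TensorProduct.comm ℝ A A (Bialgebra.comulAlgHom ℝ A a) =
      Bialgebra.comulAlgHom ℝ A a) (f : PowerSeries A) : zflip (zcomul f) = zcomul f := by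
  rw [zflip, zcomul, mapAlgHom_mapAlgHom]
  exact mapAlgHom_congr hA f

/-- If `A` is cocommutative, then `ℛ = F₂₁ F⁻¹` is a universal `R`-matrix. The hexagon identities
follow from the cocycle identity of `F` and its images under permutations of the tensor factors. -/
theorem IsTwist.isUniversalRMatrix {F : PowerSeries (A ⊗[ℝ] A)} (hF : IsTwist F)
    (hA : ∀ a : A, Algebra.TensorProduct.comm ℝ A A (Bialgebra.comulAlgHom ℝ A a) =
      Bialgebra.comulAlgHom ℝ A a) :
    IsUniversalRMatrix F (zflip F * Ring.inverse F) := by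
  obtain ⟨u, hu⟩ := hF.isUnit
  have hinv : Ring.inverse F = ↑u⁻¹ := by rw [← hu, Ring.inverse_unit]
  -- all the elements below are units, and the identities are identities in the group of units
  set U12 := Units.map (leg12 (A := A)).toMonoidHom' u with h12
  set U13 := Units.map (leg13 (A := A)).toMonoidHom' u with h13
  set U23 := Units.map (leg23 (A := A)).toMonoidHom' u with h23
  set W := Units.map (zflip (A := A)).toMonoidHom' u with hW
  set U21 := Units.map (leg12 (A := A)).toMonoidHom' W with h21
  set U31 := Units.map (leg13 (A := A)).toMonoidHom' W with h31
  set U32 := Units.map (leg23 (A := A)).toMonoidHom' W with h32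
  set P12 := Units.map (swap12 (A := A)).toMonoidHom'
  set P23 := Units.map (swap23 (A := A)).toMonoidHom'
  set a := Units.map (zcomulLeft (A := A)).toMonoidHom' u with ha
  set b := Units.map (zcomulRight (A := A)).toMonoidHom' u with hb
  have c1 : U12 * a = U23 * b := Units.ext (by
    have h := hF.cocycle
    rw [← hu] at h
    exact h)
  have p1 : P23 U12 = U13 := Units.ext (swap23_leg12 _)
  have p2 : P23 U23 = U32 := Units.ext (swap23_leg23 _)
  have p3 : P12 U13 = U23 := Units.ext (swap12_leg13 _)
  have p4 : P12 U12 = U21 := Units.ext (swap12_leg12 _)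
  have p5 : P12 U23 = U13 := Units.ext (swap12_leg23 _)
  have p6 : P12 U32 = U31 := Units.ext (swap12_leg23 _)
  have p7 : P23 U21 = U31 := Units.ext (swap23_leg12 _)
  have p8 : P23 U13 = U12 := Units.ext (swap23_leg13 _)
  have pa : P12 a = a := Units.ext (swap12_zcomulLeft_of_cocomm hA _)
  have pb : P23 b = b := Units.ext (swap23_zcomulRight_of_cocomm hA _)
  have pe : P12 (P23 a) = Units.map (zcomulRight (A := A)).toMonoidHom' W :=
    Units.ext (swap12_zcomulLeft _)
  have pg : P23 (P12 b) = Units.map (zcomulLeft (A := A)).toMonoidHom' W :=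
    Units.ext (swap12_zcomulRight _)
  have c2 : U13 * P23 a = U32 * b := by
    have := congrArg P23 c1; rwa [map_mul, map_mul, p1, p2, pb] at this
  have c3 : U23 * P12 (P23 a) = U31 * P12 b := by
    have := congrArg P12 c2; rwa [map_mul, map_mul, p3, p6] at this
  have c4 : U21 * a = U13 * P12 b := by
    have := congrArg P12 c1; rwa [map_mul, map_mul, p4, p5, pa] at this
  have c5 : U31 * P23 a = U12 * P23 (P12 b) := by
    have := congrArg P23 c4; rwa [map_mul, map_mul, p7, p8] at this
  have hR : zflip F * Ring.inverse F = ↑(W * u⁻¹) := by rw [hinv, ← hu]; rfl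
  have hi12 : Ring.inverse (leg12 F) = ↑U12⁻¹ := by rw [← hu]; exact Ring.inverse_unit U12
  have hi23 : Ring.inverse (leg23 F) = ↑U23⁻¹ := by rw [← hu]; exact Ring.inverse_unit U23
  rw [hR]
  refine ⟨Units.isUnit _, fun x => ?_, ?_, ?_⟩
  · have : zflip (twComul F x) = ↑W * zcomul x * ↑W⁻¹ := by
      rw [twComul, map_mul, map_mul, zflip_zcomul_of_cocomm hA, hinv, ← hu]
      rfl
    rw [this, twComul, hinv, ← hu, Units.val_mul]
    simp only [mul_assoc, Units.inv_mul_cancel_left]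
  · have e1 : Units.map (zcomulLeft (A := A)).toMonoidHom' (W * u⁻¹) = P23 (P12 b) * a⁻¹ := by
      rw [map_mul, map_inv, pg]
    have e2 : U12 * (P23 (P12 b) * a⁻¹) * U12⁻¹ =
        Units.map (leg13 (A := A)).toMonoidHom' (W * u⁻¹) *
        Units.map (leg23 (A := A)).toMonoidHom' (W * u⁻¹) := by
      simp only [map_mul, map_inv]
      change _ = U31 * U13⁻¹ * (U32 * U23⁻¹)
      have e3 : P23 a = U13⁻¹ * (U32 * b) := by rw [← c2, inv_mul_cancel_left]
      have e4 : a⁻¹ * U12⁻¹ = b⁻¹ * U23⁻¹ := by rw [← mul_inv_rev, ← mul_inv_rev, c1]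
      rw [← mul_assoc, ← c5, e3, mul_assoc, e4]
      group
    have e5 := congrArg Units.val e2
    rw [← e1, Units.val_mul, Units.val_mul] at e5
    rw [twComulLeft, hi12, ← hu]
    exact e5
  · have e1 : Units.map (zcomulRight (A := A)).toMonoidHom' (W * u⁻¹) = P12 (P23 a) * b⁻¹ := by
      rw [map_mul, map_inv, pe]
    have e2 : U23 * (P12 (P23 a) * b⁻¹) * U23⁻¹ =
        Units.map (leg13 (A := A)).toMonoidHom' (W * u⁻¹) *
        Units.map (leg12 (A := A)).toMonoidHom' (W * u⁻¹) := by
      simp only [map_mul, map_inv]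
      change _ = U31 * U13⁻¹ * (U21 * U12⁻¹)
      have e3 : P12 b = U13⁻¹ * (U21 * a) := by rw [c4, inv_mul_cancel_left]
      have e4 : b⁻¹ * U23⁻¹ = a⁻¹ * U12⁻¹ := by rw [← mul_inv_rev, ← mul_inv_rev, c1]
      rw [← mul_assoc, c3, e3, mul_assoc, e4]
      group
    have e5 := congrArg Units.val e2
    rw [← e1, Units.val_mul, Units.val_mul] at e5
    rw [twComulRight, hi23, ← hu]
    exact e5

end Twist

/-! ### The commutative algebra of translations -/

section Translations

open PowerSeries (coeff constantCoeff X mapAlgHom)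

theorem toU_add (x y : SO42) : toU (x + y) = toU x + toU y := map_add _ x y

theorem toU_sub (x y : SO42) : toU (x - y) = toU x - toU y := map_sub _ x y

theorem toU_neg (x : SO42) : toU (-x) = -toU x := map_neg _ x

theorem toU_smul (r : ℝ) (x : SO42) : toU (r • x) = r • toU x := map_smul _ r x

theorem toU_zero : toU 0 = 0 := map_zero (UniversalEnvelopingAlgebra.ι ℝ (L := SO42))

theorem toU_lie (x y : SO42) : toU ⁅x, y⁆ = toU x * toU y - toU y * toU x := by
  let _ : LieRing U42 := LieRing.ofAssociativeRing
  exact LieHom.map_lie (UniversalEnvelopingAlgebra.ι ℝ) x y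

theorem toU_mul_comm {x y : SO42} (h : ⁅x, y⁆ = 0) : toU x * toU y = toU y * toU x := by
  rw [← sub_eq_zero, ← toU_lie, h, toU_zero]

/-- The subalgebra of `U(so(4,2))` generated by the translations. -/
def transSubalgebra : Subalgebra ℝ U42 := Algebra.adjoin ℝ (Set.range fun μ => toU (transP μ))

theorem transP_comm (μ ν : Fin 4) : ⁅transP μ, transP ν⁆ = 0 :=
  (so42_relations' 0 0 μ ν).2.2.2.2.2.2.2.2.2.2.2.2.2.1

/-- The algebra generated by the translations, as a type of its own that carries a commutative ring
structure: identities between translations are then proved by commutative algebra. -/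
def TransAlg : Type := transSubalgebra

instance : Ring TransAlg := inferInstanceAs (Ring transSubalgebra)

instance : CommRing TransAlg where
  mul_comm a b := by
    have h : IsMulCommutative transSubalgebra := Algebra.isMulCommutative_adjoin ℝ (by
      rintro _ ⟨μ, rfl⟩ _ ⟨ν, rfl⟩
      exact toU_mul_comm (transP_comm μ ν))
    exact h.is_comm.comm a b

instance : Algebra ℝ TransAlg := inferInstanceAs (Algebra ℝ transSubalgebra)

/-- The inclusion of the algebra of translations in `U(so(4,2))`. -/
def transVal : TransAlg →ₐ[ℝ] U42 := transSubalgebra.val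

/-- Formal power series with coefficients in the commutative algebra of translations. -/
abbrev Cz : Type := PowerSeries TransAlg

/-- The inclusion of `Cz` in `U(so(4,2))[[z]]`. -/
def val : Cz →ₐ[ℝ] Uz := mapAlgHom transVal

/-- The undeformed translations, as elements of `Cz`. -/
def tP (μ : Fin 4) : Cz :=
  PowerSeries.C (⟨toU (transP μ), Algebra.subset_adjoin ⟨μ, rfl⟩⟩ : transSubalgebra)

theorem val_tP (μ : Fin 4) : val (tP μ) = emb (transP μ) := mapAlgHom_C _ _

theorem val_X : val X = z := mapAlgHom_X _

/-- `T₋` in `Cz`. -/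
def cTm : Cz := (1 / 2 : ℝ) • (tP 0 - tP 1)

/-- `T₊` in `Cz`. -/
def cTp : Cz := (1 / 2 : ℝ) • (tP 0 + tP 1)

/-- `T₂` in `Cz`. -/
def cT2 : Cz := (1 / 2 : ℝ) • (tP 2 - tP 3)

/-- `T₃` in `Cz`. -/
def cT3 : Cz := (1 / 2 : ℝ) • (tP 2 + tP 3)

/-- `σ₋` in `Cz`. -/
def cσm : Cz := zlog (-((2 : ℝ) • (X * cTm)))

/-- `T` in `Cz`. -/
def cT : Cz := cTp + X * (cT2 ^ 2 + cT3 ^ 2) * zexp (-cσm)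

/-- `σ₊` in `Cz`. -/
def cσp : Cz := zlog (-((2 : ℝ) • (X * cT)))

/-- The deformed translations in `Cz`. -/
def cPz : Fin 4 → Cz :=
  ![-((1 / 2 : ℝ) • zdiv (cσp + cσm)), -((1 / 2 : ℝ) • zdiv (cσp - cσm)),
    (cT3 + cT2) * zexp (-cσm), (cT3 - cT2) * zexp (-cσm)]

theorem emb_add (x y : SO42) : emb (x + y) = emb x + emb y := by
  rw [emb, toU_add, map_add]; rfl

theorem emb_sub (x y : SO42) : emb (x - y) = emb x - emb y := by
  rw [emb, toU_sub, map_sub]; rfl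

theorem emb_neg (x : SO42) : emb (-x) = -emb x := by
  rw [emb, toU_neg, map_neg]; rfl

theorem emb_zero : emb 0 = 0 := by rw [emb, toU_zero, map_zero]

theorem emb_smul (r : ℝ) (x : SO42) : emb (r • x) = r • emb x := by
  rw [emb, toU_smul]
  exact (constLin (A := U42)).map_smul r (toU x)

theorem emb_lie (x y : SO42) : emb ⁅x, y⁆ = emb x * emb y - emb y * emb x := by
  rw [emb, toU_lie, map_sub, map_mul, map_mul]; rfl

theorem val_zexp (f : Cz) : val (zexp f) = zexp (val f) := map_zexp _ f

theorem val_zlog (f : Cz) : val (zlog f) = zlog (val f) := map_zlog _ f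

theorem val_zdiv (f : Cz) : val (zdiv f) = zdiv (val f) := map_zdiv _ f

theorem val_cTm : val cTm = NullPlane.Tm := by
  rw [cTm, map_smul, map_sub, val_tP, val_tP, NullPlane.Tm, emb_smul, emb_sub]

theorem val_cTp : val cTp = NullPlane.Tp := by
  rw [cTp, map_smul, map_add, val_tP, val_tP, NullPlane.Tp, emb_smul, emb_add]

theorem val_cT2 : val cT2 = NullPlane.T2 := by
  rw [cT2, map_smul, map_sub, val_tP, val_tP, NullPlane.T2, emb_smul, emb_sub]

theorem val_cT3 : val cT3 = NullPlane.T3 := by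
  rw [cT3, map_smul, map_add, val_tP, val_tP, NullPlane.T3, emb_smul, emb_add]

theorem val_cσm : val cσm = NullPlane.σm := by
  rw [cσm, val_zlog, map_neg, map_smul, map_mul, val_X, val_cTm, NullPlane.σm]

theorem val_cT : val cT = NullPlane.T := by
  rw [cT, map_add, map_mul, map_mul, map_add, map_pow, map_pow, val_zexp, map_neg, val_X,
    val_cTp, val_cT2, val_cT3, val_cσm, NullPlane.T]

theorem val_cσp : val cσp = NullPlane.σp := by
  rw [cσp, val_zlog, map_neg, map_smul, map_mul, val_X, val_cT, NullPlane.σp]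

theorem val_cPz (μ : Fin 4) : val (cPz μ) = Pz μ := by
  fin_cases μ
  · simp only [cPz, Pz, Fin.zero_eta, Matrix.cons_val_zero, map_neg, map_smul, val_zdiv, map_add,
      val_cσp, val_cσm]
  · simp [cPz, Pz, val_zdiv, val_cσp, val_cσm]
  · simp [cPz, Pz, val_zexp, val_cσm, val_cT2, val_cT3]
  · simp [cPz, Pz, val_zexp, val_cσm, val_cT2, val_cT3]

theorem constantCoeff_cσm : constantCoeff cσm = 0 := constantCoeff_zlog _

theorem constantCoeff_cσp : constantCoeff cσp = 0 := constantCoeff_zlog _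

theorem zexp_cσm : zexp cσm = 1 - (2 : ℝ) • (X * cTm) := by
  rw [cσm, zexp_zlog (by rw [map_neg, PowerSeries.constantCoeff_smul, map_mul]; simp),
    sub_eq_add_neg]

theorem zexp_cσp : zexp cσp = 1 - (2 : ℝ) • (X * cT) := by
  rw [cσp, zexp_zlog (by rw [map_neg, PowerSeries.constantCoeff_smul, map_mul]; simp),
    sub_eq_add_neg]

theorem X_mul_cPz_zero : X * cPz 0 = -((1 / 2 : ℝ) • (cσp + cσm)) := by
  rw [show cPz 0 = -((1 / 2 : ℝ) • zdiv (cσp + cσm)) from rfl, mul_neg, mul_smul_comm,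
    X_mul_zdiv _ (by rw [map_add, constantCoeff_cσm, constantCoeff_cσp, add_zero])]

theorem X_mul_cPz_one : X * cPz 1 = -((1 / 2 : ℝ) • (cσp - cσm)) := by
  rw [show cPz 1 = -((1 / 2 : ℝ) • zdiv (cσp - cσm)) from rfl, mul_neg, mul_smul_comm,
    X_mul_zdiv _ (by rw [map_sub, constantCoeff_cσm, constantCoeff_cσp, sub_zero])]

theorem cPz_two : cPz 2 = tP 2 * zexp (-cσm) := by
  rw [show cPz 2 = (cT3 + cT2) * zexp (-cσm) from rfl, cT3, cT2]
  congr 1; module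

theorem cPz_three : cPz 3 = tP 3 * zexp (-cσm) := by
  rw [show cPz 3 = (cT3 - cT2) * zexp (-cσm) from rfl, cT3, cT2]
  congr 1; module

theorem cσm_eq : cσm = -(X * cPz 0) + X * cPz 1 := by
  rw [X_mul_cPz_zero, X_mul_cPz_one]; module

theorem cσp_eq : cσp = -(X * cPz 0) - X * cPz 1 := by
  rw [X_mul_cPz_zero, X_mul_cPz_one]; module

theorem constantCoeff_X_mul {A : Type*} [Ring A] (f : PowerSeries A) :
    constantCoeff (X * f) = 0 := by
  simp

/-- `e^{z P₀}` in `Cz`. -/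
def ex : Cz := zexp (X * cPz 0)

/-- `e^{-z P₀}` in `Cz`. -/
def exi : Cz := zexp (-(X * cPz 0))

/-- `e^{z P₁}` in `Cz`. -/
def ey : Cz := zexp (X * cPz 1)

/-- `e^{-z P₁}` in `Cz`. -/
def eyi : Cz := zexp (-(X * cPz 1))

theorem ex_mul_exi : ex * exi = 1 := zexp_mul_neg (constantCoeff_X_mul _)

theorem ey_mul_eyi : ey * eyi = 1 := zexp_mul_neg (constantCoeff_X_mul _)

theorem zexp_add_comm {f g : Cz} (hf : constantCoeff f = 0) (hg : constantCoeff g = 0) :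
    zexp (f + g) = zexp f * zexp g := zexp_add hf hg (Commute.all f g)

theorem zexp_cσm_eq : zexp cσm = exi * ey := by
  rw [cσm_eq, zexp_add_comm (by simp) (by simp)]; rfl

theorem zexp_neg_cσm_eq : zexp (-cσm) = ex * eyi := by
  rw [cσm_eq, neg_add, neg_neg, zexp_add_comm (by simp) (by simp)]; rfl

theorem zexp_cσp_eq : zexp cσp = exi * eyi := by
  rw [cσp_eq, sub_eq_add_neg, zexp_add_comm (by simp) (by simp)]; rfl

theorem zexp_neg_cσp_eq : zexp (-cσp) = ex * ey := by
  rw [cσp_eq, neg_sub, sub_neg_eq_add, add_comm, zexp_add_comm (by simp) (by simp)]; rfl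

/-! ### Commutators with series in the translations -/

/-- `[S, p] = d` for series `p, d` in the translations. For fixed `S` this is the graph of a
derivation, defined on those `p` whose commutator with `S` is again a series in the translations. -/
def Brk (S : Uz) (p d : Cz) : Prop := S * val p - val p * S = val d

variable {S : Uz} {p q d e : Cz}

theorem Brk.add (h : Brk S p d) (h' : Brk S q e) : Brk S (p + q) (d + e) := by
  rw [Brk, map_add, map_add, ← h, ← h', mul_add, add_mul]; abel

theorem Brk.neg (h : Brk S p d) : Brk S (-p) (-d) := by
  rw [Brk, map_neg, map_neg, ← h, mul_neg, neg_mul]; abel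

theorem Brk.sub (h : Brk S p d) (h' : Brk S q e) : Brk S (p - q) (d - e) := by
  rw [sub_eq_add_neg, sub_eq_add_neg]; exact h.add h'.neg

theorem Brk.smul (r : ℝ) (h : Brk S p d) : Brk S (r • p) (r • d) := by
  rw [Brk, map_smul, map_smul, ← h, mul_smul_comm, smul_mul_assoc, smul_sub]

theorem Brk.mul (h : Brk S p d) (h' : Brk S q e) : Brk S (p * q) (d * q + p * e) := by
  rw [Brk, map_mul, map_add, map_mul, map_mul, ← h, ← h']
  noncomm_ring

theorem Brk.X_mul (h : Brk S p d) : Brk S (X * p) (X * d) := by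
  rw [Brk, map_mul, map_mul, ← h, val_X, mul_sub, ← mul_assoc, z,
    (PowerSeries.commute_X S).eq]
  simp only [mul_assoc]

theorem Brk.of_X_mul (h : Brk S (X * p) (X * d)) : Brk S p d := by
  rw [Brk, map_mul, map_mul, val_X, z, ← mul_assoc, (PowerSeries.commute_X S).eq, mul_assoc,
    mul_assoc, ← mul_sub] at h
  exact X_mul_cancel h

theorem Brk.congr (h : Brk S p d) (hd : d = e) : Brk S p e := hd ▸ h

theorem Brk.congr' (h : Brk S p d) (hp : p = q) (hd : d = e) : Brk S q e := hp ▸ hd ▸ h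

theorem constantCoeff_val {p : Cz} (hp : constantCoeff p = 0) : constantCoeff (val p) = 0 := by
  rw [val, constantCoeff_mapAlgHom, hp, map_zero]

theorem val_injective : Function.Injective val := by
  intro p q h
  ext n
  have := congrArg (coeff n) h
  rw [val, coeff_mapAlgHom, coeff_mapAlgHom] at this
  exact Subtype.val_injective this

theorem commute_val (p q : Cz) : Commute (val p) (val q) := by
  rw [Commute, SemiconjBy, ← map_mul, mul_comm, map_mul]

/-- The chain rule: `[S, f(p)] = [S, p] f'(p)`. -/
theorem Brk.zev (hp : constantCoeff p = 0) (h : Brk S p d) (f : PowerSeries ℝ) :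
    Brk S (zev p f) (d * zev p (PowerSeries.derivative ℝ f)) := by
  have hx : val p * S = S * val p + -val d := by rw [← h]; abel
  have key := zev_mul_of_ad (d := 0) (constantCoeff_val hp) hx
    (by rw [add_zero]; exact ((commute_val p d).neg_right).eq) (by simp) f
  rw [Brk, map_mul, val, map_zev, map_zev, ← val, key]
  simp

theorem Brk.zexp (hp : constantCoeff p = 0) (h : Brk S p d) : Brk S (zexp p) (d * zexp p) := by
  have := h.zev hp (PowerSeries.exp ℝ)
  rwa [derivative_exp_real, ← zexp_eq_zev] at this

/-- `[S, ln(1 + p)] = [S, p] (1 + p)⁻¹`, with the inverse written as an exponential. -/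
theorem Brk.zlog (hp : constantCoeff p = 0) (h : Brk S p d) :
    Brk S (zlog p) (d * TwistedConformal.zexp (-zlog p)) := by
  have h1 := h.zev hp (PowerSeries.log ℝ)
  rw [← zlog_eq_zev] at h1
  have h2 := h1.zexp (constantCoeff_zlog _)
  rw [zexp_zlog hp] at h2
  have h3 : Brk S (1 + p) d := by
    rw [Brk, map_add, map_one, ← h]; noncomm_ring
  have h4 := val_injective (h2.symm.trans h3)
  have h5 : (1 + p) * TwistedConformal.zexp (-TwistedConformal.zlog p) = 1 := by
    rw [← zexp_zlog hp, zexp_mul_neg (constantCoeff_zlog _)]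
  refine h1.congr ?_
  conv_rhs => rw [← h4, mul_assoc, h5, mul_one]

/-- The commutators of `S` with the deformed translations, from those with the undeformed ones, by
the derivation rules. Here `dm = [S, T₋]` and `dT = [S, T]`. -/
theorem brk_cPz {d : Fin 4 → Cz} (h : ∀ μ, Brk S (tP μ) (d μ)) :
    let dm := (1 / 2 : ℝ) • (d 0 - d 1)
    let dT := (1 / 2 : ℝ) • (d 0 + d 1) + X * (tP 2 * d 2 + tP 3 * d 3) * (ex * eyi) +
      X ^ 2 * (tP 2 ^ 2 + tP 3 ^ 2) * (ex * eyi) ^ 2 * dm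
    Brk S (cPz 0) (dT * (ex * ey) + dm * (ex * eyi)) ∧
    Brk S (cPz 1) (dT * (ex * ey) - dm * (ex * eyi)) ∧
    Brk S (cPz 2) (d 2 * (ex * eyi) + 2 * X * tP 2 * (ex * eyi) ^ 2 * dm) ∧
    Brk S (cPz 3) (d 3 * (ex * eyi) + 2 * X * tP 3 * (ex * eyi) ^ 2 * dm) := by
  intro dm dT
  have hTm : Brk S cTm dm := ((h 0).sub (h 1)).smul _
  have hTp : Brk S cTp _ := ((h 0).add (h 1)).smul _
  have hT2 : Brk S cT2 _ := ((h 2).sub (h 3)).smul _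
  have hT3 : Brk S cT3 _ := ((h 2).add (h 3)).smul _
  have h0 : ∀ p : Cz, constantCoeff (-((2 : ℝ) • (X * p))) = 0 := fun p => by
    rw [map_neg, PowerSeries.constantCoeff_smul, map_mul]; simp
  have hσm : Brk S cσm (-((2 : ℝ) • (X * dm)) * (ex * eyi)) := by
    have := (hTm.X_mul.smul 2).neg.zlog (h0 _)
    rw [← zexp_neg_cσm_eq]; exact this
  have hE : Brk S (TwistedConformal.zexp (-cσm)) _ :=
    hσm.neg.zexp (by rw [map_neg, constantCoeff_cσm, neg_zero])
  have hT : Brk S cT dT := by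
    refine (hTp.add (((hT2.mul hT2).add (hT3.mul hT3)).X_mul.mul hE)).congr' ?_ ?_
    · rw [cT]; ring
    · rw [zexp_neg_cσm_eq]
      simp only [dT, cT2, cT3, Algebra.smul_def]
      have h2 : (2 : Cz) * algebraMap ℝ Cz (1 / 2) = 1 := by
        rw [← map_ofNat (algebraMap ℝ Cz) 2, ← map_mul]; norm_num
      have h3 : algebraMap ℝ Cz 2 = 2 := map_ofNat _ 2
      rw [h3]
      generalize algebraMap ℝ Cz (1 / 2) = c at h2
      grind
  have hσp : Brk S cσp (-((2 : ℝ) • (X * dT)) * (ex * ey)) := by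
    have := (hT.X_mul.smul 2).neg.zlog (h0 _)
    rw [← zexp_neg_cσp_eq]; exact this
  refine ⟨Brk.of_X_mul ?_, Brk.of_X_mul ?_, ?_, ?_⟩
  · rw [X_mul_cPz_zero]
    refine ((hσp.add hσm).smul _).neg.congr ?_
    simp only [smul_mul_assoc, neg_mul, mul_add]
    rw [mul_assoc, mul_assoc]
    module
  · rw [X_mul_cPz_one]
    refine ((hσp.sub hσm).smul _).neg.congr ?_
    simp only [smul_mul_assoc, neg_mul, mul_sub]
    rw [mul_assoc, mul_assoc]
    module
  · rw [cPz_two]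
    refine ((h 2).mul hE).congr ?_
    rw [zexp_neg_cσm_eq, Algebra.smul_def, map_ofNat]
    ring
  · rw [cPz_three]
    refine ((h 3).mul hE).congr ?_
    rw [zexp_neg_cσm_eq, Algebra.smul_def, map_ofNat]
    ring

end Translations

/-! ### The deformed commutation relations -/

section Commutators

open PowerSeries (coeff constantCoeff X mapAlgHom)

theorem two_mul_algebraMap_half : (2 : Cz) * algebraMap ℝ Cz (1 / 2) = 1 := by
  rw [← map_ofNat (algebraMap ℝ Cz) 2, ← map_mul]; norm_num

theorem two_mul_X_mul_cancel {f g : Cz} (h : 2 * (X * f) = 2 * (X * g)) : f = g :=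
  X_mul_cancel (by
    linear_combination (algebraMap ℝ Cz (1 / 2)) * h - X * (f - g) * two_mul_algebraMap_half)

theorem two_mul_X_mul_cTm : 2 * (X * cTm) = 1 - exi * ey := by
  have h := zexp_cσm
  rw [zexp_cσm_eq, Algebra.smul_def, map_ofNat] at h
  rw [h]; ring

theorem two_mul_X_mul_cT : 2 * (X * cT) = 1 - exi * eyi := by
  have h := zexp_cσp
  rw [zexp_cσp_eq, Algebra.smul_def, map_ofNat] at h
  rw [h]; ring

theorem tP_two : tP 2 = cPz 2 * (exi * ey) := by
  have h1 := ex_mul_exi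
  have h2 := ey_mul_eyi
  rw [cPz_two, zexp_neg_cσm_eq]
  grind

theorem tP_three : tP 3 = cPz 3 * (exi * ey) := by
  have h1 := ex_mul_exi
  have h2 := ey_mul_eyi
  rw [cPz_three, zexp_neg_cσm_eq]
  grind

/-- The undeformed `T₊` in terms of the deformed translations. -/
theorem cTp_eq : cTp = cT - (1 / 2 : ℝ) • (X * (exi * ey) * (cPz 2 ^ 2 + cPz 3 ^ 2)) := by
  have h1 := ex_mul_exi
  have h2 := ey_mul_eyi
  have h3 := two_mul_algebraMap_half
  have h4 := tP_two
  have h5 := tP_three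
  rw [cT, cT2, cT3, zexp_neg_cσm_eq]
  simp only [Algebra.smul_def]
  generalize algebraMap ℝ Cz (1 / 2) = c at *
  grind

/-- With `two_mul_X_mul_tP_one`, `tP_two`, `tP_three`: the undeformed translations in terms of the
deformed ones. -/
theorem two_mul_X_mul_tP_zero : 2 * (X * tP 0) =
    2 - exi * ey - exi * eyi - X ^ 2 * (exi * ey) * (cPz 2 ^ 2 + cPz 3 ^ 2) := by
  have h0 : tP 0 = cTp + cTm := by rw [cTp, cTm]; module
  have h1 := two_mul_X_mul_cT
  have h2 := two_mul_X_mul_cTm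
  have h3 := two_mul_algebraMap_half
  rw [h0, cTp_eq, Algebra.smul_def]
  generalize algebraMap ℝ Cz (1 / 2) = c at *
  linear_combination h1 + h2 - X ^ 2 * (exi * ey) * (cPz 2 ^ 2 + cPz 3 ^ 2) * h3

theorem two_mul_X_mul_tP_one : 2 * (X * tP 1) =
    exi * ey - exi * eyi - X ^ 2 * (exi * ey) * (cPz 2 ^ 2 + cPz 3 ^ 2) := by
  have h0 : tP 1 = cTp - cTm := by rw [cTp, cTm]; module
  have h1 := two_mul_X_mul_cT
  have h2 := two_mul_X_mul_cTm
  have h3 := two_mul_algebraMap_half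
  rw [h0, cTp_eq, Algebra.smul_def]
  generalize algebraMap ℝ Cz (1 / 2) = c at *
  linear_combination h1 - h2 - X ^ 2 * (exi * ey) * (cPz 2 ^ 2 + cPz 3 ^ 2) * h3

theorem brk_emb {x : SO42} {μ : Fin 4} {y : SO42} {d : Cz} (h : ⁅x, transP μ⁆ = y)
    (hy : val d = emb y) : Brk (emb x) (tP μ) d := by
  rw [Brk, val_tP, ← emb_lie, h, hy]

theorem brk_dil (μ : Fin 4) : Brk (emb dil) (tP μ) (tP μ) := by
  refine brk_emb (y := transP μ) ?_ (val_tP μ)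
  rw [← lie_skew, (so42_relations' 0 0 μ 0).2.2.2.2.2.2.2.2.2.2.2.1, neg_neg]

theorem brk_boostK (i : Fin 3) (μ : Fin 4) :
    Brk (emb (boostK i)) (tP μ) (if μ = 0 then tP i.succ else if μ = i.succ then tP 0 else 0) := by
  cases μ using Fin.cases with
  | zero => exact brk_emb (so42_relations' i 0 0 0).2.2.2.2.2.1 (val_tP _)
  | succ j =>
    refine brk_emb (so42_relations' i j 0 0).2.2.2.1 ?_
    by_cases h : i = j
    · simp [h, val_tP]
    · simp [h, Ne.symm h, emb_zero]

theorem brk_rotJ_zero (i : Fin 3) : Brk (emb (rotJ i)) (tP 0) 0 :=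
  brk_emb (so42_relations' i 0 0 0).1 (by rw [map_zero, emb_zero])

theorem brk_rotJ (i j : Fin 3) :
    Brk (emb (rotJ i)) (tP j.succ) (∑ k : Fin 3, eps i j k • tP k.succ) :=
  brk_emb (so42_relations i j).2.2.1 (by
    simp only [Fin.sum_univ_three, map_add, map_smul, val_tP, emb_add, emb_smul])

theorem brk_rotJ_of (i j : Fin 3) {d : Cz} (h : ∑ k : Fin 3, eps i j k • tP k.succ = d) :
    Brk (emb (rotJ i)) (tP j.succ) d := (brk_rotJ i j).congr h

/-- The commutators of `S` with the deformed translations, with everything expressed through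
`e^{±z P₀}`, `e^{±z P₁}`, `P₂`, `P₃`. Here `m = 2 z [S, T₋]` and `n = 2 z [S, T]`; factors `z` are
not divided out, since `T₋` and `T` are only given as quotients by `2 z`. -/
theorem brk_cPz_of {S : Uz} {d0 d1 d2 d3 m n e0 e1 e2 e3 : Cz} (h0 : Brk S (tP 0) d0)
    (h1 : Brk S (tP 1) d1) (h2 : Brk S (tP 2) d2) (h3 : Brk S (tP 3) d3)
    (hm : X * (d0 - d1) = m)
    (hn : X * (d0 + d1) + 2 * X ^ 2 * (cPz 2 * d2 + cPz 3 * d3) +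
      X ^ 2 * (cPz 2 ^ 2 + cPz 3 ^ 2) * m = n)
    (he0 : n * (ex * ey) + m * (ex * eyi) = 2 * (X * e0))
    (he1 : n * (ex * ey) - m * (ex * eyi) = 2 * (X * e1))
    (he2 : (d2 + cPz 2 * m) * (ex * eyi) = e2) (he3 : (d3 + cPz 3 * m) * (ex * eyi) = e3) :
    Brk S (cPz 0) e0 ∧ Brk S (cPz 1) e1 ∧
      Brk S (cPz 2) e2 ∧ Brk S (cPz 3) e3 := by
  have h := brk_cPz (S := S) (d := ![d0, d1, d2, d3]) (by
    intro μ; fin_cases μ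
    exacts [h0, h1, h2, h3])
  obtain ⟨a, b, c, d⟩ := h
  have p2 : tP 2 * (ex * eyi) = cPz 2 := by rw [cPz_two, zexp_neg_cσm_eq]
  have p3 : tP 3 * (ex * eyi) = cPz 3 := by rw [cPz_three, zexp_neg_cσm_eq]
  have hc := two_mul_algebraMap_half
  simp only [Algebra.smul_def, Matrix.cons_val_zero, Matrix.cons_val_one,
    Matrix.cons_val] at a b c d
  rw [← p2, ← p3] at hn
  rw [← p2] at he2
  rw [← p3] at he3
  generalize algebraMap ℝ Cz (1 / 2) = k at *
  refine ⟨a.congr (two_mul_X_mul_cancel ?_), b.congr (two_mul_X_mul_cancel ?_),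
    c.congr ?_, d.congr ?_⟩
  · rw [← he0, ← hn, ← hm]
    linear_combination (X * (d0 + d1) * (ex * ey) + X * (d0 - d1) * (ex * eyi) +
      X ^ 3 * (tP 2 ^ 2 + tP 3 ^ 2) * (ex * eyi) ^ 2 * (d0 - d1) * (ex * ey)) * hc
  · rw [← he1, ← hn, ← hm]
    linear_combination (X * (d0 + d1) * (ex * ey) - X * (d0 - d1) * (ex * eyi) +
      X ^ 3 * (tP 2 ^ 2 + tP 3 ^ 2) * (ex * eyi) ^ 2 * (d0 - d1) * (ex * ey)) * hc
  · rw [← he2, ← hm]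
    linear_combination (X * tP 2 * (ex * eyi) ^ 2 * (d0 - d1)) * hc
  · rw [← he3, ← hm]
    linear_combination (X * tP 3 * (ex * eyi) ^ 2 * (d0 - d1)) * hc

theorem constantCoeff_ex : constantCoeff ex = 1 := constantCoeff_zexp _

theorem constantCoeff_eyi : constantCoeff eyi = 1 := constantCoeff_zexp _

theorem zcosh_eq : zcosh (X * cPz 1) = (1 / 2 : ℝ) • (ey + eyi) := rfl

theorem zsinh_eq : zsinh (X * cPz 1) = (1 / 2 : ℝ) • (ey - eyi) := rfl

theorem constantCoeff_half_smul {A : Type*} [Ring A] [Algebra ℝ A] (f : PowerSeries A) :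
    constantCoeff ((1 / 2 : ℝ) • f) = (1 / 2 : ℝ) • constantCoeff f := rfl

theorem constantCoeff_zcosh : constantCoeff (zcosh (X * cPz 1)) = 1 := by
  rw [zcosh, constantCoeff_half_smul, map_add, constantCoeff_zexp, constantCoeff_zexp]
  module

theorem constantCoeff_zsinh : constantCoeff (zsinh (X * cPz 1)) = 0 := by
  rw [zsinh, constantCoeff_half_smul, map_sub, constantCoeff_zexp, constantCoeff_zexp]
  module

/-- The quotients by `z` in the commutation relations are well defined, their numerators having no
constant term; `zdiv` of a series with a constant term would discard it. -/
theorem two_mul_X_mul_zdiv_cosh :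
    2 * (X * zdiv (ex * zcosh (X * cPz 1) - 1)) = ex * (ey + eyi) - 2 := by
  rw [X_mul_zdiv _ (by rw [map_sub, map_mul, constantCoeff_ex, constantCoeff_zcosh]; simp),
    zcosh_eq, Algebra.smul_def]
  linear_combination (ex * (ey + eyi)) * two_mul_algebraMap_half

theorem two_mul_X_mul_zdiv_sinh :
    2 * (X * zdiv (ex * zsinh (X * cPz 1))) = ex * (ey - eyi) := by
  rw [X_mul_zdiv _ (by rw [map_mul, constantCoeff_ex, constantCoeff_zsinh]; simp),
    zsinh_eq, Algebra.smul_def]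
  linear_combination (ex * (ey - eyi)) * two_mul_algebraMap_half

theorem two_mul_X_mul_zdiv_sub_cosh :
    2 * (X * zdiv (eyi * (ex - zcosh (X * cPz 1)))) = eyi * (2 * ex - ey - eyi) := by
  rw [X_mul_zdiv _ (by
    rw [map_mul, map_sub, constantCoeff_eyi, constantCoeff_ex, constantCoeff_zcosh]; simp),
    zcosh_eq, Algebra.smul_def]
  linear_combination (-eyi * (ey + eyi)) * two_mul_algebraMap_half

theorem zexp_neg_two : zexp (-((2 : ℝ) • (X * cPz 1))) = eyi * eyi := by
  rw [eyi, ← zexp_add_comm (by simp) (by simp)]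
  congr 1; module

theorem X_mul_zdiv_one_sub :
    X * zdiv (1 - zexp (-((2 : ℝ) • (X * cPz 1)))) = 1 - eyi * eyi := by
  rw [X_mul_zdiv _ (by rw [map_sub, map_one, constantCoeff_zexp, sub_self]), zexp_neg_two]

theorem brk_dil_cPz :
    Brk (emb dil) (cPz 0) (zdiv (ex * zcosh (X * cPz 1) - 1) +
      (1 / 2 : ℝ) • (X * ex * ey * (cPz 2 ^ 2 + cPz 3 ^ 2))) ∧
    Brk (emb dil) (cPz 1) (zdiv (ex * zsinh (X * cPz 1)) +
      (1 / 2 : ℝ) • (X * ex * ey * (cPz 2 ^ 2 + cPz 3 ^ 2))) ∧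
    Brk (emb dil) (cPz 2) (ex * eyi * cPz 2) ∧ Brk (emb dil) (cPz 3) (ex * eyi * cPz 3) := by
  have w1 := two_mul_X_mul_zdiv_cosh
  have w2 := two_mul_X_mul_zdiv_sinh
  have hc := two_mul_algebraMap_half
  have h0 := two_mul_X_mul_tP_zero
  have h1 := two_mul_X_mul_tP_one
  have h2 := tP_two
  have h3 := tP_three
  have hx := ex_mul_exi
  have hy := ey_mul_eyi
  simp only [Algebra.smul_def]
  refine brk_cPz_of (m := 1 - exi * ey) (n := 1 - exi * eyi + X ^ 2 * (cPz 2 ^ 2 + cPz 3 ^ 2))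
    (brk_dil 0) (brk_dil 1) (brk_dil 2) (brk_dil 3) ?_ ?_ ?_ ?_ ?_ ?_
  · linear_combination algebraMap ℝ Cz (1 / 2) * (h0 - h1) -
      (X * (tP 0 - tP 1) - (1 - exi * ey)) * hc
  · rw [h2, h3]
    linear_combination algebraMap ℝ Cz (1 / 2) * (h0 + h1) -
      (X * (tP 0 + tP 1) - (1 - exi * eyi - X ^ 2 * (exi * ey) * (cPz 2 ^ 2 + cPz 3 ^ 2))) * hc
  · linear_combination (-eyi * ey - ey * eyi) * hx - 2 * hy -
      X ^ 2 * ex * ey * (cPz 2 ^ 2 + cPz 3 ^ 2) * hc - w1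
  · linear_combination (-eyi * ey + ey * eyi) * hx -
      X ^ 2 * ex * ey * (cPz 2 ^ 2 + cPz 3 ^ 2) * hc - w2
  · rw [h2]; ring
  · rw [h3]; ring

theorem brk_boostK_zero_cPz :
    Brk (emb (boostK 0)) (cPz 0) (zdiv (ex * zsinh (X * cPz 1)) -
      (1 / 2 : ℝ) • (X * ex * ey * (cPz 2 ^ 2 + cPz 3 ^ 2))) ∧
    Brk (emb (boostK 0)) (cPz 1) (zdiv (ex * zcosh (X * cPz 1) - 1) -
      (1 / 2 : ℝ) • (X * ex * ey * (cPz 2 ^ 2 + cPz 3 ^ 2))) ∧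
    Brk (emb (boostK 0)) (cPz 2) ((1 - ex * eyi) * cPz 2) ∧
    Brk (emb (boostK 0)) (cPz 3) ((1 - ex * eyi) * cPz 3) := by
  have w1 := two_mul_X_mul_zdiv_cosh
  have w2 := two_mul_X_mul_zdiv_sinh
  have hc := two_mul_algebraMap_half
  have h0 := two_mul_X_mul_tP_zero
  have h1 := two_mul_X_mul_tP_one
  have hx := ex_mul_exi
  have hy := ey_mul_eyi
  simp only [Algebra.smul_def]
  refine brk_cPz_of (m := exi * ey - 1) (n := 1 - exi * eyi - X ^ 2 * (cPz 2 ^ 2 + cPz 3 ^ 2))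
    (brk_boostK 0 0) (brk_boostK 0 1) (brk_boostK 0 2) (brk_boostK 0 3) ?_ ?_ ?_ ?_ ?_ ?_
  · change X * (tP 1 - tP 0) = _
    linear_combination algebraMap ℝ Cz (1 / 2) * (h1 - h0) -
      (X * (tP 1 - tP 0) - (exi * ey - 1)) * hc
  · change X * (tP 1 + tP 0) + 2 * X ^ 2 * (cPz 2 * 0 + cPz 3 * 0) + _ = _
    linear_combination algebraMap ℝ Cz (1 / 2) * (h0 + h1) -
      (X * (tP 0 + tP 1) - (1 - exi * eyi - X ^ 2 * (exi * ey) * (cPz 2 ^ 2 + cPz 3 ^ 2))) * hc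
  · rw [mul_sub, mul_sub, w2]
    linear_combination (-eyi * ey + ey * eyi) * hx +
      X ^ 2 * ex * ey * (cPz 2 ^ 2 + cPz 3 ^ 2) * hc
  · rw [mul_sub, mul_sub, w1]
    linear_combination (-eyi * ey - ey * eyi) * hx - 2 * hy +
      X ^ 2 * ex * ey * (cPz 2 ^ 2 + cPz 3 ^ 2) * hc
  · change (0 + cPz 2 * _) * _ = _
    linear_combination cPz 2 * ey * eyi * hx + cPz 2 * hy
  · change (0 + cPz 3 * _) * _ = _
    linear_combination cPz 3 * ey * eyi * hx + cPz 3 * hy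

theorem brk_boostK_one_cPz :
    Brk (emb (boostK 1)) (cPz 0) (ex * ey * cPz 2) ∧
    Brk (emb (boostK 1)) (cPz 1) ((ex * ey - 1) * cPz 2) ∧
    Brk (emb (boostK 1)) (cPz 2) (zdiv (eyi * (ex - zcosh (X * cPz 1))) +
      (1 / 2 : ℝ) • (X * (cPz 2 ^ 2 - cPz 3 ^ 2))) ∧
    Brk (emb (boostK 1)) (cPz 3) (X * (cPz 2 * cPz 3)) := by
  have w1 := two_mul_X_mul_zdiv_sub_cosh
  have hc := two_mul_algebraMap_half
  have h0 := two_mul_X_mul_tP_zero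
  have h2 := tP_two
  have hx := ex_mul_exi
  have hy := ey_mul_eyi
  simp only [Algebra.smul_def]
  refine brk_cPz_of (m := X * cPz 2 * (exi * ey)) (n := X * cPz 2 * (2 - exi * eyi))
    (brk_boostK 1 0) (brk_boostK 1 1) (brk_boostK 1 2) (brk_boostK 1 3) ?_ ?_ ?_ ?_ ?_ ?_
  · change X * (tP 2 - 0) = _
    rw [h2]; ring
  · change X * (tP 2 + 0) + 2 * X ^ 2 * (cPz 2 * tP 0 + cPz 3 * 0) + _ = _
    rw [h2]
    linear_combination X * cPz 2 * h0
  · linear_combination (-X * cPz 2 * eyi * ey + X * cPz 2 * ey * eyi) * hx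
  · linear_combination (-X * cPz 2 * eyi * ey - X * cPz 2 * ey * eyi) * hx - 2 * X * cPz 2 * hy
  · refine two_mul_X_mul_cancel ?_
    change 2 * (X * ((tP 0 + cPz 2 * _) * _)) = _
    rw [mul_add, mul_add, w1]
    linear_combination ex * eyi * h0 +
      (-ey * eyi - eyi ^ 2 + X ^ 2 * (cPz 2 ^ 2 - cPz 3 ^ 2) * ey * eyi) * hx +
      X ^ 2 * (cPz 2 ^ 2 - cPz 3 ^ 2) * hy - X ^ 2 * (cPz 2 ^ 2 - cPz 3 ^ 2) * hc
  · change (0 + cPz 3 * _) * _ = _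
    linear_combination X * cPz 2 * cPz 3 * (ey * eyi * hx + hy)

theorem brk_boostK_two_cPz :
    Brk (emb (boostK 2)) (cPz 0) (ex * ey * cPz 3) ∧
    Brk (emb (boostK 2)) (cPz 1) ((ex * ey - 1) * cPz 3) ∧
    Brk (emb (boostK 2)) (cPz 2) (X * (cPz 3 * cPz 2)) ∧
    Brk (emb (boostK 2)) (cPz 3) (zdiv (eyi * (ex - zcosh (X * cPz 1))) +
      (1 / 2 : ℝ) • (X * (cPz 3 ^ 2 - cPz 2 ^ 2))) := by
  have w1 := two_mul_X_mul_zdiv_sub_cosh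
  have hc := two_mul_algebraMap_half
  have h0 := two_mul_X_mul_tP_zero
  have h3 := tP_three
  have hx := ex_mul_exi
  have hy := ey_mul_eyi
  simp only [Algebra.smul_def]
  refine brk_cPz_of (m := X * cPz 3 * (exi * ey)) (n := X * cPz 3 * (2 - exi * eyi))
    (brk_boostK 2 0) (brk_boostK 2 1) (brk_boostK 2 2) (brk_boostK 2 3) ?_ ?_ ?_ ?_ ?_ ?_
  · change X * (tP 3 - 0) = _
    rw [h3]; ring
  · change X * (tP 3 + 0) + 2 * X ^ 2 * (cPz 2 * 0 + cPz 3 * tP 0) + _ = _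
    rw [h3]
    linear_combination X * cPz 3 * h0
  · linear_combination (-X * cPz 3 * eyi * ey + X * cPz 3 * ey * eyi) * hx
  · linear_combination (-X * cPz 3 * eyi * ey - X * cPz 3 * ey * eyi) * hx - 2 * X * cPz 3 * hy
  · change (0 + cPz 2 * _) * _ = _
    linear_combination X * cPz 2 * cPz 3 * (ey * eyi * hx + hy)
  · refine two_mul_X_mul_cancel ?_
    change 2 * (X * ((tP 0 + cPz 3 * _) * _)) = _
    rw [mul_add, mul_add, w1]
    linear_combination ex * eyi * h0 +
      (-ey * eyi - eyi ^ 2 + X ^ 2 * (cPz 3 ^ 2 - cPz 2 ^ 2) * ey * eyi) * hx +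
      X ^ 2 * (cPz 3 ^ 2 - cPz 2 ^ 2) * hy - X ^ 2 * (cPz 3 ^ 2 - cPz 2 ^ 2) * hc

theorem brk_rotJ_zero_cPz :
    Brk (emb (rotJ 0)) (cPz 0) 0 ∧ Brk (emb (rotJ 0)) (cPz 1) 0 ∧
    Brk (emb (rotJ 0)) (cPz 2) (cPz 3) ∧ Brk (emb (rotJ 0)) (cPz 3) (-cPz 2) := by
  have h2 := tP_two
  have h3 := tP_three
  have hx := ex_mul_exi
  have hy := ey_mul_eyi
  refine brk_cPz_of (m := 0) (n := 0) (d1 := 0) (d2 := tP 3) (d3 := -tP 2)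
    (brk_rotJ_zero 0)
    (brk_rotJ_of 0 0 (by simp [eps, Fin.sum_univ_three]))
    (brk_rotJ_of 0 1 (by simp [eps, Fin.sum_univ_three]))
    (brk_rotJ_of 0 2 (by simp [eps, Fin.sum_univ_three]))
    ?_ ?_ ?_ ?_ ?_ ?_
  · ring
  · rw [h2, h3]; ring
  · ring
  · ring
  · rw [h3]; linear_combination cPz 3 * (ey * eyi * hx + hy)
  · rw [h2]; linear_combination -cPz 2 * (ey * eyi * hx + hy)

theorem brk_rotJ_one_cPz :
    Brk (emb (rotJ 1)) (cPz 0) 0 ∧ Brk (emb (rotJ 1)) (cPz 1) (-cPz 3) ∧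
    Brk (emb (rotJ 1)) (cPz 2) (X * (cPz 2 * cPz 3)) ∧
    Brk (emb (rotJ 1)) (cPz 3) ((1 / 2 : ℝ) • zdiv (1 - zexp (-((2 : ℝ) • (X * cPz 1)))) +
      (1 / 2 : ℝ) • (X * (cPz 3 ^ 2 - cPz 2 ^ 2))) := by
  have w1 := X_mul_zdiv_one_sub
  have hc := two_mul_algebraMap_half
  have h1 := two_mul_X_mul_tP_one
  have h3 := tP_three
  have hx := ex_mul_exi
  have hy := ey_mul_eyi
  simp only [Algebra.smul_def] at w1 ⊢
  refine brk_cPz_of (m := X * cPz 3 * (exi * ey)) (n := -X * cPz 3 * (exi * eyi))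
    (d1 := -tP 3) (d2 := 0) (d3 := tP 1)
    (brk_rotJ_zero 1)
    (brk_rotJ_of 1 0 (by simp [eps, Fin.sum_univ_three]))
    (brk_rotJ_of 1 1 (by simp [eps, Fin.sum_univ_three]))
    (brk_rotJ_of 1 2 (by simp [eps, Fin.sum_univ_three]))
    ?_ ?_ ?_ ?_ ?_ ?_
  · rw [h3]; ring
  · rw [h3]
    linear_combination X * cPz 3 * h1
  · ring
  · linear_combination (-2 * X * cPz 3 * ey * eyi) * hx - 2 * X * cPz 3 * hy
  · linear_combination X * cPz 2 * cPz 3 * (ey * eyi * hx + hy)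
  · refine two_mul_X_mul_cancel ?_
    linear_combination ex * eyi * h1 +
      (ey * eyi - eyi ^ 2 + X ^ 2 * (cPz 3 ^ 2 - cPz 2 ^ 2) * ey * eyi) * hx +
      (1 + X ^ 2 * (cPz 3 ^ 2 - cPz 2 ^ 2)) * hy - X ^ 2 * (cPz 3 ^ 2 - cPz 2 ^ 2) * hc -
      2 * algebraMap ℝ Cz (1 / 2) * w1 - (1 - eyi * eyi) * hc

theorem brk_rotJ_two_cPz :
    Brk (emb (rotJ 2)) (cPz 0) 0 ∧ Brk (emb (rotJ 2)) (cPz 1) (cPz 2) ∧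
    Brk (emb (rotJ 2)) (cPz 2) (-((1 / 2 : ℝ) • zdiv (1 - zexp (-((2 : ℝ) • (X * cPz 1)))) +
      (1 / 2 : ℝ) • (X * (cPz 2 ^ 2 - cPz 3 ^ 2)))) ∧
    Brk (emb (rotJ 2)) (cPz 3) (-(X * (cPz 3 * cPz 2))) := by
  have w1 := X_mul_zdiv_one_sub
  have hc := two_mul_algebraMap_half
  have h1 := two_mul_X_mul_tP_one
  have h2 := tP_two
  have hx := ex_mul_exi
  have hy := ey_mul_eyi
  simp only [Algebra.smul_def] at w1 ⊢
  refine brk_cPz_of (m := -X * cPz 2 * (exi * ey)) (n := X * cPz 2 * (exi * eyi))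
    (d1 := tP 2) (d2 := -tP 1) (d3 := 0)
    (brk_rotJ_zero 2)
    (brk_rotJ_of 2 0 (by simp [eps, Fin.sum_univ_three]))
    (brk_rotJ_of 2 1 (by simp [eps, Fin.sum_univ_three]))
    (brk_rotJ_of 2 2 (by simp [eps, Fin.sum_univ_three]))
    ?_ ?_ ?_ ?_ ?_ ?_
  · rw [h2]; ring
  · rw [h2]
    linear_combination -X * cPz 2 * h1
  · ring
  · linear_combination (2 * X * cPz 2 * ey * eyi) * hx + 2 * X * cPz 2 * hy
  · refine two_mul_X_mul_cancel ?_
    linear_combination -ex * eyi * h1 -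
      (ey * eyi - eyi ^ 2 + X ^ 2 * (cPz 2 ^ 2 - cPz 3 ^ 2) * ey * eyi) * hx -
      (1 + X ^ 2 * (cPz 2 ^ 2 - cPz 3 ^ 2)) * hy + X ^ 2 * (cPz 2 ^ 2 - cPz 3 ^ 2) * hc +
      2 * algebraMap ℝ Cz (1 / 2) * w1 + (1 - eyi * eyi) * hc
  · linear_combination -X * cPz 2 * cPz 3 * (ey * eyi * hx + hy)

end Commutators

/-! ### Conjugation by exponentials of tensors -/

section Conjugation

open PowerSeries (coeff constantCoeff X mapAlgHom)

/-- `Uz₂` as a module over the series in the translations, acting on the second tensor factor. An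
identity between sums of tensors `S ⊗ p`, with `p` a series in the translations, is then one
between linear combinations of the `S ⊗ 1` over a commutative ring. -/
instance : Module Cz Uz₂ where
  smul p w := w * inRight (val p)
  one_smul w := by change w * inRight (val 1) = w; rw [map_one, map_one, mul_one]
  mul_smul p q w := by
    change w * inRight (val (p * q)) = w * inRight (val q) * inRight (val p)
    rw [mul_comm p q, map_mul, map_mul, mul_assoc]
  smul_zero p := zero_mul _
  smul_add p w w' := add_mul _ _ _
  add_smul p q w := by
    change w * inRight (val (p + q)) = w * inRight (val p) + w * inRight (val q)
    rw [map_add, map_add, mul_add]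
  zero_smul w := by change w * inRight (val 0) = 0; rw [map_zero, map_zero, mul_zero]

theorem smul_inLeft (S : Uz) (p : Cz) : S ⊠ val p = p • inLeft S := rfl

theorem constantCoeff_tmul_val (S : Uz) {p : Cz} (hp : constantCoeff p = 0) :
    constantCoeff (S ⊠ val p) = 0 :=
  constantCoeff_ztmul (constantCoeff_val hp)

theorem tmul_val_mul (S S' : Uz) (p p' : Cz) :
    (S ⊠ val p) * (S' ⊠ val p') = (S * S') ⊠ val (p * p') := by
  rw [ztmul_mul, map_mul]

theorem commute_tmul_val {S S' : Uz} (h : Commute S S') (p p' : Cz) :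
    Commute (S ⊠ val p) (S' ⊠ val p') :=
  commute_ztmul h (commute_val p p')

/-- `F x F⁻¹ = y`, for an invertible `F`, written without the inverse. -/
def Conj {R : Type*} [Ring R] (F x y : R) : Prop := F * x = y * F

section

variable {R : Type*} [Ring R] {F G x y w x' y' : R}

theorem Conj.comp (h : Conj F y w) (h' : Conj G x y) : Conj (F * G) x w := by
  rw [Conj, mul_assoc, h', ← mul_assoc, h, mul_assoc]

theorem Conj.add (h : Conj F x y) (h' : Conj F x' y') : Conj F (x + x') (y + y') := by
  rw [Conj, mul_add, add_mul, h, h']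

theorem Conj.sub (h : Conj F x y) (h' : Conj F x' y') : Conj F (x - x') (y - y') := by
  rw [Conj, mul_sub, sub_mul, h, h']

theorem Conj.congr (h : Conj F x y) (hy : y = w) : Conj F x w := hy ▸ h

theorem Conj.congr' (h : Conj F x y) (hx : x = w) : Conj F w y := hx ▸ h

theorem Conj.zexp {A : Type*} [Ring A] [Algebra ℝ A] {F x y : PowerSeries A} (h : Conj F x y)
    (hx : constantCoeff x = 0) (hy : constantCoeff y = 0) : Conj F (zexp x) (zexp y) :=
  (zexp_intertwine hy hx h.symm).symm

end

/-- A commuting element is fixed under conjugation. -/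
theorem conj_of_commute {S S' : Uz} (h : S * S' = S' * S) {p : Cz} (hp : constantCoeff p = 0)
    (p' : Cz) : Conj (zexp (S ⊠ val p)) (S' ⊠ val p') (S' ⊠ val p') :=
  (commute_zexp_right (constantCoeff_tmul_val S hp)
    (commute_tmul_val (Eq.symm h : Commute S' S) p' p)).symm

/-- An eigenvector of `ad S` is scaled by an exponential. -/
theorem conj_of_eigen {S b : Uz} {r : ℝ} (h : S * b = b * S + r • b) {p : Cz}
    (hp : constantCoeff p = 0) (s : Cz) :
    Conj (zexp (S ⊠ val p)) (b ⊠ val s) (b ⊠ val (s * zexp (r • p))) := by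
  have hrp : constantCoeff (r • p) = 0 := by
    rw [PowerSeries.constantCoeff_smul, hp, smul_zero]
  have h1 : (S ⊠ val p) * (b ⊠ val s) = (b ⊠ val s) * (1 ⊠ val (r • p) + S ⊠ val p) := by
    rw [tmul_val_mul, h, add_ztmul, smul_ztmul, mul_add, tmul_val_mul, tmul_val_mul, mul_one,
      mul_comm p s, mul_smul_comm, map_smul, ztmul_smul, add_comm]
  have h2 : zexp (1 ⊠ val (r • p) + S ⊠ val p) =
      (1 ⊠ val (zexp (r • p))) * zexp (S ⊠ val p) := by
    rw [zexp_add (constantCoeff_tmul_val 1 hrp) (constantCoeff_tmul_val S hp)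
      (commute_tmul_val (Commute.one_left S) _ _), one_ztmul, one_ztmul, val_zexp, inRight,
      map_zexp]
  have h3 := zexp_intertwine (constantCoeff_tmul_val S hp)
    (by rw [map_add, constantCoeff_tmul_val 1 hrp, constantCoeff_tmul_val S hp, add_zero]) h1
  rw [h2, ← mul_assoc, tmul_val_mul, mul_one] at h3
  exact h3

/-- If `[b, S] = c`, `[b, c] = d` and `[b, d] = 0`, then conjugation by `exp (b ⊗ r)` is given by
the first three terms of the adjoint series. -/
theorem conj_of_nilpotent {b S c d : Uz} (h1 : b * S = S * b + c) (h2 : b * c = c * b + d)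
    (h3 : b * d = d * b) {r : Cz} (hr : constantCoeff r = 0) (s : Cz) :
    Conj (zexp (b ⊠ val r)) (S ⊠ val s)
      (S ⊠ val s + c ⊠ val (r * s) + (1 / 2 : ℝ) • (d ⊠ val (r ^ 2 * s))) := by
  refine zexp_mul_of_ad_two (constantCoeff_tmul_val b hr) ?_ ?_ ?_
  · rw [tmul_val_mul, tmul_val_mul, h1, add_ztmul, mul_comm s r]
  · rw [tmul_val_mul, tmul_val_mul, h2, add_ztmul, mul_comm (r * s) r, ← mul_assoc, ← sq]
  · rw [tmul_val_mul, tmul_val_mul, h3, mul_comm r]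

theorem conj_of_nilpotent' {b S c : Uz} (h1 : b * S = S * b + c) (h2 : b * c = c * b)
    {r : Cz} (hr : constantCoeff r = 0) (s : Cz) :
    Conj (zexp (b ⊠ val r)) (S ⊠ val s) (S ⊠ val s + c ⊠ val (r * s)) := by
  have := conj_of_nilpotent (d := 0) h1 (by rw [h2, add_zero]) (by simp) hr s
  rwa [zero_ztmul, smul_zero, add_zero] at this

/-- If `[Y, p] = d`, then `[S ⊗ p, 1 ⊗ Y] = -S ⊗ d` commutes with `S ⊗ p`, and the adjoint series
stops after the linear term. -/
theorem conj_inRight {S Y : Uz} {p d : Cz} (hp : constantCoeff p = 0) (h : Brk Y p d) :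
    Conj (zexp (S ⊠ val p)) (1 ⊠ Y) (1 ⊠ Y - S ⊠ val d) := by
  rw [sub_eq_add_neg]
  refine zexp_mul_of_ad_one (constantCoeff_tmul_val S hp) ?_ ?_
  · rw [ztmul_mul, ztmul_mul, ← h, one_mul, mul_one, ztmul_sub]; abel
  · exact ((commute_tmul_val (Commute.refl S) p d).neg_right).eq

end Conjugation

/-! ### Brackets of the Weyl–Poincaré algebra -/

section Brackets

theorem lie_boostK_rotJ (i j : Fin 3) :
    ⁅boostK i, rotJ j⁆ = -∑ k, eps j i k • boostK k := by
  rw [← lie_skew, (so42_relations j i).2.1]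

theorem emb_mul_comm {x y w : SO42} (h : ⁅x, y⁆ = w) : emb x * emb y = emb y * emb x + emb w := by
  rw [← h, emb_lie]; abel

theorem emb_commute {x y : SO42} (h : ⁅x, y⁆ = 0) : emb x * emb y = emb y * emb x := by
  rw [emb_mul_comm h, emb_zero, add_zero]

/-- `K₂ + J₃`. -/
def b2 : SO42 := boostK 1 + rotJ 2

/-- `K₃ - J₂`. -/
def b3 : SO42 := boostK 2 - rotJ 1

/-- `K₂ - J₃`. -/
def a2 : SO42 := boostK 1 - rotJ 2

/-- `K₃ + J₂`. -/
def a3 : SO42 := boostK 2 + rotJ 1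

theorem lie_dil_rotJ (i : Fin 3) : ⁅dil, rotJ i⁆ = 0 := by
  rw [← lie_skew, (so42_relations' i 0 0 0).2.2.1, neg_zero]

theorem lie_dil_boostK (i : Fin 3) : ⁅dil, boostK i⁆ = 0 := by
  rw [← lie_skew, (so42_relations' i 0 0 0).2.2.2.2.2.2.2.1, neg_zero]

theorem lie_rotJ_rotJ (i j : Fin 3) : ⁅rotJ i, rotJ j⁆ = ∑ k, eps i j k • rotJ k :=
  (so42_relations i j).1

theorem lie_rotJ_boostK (i j : Fin 3) : ⁅rotJ i, boostK j⁆ = ∑ k, eps i j k • boostK k :=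
  (so42_relations i j).2.1

theorem lie_boostK_boostK (i j : Fin 3) : ⁅boostK i, boostK j⁆ = -∑ k, eps i j k • rotJ k :=
  (so42_relations i j).2.2.2.2.1

/-- The `K₁`-weight vectors of the Lorentz algebra: `K₂ + J₃` and `K₃ - J₂` have weight `-1` and
commute, `K₂ - J₃` and `K₃ + J₂` have weight `1`, and `K₁`, `J₁` have weight `0`. -/
theorem null_relations :
    ⁅dil, b2⁆ = 0 ∧ ⁅dil, b3⁆ = 0 ∧ ⁅dil, a2⁆ = 0 ∧ ⁅dil, a3⁆ = 0 ∧
    ⁅boostK 0, b2⁆ = -b2 ∧ ⁅boostK 0, b3⁆ = -b3 ∧ ⁅boostK 0, a2⁆ = a2 ∧ ⁅boostK 0, a3⁆ = a3 ∧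
    ⁅boostK 0, rotJ 0⁆ = 0 ∧ ⁅b2, b3⁆ = 0 ∧ ⁅b2, rotJ 0⁆ = -b3 ∧ ⁅b3, rotJ 0⁆ = b2 ∧
    ⁅b2, a2⁆ = -((2 : ℝ) • boostK 0) ∧ ⁅b2, a3⁆ = -((2 : ℝ) • rotJ 0) ∧
    ⁅b3, a2⁆ = (2 : ℝ) • rotJ 0 ∧ ⁅b3, a3⁆ = -((2 : ℝ) • boostK 0) := by
  refine ⟨?_, ?_, ?_, ?_, ?_, ?_, ?_, ?_, ?_, ?_, ?_, ?_, ?_, ?_, ?_, ?_⟩ <;>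
  · simp only [b2, b3, a2, a3, lie_add, lie_sub, add_lie, sub_lie, lie_dil_rotJ, lie_dil_boostK,
      lie_boostK_rotJ, lie_rotJ_rotJ, lie_rotJ_boostK, lie_boostK_boostK, Fin.sum_univ_three]
    simp [eps]
    try module

theorem emb_null_relations :
    emb dil * emb b2 = emb b2 * emb dil ∧ emb dil * emb b3 = emb b3 * emb dil ∧
    emb dil * emb a2 = emb a2 * emb dil ∧ emb dil * emb a3 = emb a3 * emb dil ∧
    emb (boostK 0) * emb b2 = emb b2 * emb (boostK 0) + (-1 : ℝ) • emb b2 ∧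
    emb (boostK 0) * emb b3 = emb b3 * emb (boostK 0) + (-1 : ℝ) • emb b3 ∧
    emb (boostK 0) * emb a2 = emb a2 * emb (boostK 0) + (1 : ℝ) • emb a2 ∧
    emb (boostK 0) * emb a3 = emb a3 * emb (boostK 0) + (1 : ℝ) • emb a3 ∧
    emb (boostK 0) * emb (rotJ 0) = emb (rotJ 0) * emb (boostK 0) ∧
    emb b2 * emb b3 = emb b3 * emb b2 ∧
    emb b2 * emb (rotJ 0) = emb (rotJ 0) * emb b2 + -emb b3 ∧
    emb b3 * emb (rotJ 0) = emb (rotJ 0) * emb b3 + emb b2 ∧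
    emb b2 * emb a2 = emb a2 * emb b2 + -((2 : ℝ) • emb (boostK 0)) ∧
    emb b2 * emb a3 = emb a3 * emb b2 + -((2 : ℝ) • emb (rotJ 0)) ∧
    emb b3 * emb a2 = emb a2 * emb b3 + (2 : ℝ) • emb (rotJ 0) ∧
    emb b3 * emb a3 = emb a3 * emb b3 + -((2 : ℝ) • emb (boostK 0)) := by
  obtain ⟨h1, h2, h3, h4, h5, h6, h7, h8, h9, h10, h11, h12, h13, h14, h15, h16⟩ := null_relations
  refine ⟨emb_commute h1, emb_commute h2, emb_commute h3, emb_commute h4, ?_, ?_, ?_, ?_,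
    emb_commute h9, emb_commute h10, ?_, emb_mul_comm h12, ?_, ?_, ?_, ?_⟩
  · rw [emb_mul_comm h5, emb_neg, neg_one_smul]
  · rw [emb_mul_comm h6, emb_neg, neg_one_smul]
  · rw [emb_mul_comm h7, one_smul]
  · rw [emb_mul_comm h8, one_smul]
  · rw [emb_mul_comm h11, emb_neg]
  · rw [emb_mul_comm h13, emb_neg, emb_smul]
  · rw [emb_mul_comm h14, emb_neg, emb_smul]
  · rw [emb_mul_comm h15, emb_smul]
  · rw [emb_mul_comm h16, emb_neg, emb_smul]

end Brackets

/-! ### The compact form of the twisting element -/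

section Compact

open PowerSeries (coeff constantCoeff X mapAlgHom)
open NullPlane

/-! Compatibility of the module structure of `Uz₂` over `Cz` with its real, natural and integer
multiples. -/

instance : IsScalarTower ℝ Cz Uz₂ where
  smul_assoc r p w := by
    change w * inRight (val (r • p)) = r • (w * inRight (val p))
    rw [map_smul, map_smul, mul_smul_comm]

instance : @IsScalarTower ℕ Cz Uz₂ Algebra.toSMul _ _ where
  smul_assoc n p w := by
    rw [Algebra.smul_def, eq_natCast, mul_smul, Nat.cast_smul_eq_nsmul]

instance : @IsScalarTower ℤ Cz Uz₂ Algebra.toSMul _ _ where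
  smul_assoc n p w := by
    rw [Algebra.smul_def, eq_intCast, mul_smul, Int.cast_smul_eq_zsmul]

/-- The exponent `-z P₁`. -/
def p1 : Cz := -(X * cPz 1)

/-- The exponent `-z P₀`. -/
def p0 : Cz := -(X * cPz 0)

/-- The exponents `-z e^{z P₁} Pₐ`, used for `a = 2, 3`. -/
def ra (μ : Fin 4) : Cz := -(X * (ey * cPz μ))

theorem constantCoeff_p1 : constantCoeff p1 = 0 := by
  rw [p1, map_neg, constantCoeff_X_mul, neg_zero]

theorem constantCoeff_p0 : constantCoeff p0 = 0 := by
  rw [p0, map_neg, constantCoeff_X_mul, neg_zero]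

theorem constantCoeff_ra (μ : Fin 4) : constantCoeff (ra μ) = 0 := by
  rw [ra, map_neg, constantCoeff_X_mul, neg_zero]

/-- The factor `exp(-z (K₃ - J₂) ⊗ e^{z P₁} P₃)` of the twisting element. -/
def E3 : Uz₂ := zexp (emb b3 ⊠ val (ra 3))

/-- The factor `exp(-z (K₂ + J₃) ⊗ e^{z P₁} P₂)` of the twisting element. -/
def E2 : Uz₂ := zexp (emb b2 ⊠ val (ra 2))

/-- The factor `exp(-z K₁ ⊗ P₁)` of the twisting element. -/
def EK : Uz₂ := zexp (emb (boostK 0) ⊠ val p1)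

/-- The factor `exp(-z D ⊗ P₀)` of the twisting element. -/
def ED : Uz₂ := zexp (emb dil ⊠ val p0)

theorem smul_eq_algebraMap_mul (r : ℝ) (p : Cz) : r • p = algebraMap ℝ Cz r * p :=
  Algebra.smul_def r p

theorem z₂_mul_tmul_val (S : Uz) (p : Cz) : z₂ * (S ⊠ val p) = S ⊠ val (X * p) := by
  rw [z₂, X_mul_ztmul, map_mul, val_X, z]

theorem neg_tmul_val (S : Uz) (p : Cz) : -(S ⊠ val p) = S ⊠ val (-p) := by
  rw [map_neg, ztmul_neg]

theorem smul_tmul_val (r : ℝ) (S : Uz) (p : Cz) : r • (S ⊠ val p) = S ⊠ val (r • p) := by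
  rw [map_smul, ztmul_smul]

theorem zexp_add_tmul_val {S S' : Uz} (h : S * S' = S' * S) {p p' : Cz}
    (hp : constantCoeff p = 0) (hp' : constantCoeff p' = 0) :
    zexp (S ⊠ val p + S' ⊠ val p') = zexp (S ⊠ val p) * zexp (S' ⊠ val p') :=
  zexp_add (constantCoeff_tmul_val S hp) (constantCoeff_tmul_val S' hp') (commute_tmul_val h _ _)

theorem commute_zexp_tmul_val {S S' : Uz} (h : S * S' = S' * S) {p p' : Cz}
    (hp : constantCoeff p = 0) (hp' : constantCoeff p' = 0) :
    zexp (S ⊠ val p) * zexp (S' ⊠ val p') = zexp (S' ⊠ val p') * zexp (S ⊠ val p) := by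
  rw [← zexp_add_tmul_val h hp hp', ← zexp_add_tmul_val h.symm hp' hp, add_comm]

theorem emb_dil_mul_boostK : emb dil * emb (boostK 0) = emb (boostK 0) * emb dil :=
  emb_commute (lie_dil_boostK 0)

theorem emb_Hp : Hp = (1 / 2 : ℝ) • (emb dil + emb (boostK 0)) := by
  rw [Hp, emb_smul, emb_add]

theorem emb_Hm : Hm = (1 / 2 : ℝ) • (emb dil - emb (boostK 0)) := by
  rw [Hm, emb_smul, emb_sub]

theorem emb_B3 : B3 = (1 / 2 : ℝ) • (emb b2 + emb b3) := by
  rw [B3, ← emb_add, ← emb_smul, b2, b3]; congr 1; module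

theorem emb_B2 : B2 = (1 / 2 : ℝ) • (emb b2 - emb b3) := by
  rw [B2, ← emb_sub, ← emb_smul, b2, b3]; congr 1; module

theorem constantCoeff_smul_zero_of {A : Type*} [Ring A] [Algebra ℝ A] (r : ℝ) {p : PowerSeries A}
    (hp : constantCoeff p = 0) : constantCoeff (r • p) = 0 := by
  rw [PowerSeries.constantCoeff_smul, hp, smul_zero]

/-- `exp(-z P₀ / 2) exp(z P₁ / 2)`, which is `exp(σ₋ / 2)`. -/
def gh : Cz := zexp (-((1 / 2 : ℝ) • (X * cPz 0))) * zexp ((1 / 2 : ℝ) • (X * cPz 1))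

theorem gh_eq : gh = zexp ((1 / 2 : ℝ) • cσm) := by
  rw [gh, ← zexp_add_comm]
  · congr 1; rw [cσm_eq]; module
  · rw [map_neg, constantCoeff_smul_zero_of _ (constantCoeff_X_mul _), neg_zero]
  · exact constantCoeff_smul_zero_of _ (constantCoeff_X_mul _)

theorem tP_mul_zexp_two :
    tP 2 * zexp (-((1 / 2 : ℝ) • cσm)) = gh * cPz 2 := by
  have hc := constantCoeff_smul_zero_of (1 / 2 : ℝ) constantCoeff_cσm
  rw [cPz_two, gh_eq, mul_left_comm, ← zexp_add_comm hc]
  · congr 2; module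
  · rw [map_neg, constantCoeff_cσm, neg_zero]

theorem tP_mul_zexp_three :
    tP 3 * zexp (-((1 / 2 : ℝ) • cσm)) = gh * cPz 3 := by
  have hc := constantCoeff_smul_zero_of (1 / 2 : ℝ) constantCoeff_cσm
  rw [cPz_three, gh_eq, mul_left_comm, ← zexp_add_comm hc]
  · congr 2; module
  · rw [map_neg, constantCoeff_cσm, neg_zero]

theorem ΦE_eq : ΦE = zexp (emb b2 ⊠ val (-(X * (gh * cPz 2)))) *
    zexp (emb b3 ⊠ val (-(X * (gh * cPz 3)))) := by
  have hb : emb b2 * emb b3 = emb b3 * emb b2 := emb_null_relations.2.2.2.2.2.2.2.2.2.1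
  have hB : B3 * B2 = B2 * B3 := by
    rw [emb_B2, emb_B3, smul_mul_smul_comm, smul_mul_smul_comm, mul_sub, sub_mul, add_mul, add_mul,
      mul_add, mul_add, hb]
  have h0 : ∀ p : Cz, constantCoeff (-(X * p)) = 0 := fun p => by
    rw [map_neg, constantCoeff_X_mul, neg_zero]
  have h0' : ∀ p : Cz, constantCoeff (-((2 : ℝ) • (X * p))) = 0 := fun p => by
    rw [map_neg, constantCoeff_smul_zero_of _ (constantCoeff_X_mul _), neg_zero]
  have e3 : ∀ q : Cz, -((2 : ℝ) • (z₂ * (B3 ⊠ (val q)))) = B3 ⊠ val (-((2 : ℝ) • (X * q))) :=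
    fun q => by rw [z₂_mul_tmul_val, smul_tmul_val, neg_tmul_val]
  have e2 : ∀ q : Cz, -((2 : ℝ) • (z₂ * (B2 ⊠ (val q)))) = B2 ⊠ val (-((2 : ℝ) • (X * q))) :=
    fun q => by rw [z₂_mul_tmul_val, smul_tmul_val, neg_tmul_val]
  have v : ∀ q : Cz, val q * zexp (-((1 / 2 : ℝ) • σm)) =
      val (q * zexp (-((1 / 2 : ℝ) • cσm))) := by
    intro q
    rw [map_mul, val_zexp, map_neg, map_smul, val_cσm]
  rw [ΦE, ← val_cT2, ← val_cT3, v, v, e3, e2, ← zexp_add_tmul_val hB (h0' _) (h0' _),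
    ← zexp_add_tmul_val hb (h0 _) (h0 _), ← tP_mul_zexp_two, ← tP_mul_zexp_three, cT2, cT3, emb_B2,
    emb_B3]
  congr 1
  simp only [smul_inLeft]
  simp only [map_smul, map_add, map_sub]
  match_scalars
  · simp only [smul_eq_algebraMap_mul, map_ofNat]
    linear_combination (-X * tP 2 * zexp (-(algebraMap ℝ Cz (1 / 2) * cσm))) *
      (2 * algebraMap ℝ Cz (1 / 2) + 1) * two_mul_algebraMap_half
  · simp only [smul_eq_algebraMap_mul, map_ofNat]
    linear_combination (-X * tP 3 * zexp (-(algebraMap ℝ Cz (1 / 2) * cσm))) *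
      (2 * algebraMap ℝ Cz (1 / 2) + 1) * two_mul_algebraMap_half

theorem ΦA_eq : ΦA = zexp (Hp ⊠ val cσp) := by rw [ΦA, val_cσp]
theorem ΦJ_eq : ΦJ = zexp (Hm ⊠ val cσm) := by rw [ΦJ, val_cσm]

/-- `H₊ ⊗ σ₊ + H₋ ⊗ σ₋ = -z K₁ ⊗ P₁ - z D ⊗ P₀`. -/
theorem ΦA_mul_ΦJ : ΦA * ΦJ = EK * ED := by
  have hDK := emb_dil_mul_boostK
  have hH : Hp * Hm = Hm * Hp := by
    rw [emb_Hp, emb_Hm, smul_mul_smul_comm, smul_mul_smul_comm, mul_sub, sub_mul, add_mul, add_mul,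
      mul_add, mul_add, hDK]
  rw [ΦA_eq, ΦJ_eq, EK, ED, ← zexp_add_tmul_val hH constantCoeff_cσp constantCoeff_cσm,
    ← zexp_add_tmul_val hDK.symm constantCoeff_p1 constantCoeff_p0, emb_Hp, emb_Hm, cσp_eq,
    cσm_eq, p1, p0]
  congr 1
  simp only [smul_inLeft]
  simp only [map_smul, map_add, map_sub]
  match_scalars
  · linear_combination (-X * cPz 0) * two_mul_algebraMap_half
  · linear_combination (-X * cPz 1) * two_mul_algebraMap_half

theorem gh_mul (p : Cz) :
    -(X * (gh * p)) * zexp ((-(1 / 2) : ℝ) • cσp) = -(X * (ey * p)) := by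
  have h : gh * zexp ((-(1 / 2) : ℝ) • cσp) = ey := by
    rw [gh_eq, ← zexp_add_comm (constantCoeff_smul_zero_of _ constantCoeff_cσm)
      (constantCoeff_smul_zero_of _ constantCoeff_cσp), ey]
    congr 1
    rw [cσm_eq, cσp_eq]; module
  rw [← h]; ring

theorem Hp_mul {x : SO42} (h : emb dil * emb x = emb x * emb dil)
    (h' : emb (boostK 0) * emb x = emb x * emb (boostK 0) + (-1 : ℝ) • emb x) :
    Hp * emb x = emb x * Hp + (-(1 / 2) : ℝ) • emb x := by
  rw [emb_Hp, smul_mul_assoc, add_mul, h, h', mul_smul_comm, mul_add]; module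

/-- The compact form of the twisting element. The generators `K₂ + J₃` and `K₃ - J₂` have weight
`-1/2` under `H₊`, so moving `Φ_ℰ` to the left of `Φ_𝒜` multiplies the exponents by
`e^{-σ₊/2}`; the remaining factors `Φ_𝒜 Φ_𝒥` commute and recombine. -/
theorem twist_eq : twist = E3 * E2 * EK * ED := by
  have hn := emb_null_relations
  have hb : emb b2 * emb b3 = emb b3 * emb b2 := hn.2.2.2.2.2.2.2.2.2.1
  have h0 : ∀ p : Cz, constantCoeff (-(X * p)) = 0 := fun p => by
    rw [map_neg, constantCoeff_X_mul, neg_zero]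
  have h2 := ((conj_of_eigen (Hp_mul hn.1 hn.2.2.2.2.1) constantCoeff_cσp
    (-(X * (gh * cPz 2)))).congr (by rw [gh_mul])).zexp
    (constantCoeff_tmul_val _ (h0 _)) (constantCoeff_tmul_val _ (h0 _))
  have h3 := ((conj_of_eigen (Hp_mul hn.2.1 hn.2.2.2.2.2.1) constantCoeff_cσp
    (-(X * (gh * cPz 3)))).congr (by rw [gh_mul])).zexp
    (constantCoeff_tmul_val _ (h0 _)) (constantCoeff_tmul_val _ (h0 _))
  rw [← ΦA_eq] at h2 h3
  rw [twist, ΦE_eq, commute_zexp_tmul_val hb (h0 _) (h0 _), ← mul_assoc, h3, mul_assoc _ ΦA, h2,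
    ← mul_assoc, mul_assoc _ ΦA, ΦA_mul_ΦJ, ← mul_assoc]
  rfl

/-- `D` and `K₁` commute, so the exponential of `½ (D + s K₁) ⊗ (p + r q)` splits into four factors.
For `p = -z P₀`, `q = z P₁` and signs `r`, `s` these are the factorizations of `Φ_𝒥` and `Φ_𝒜`. -/
theorem zexp_four {r s : ℝ} {p q : Cz} (hp : constantCoeff p = 0) (hq : constantCoeff q = 0) :
    zexp (((1 / 2 : ℝ) • (emb dil + s • emb (boostK 0))) ⊠ val (p + r • q)) =
      zexp ((1 / 2 : ℝ) • (emb dil ⊠ val p)) * zexp ((r / 2 : ℝ) • (emb dil ⊠ val q)) *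
      zexp ((s / 2 : ℝ) • (emb (boostK 0) ⊠ val p)) *
      zexp ((s * r / 2 : ℝ) • (emb (boostK 0) ⊠ val q)) := by
  have hDK := emb_dil_mul_boostK
  have hp' : ∀ r : ℝ, constantCoeff (r • p) = 0 := fun r => constantCoeff_smul_zero_of r hp
  have hq' : ∀ r : ℝ, constantCoeff (r • q) = 0 := fun r => constantCoeff_smul_zero_of r hq
  simp only [smul_tmul_val]
  rw [mul_assoc, ← zexp_add_tmul_val rfl (hp' _) (hq' _), ← zexp_add_tmul_val rfl (hp' _) (hq' _),
    ← ztmul_add, ← map_add, ← ztmul_add, ← map_add, ← zexp_add_tmul_val hDK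
      (by rw [map_add, hp', hq', add_zero]) (by rw [map_add, hp', hq', add_zero])]
  congr 1
  simp only [smul_inLeft]
  simp only [map_smul, map_add, map_sub]
  match_scalars <;>
    simp only [smul_eq_algebraMap_mul, div_eq_mul_inv, map_mul, map_one] <;> ring

end Compact

/-! ### Conjugation by the twisting element -/

section TwistConjugation

open PowerSeries (coeff constantCoeff X mapAlgHom)
open NullPlane

theorem zexp_p0 : zexp p0 = exi := rfl

theorem zexp_p1 : zexp p1 = eyi := rfl

theorem zexp_neg_p1 : zexp (-p1) = ey := by rw [p1, neg_neg]; rfl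

theorem conj_twist {x x₁ x₂ x₃ x₄ : Uz₂} (h₁ : Conj ED x x₁) (h₂ : Conj EK x₁ x₂)
    (h₃ : Conj E2 x₂ x₃) (h₄ : Conj E3 x₃ x₄) : Conj twist x x₄ := by
  rw [twist_eq]
  exact ((h₄.comp h₃).comp h₂).comp h₁

theorem Brk.add_left {S S' : Uz} {p d d' : Cz} (h : Brk S p d) (h' : Brk S' p d') :
    Brk (S + S') p (d + d') := by
  rw [Brk, map_add, ← h, ← h', add_mul, mul_add]; abel

theorem Brk.sub_left {S S' : Uz} {p d d' : Cz} (h : Brk S p d) (h' : Brk S' p d') :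
    Brk (S - S') p (d - d') := by
  rw [Brk, map_sub, ← h, ← h', sub_mul, mul_sub]; abel

theorem Brk.mul_comm {S : Uz} {p d : Cz} (h : Brk S p d) : S * val p = val p * S + val d := by
  rw [← h]; abel

theorem conj_ED_of {S : Uz} (h : emb dil * S = S * emb dil) (s : Cz) :
    Conj ED (S ⊠ val s) (S ⊠ val s) := conj_of_commute h constantCoeff_p0 s

theorem conj_EK_of {S : Uz} (h : emb (boostK 0) * S = S * emb (boostK 0)) (s : Cz) :
    Conj EK (S ⊠ val s) (S ⊠ val s) := conj_of_commute h constantCoeff_p1 s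

theorem conj_E2_of {S : Uz} (h : emb b2 * S = S * emb b2) (s : Cz) :
    Conj E2 (S ⊠ val s) (S ⊠ val s) := conj_of_commute h (constantCoeff_ra 2) s

theorem conj_E3_of {S : Uz} (h : emb b3 * S = S * emb b3) (s : Cz) :
    Conj E3 (S ⊠ val s) (S ⊠ val s) := conj_of_commute h (constantCoeff_ra 3) s

theorem conj_EK_of_neg {S : Uz}
    (h : emb (boostK 0) * S = S * emb (boostK 0) + (-1 : ℝ) • S) (s : Cz) :
    Conj EK (S ⊠ val s) (S ⊠ val (s * ey)) :=
  (conj_of_eigen h constantCoeff_p1 s).congr (by rw [neg_one_smul, zexp_neg_p1])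

theorem conj_EK_of_pos {S : Uz}
    (h : emb (boostK 0) * S = S * emb (boostK 0) + (1 : ℝ) • S) (s : Cz) :
    Conj EK (S ⊠ val s) (S ⊠ val (s * eyi)) :=
  (conj_of_eigen h constantCoeff_p1 s).congr (by rw [one_smul, zexp_p1])

theorem b2_mul_boostK :
    emb b2 * emb (boostK 0) = emb (boostK 0) * emb b2 + emb b2 := by
  rw [emb_null_relations.2.2.2.2.1]; module

theorem b3_mul_boostK :
    emb b3 * emb (boostK 0) = emb (boostK 0) * emb b3 + emb b3 := by
  rw [emb_null_relations.2.2.2.2.2.1]; module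

theorem conj_twist_dil : Conj twist (emb dil ⊠ val 1) (emb dil ⊠ val 1) :=
  conj_twist (conj_ED_of rfl _) (conj_EK_of emb_dil_mul_boostK.symm _)
    (conj_E2_of emb_null_relations.1.symm _) (conj_E3_of emb_null_relations.2.1.symm _)

theorem conj_twist_boostK_zero : Conj twist (emb (boostK 0) ⊠ val 1)
    (emb (boostK 0) ⊠ val 1 + emb b2 ⊠ val (ra 2) + emb b3 ⊠ val (ra 3)) := by
  have hb : emb b2 * emb b3 = emb b3 * emb b2 := emb_null_relations.2.2.2.2.2.2.2.2.2.1
  refine conj_twist (conj_ED_of emb_dil_mul_boostK _) (conj_EK_of rfl _)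
    (conj_of_nilpotent' b2_mul_boostK rfl (constantCoeff_ra 2) 1)
    (((conj_of_nilpotent' b3_mul_boostK rfl (constantCoeff_ra 3) 1).add
      (conj_E3_of hb.symm _)).congr ?_)
  rw [mul_one, mul_one]; abel

theorem conj_twist_b2 : Conj twist (emb b2 ⊠ val 1) (emb b2 ⊠ val ey) := by
  have hn := emb_null_relations
  refine (conj_twist (conj_ED_of hn.1 _) (conj_EK_of_neg hn.2.2.2.2.1 _) (conj_E2_of rfl _)
    (conj_E3_of hn.2.2.2.2.2.2.2.2.2.1.symm _)).congr ?_
  rw [one_mul]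

theorem conj_twist_b3 : Conj twist (emb b3 ⊠ val 1) (emb b3 ⊠ val ey) := by
  have hn := emb_null_relations
  refine (conj_twist (conj_ED_of hn.2.1 _) (conj_EK_of_neg hn.2.2.2.2.2.1 _)
    (conj_E2_of hn.2.2.2.2.2.2.2.2.2.1 _) (conj_E3_of rfl _)).congr ?_
  rw [one_mul]

theorem conj_twist_rotJ_zero : Conj twist (emb (rotJ 0) ⊠ val 1)
    (emb (rotJ 0) ⊠ val 1 + emb b2 ⊠ val (ra 3) - emb b3 ⊠ val (ra 2)) := by
  obtain ⟨-, -, -, -, -, -, -, -, hKJ, hb, h2, h3, -⟩ := emb_null_relations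
  refine conj_twist (conj_ED_of (emb_commute (lie_dil_rotJ 0)) _) (conj_EK_of hKJ _)
    (conj_of_nilpotent' h2 (by rw [mul_neg, neg_mul, hb]) (constantCoeff_ra 2) 1)
    (((conj_of_nilpotent' h3 hb.symm (constantCoeff_ra 3) 1).add
      (conj_E3_of (by rw [mul_neg, neg_mul]) _)).congr ?_)
  rw [mul_one, mul_one, neg_ztmul]; abel

/-- The conjugates of the vectors of `K₁`-weight `1`: the adjoint series of the two nilpotent
factors stop after the quadratic terms. -/
theorem conj_twist_a2 : Conj twist (emb a2 ⊠ val 1)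
    (emb a2 ⊠ val eyi + (2 : ℝ) • (emb (rotJ 0) ⊠ val (ra 3 * eyi)) +
      emb b2 ⊠ val (ra 3 ^ 2 * eyi) - (2 : ℝ) • (emb (boostK 0) ⊠ val (ra 2 * eyi)) -
      (2 : ℝ) • (emb b3 ⊠ val (ra 2 * ra 3 * eyi)) - emb b2 ⊠ val (ra 2 ^ 2 * eyi)) := by
  obtain ⟨-, -, hD, -, -, -, hK, -, -, hb, h2, h3, h22, h23, h32, h33⟩ := emb_null_relations
  refine conj_twist (conj_ED_of hD _) (conj_EK_of_pos hK _)
    (conj_of_nilpotent (d := (-2 : ℝ) • emb b2) h22 (by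
      rw [mul_neg, neg_mul, mul_smul_comm, smul_mul_assoc, b2_mul_boostK]; module)
      (by rw [mul_smul_comm, smul_mul_assoc]) (constantCoeff_ra 2) _)
    ((((conj_of_nilpotent (d := (2 : ℝ) • emb b2) h32 (by
      rw [mul_smul_comm, smul_mul_assoc, h3]; module)
      (by rw [mul_smul_comm, smul_mul_assoc, hb]) (constantCoeff_ra 3) _).add
      (conj_of_nilpotent' (c := (-2 : ℝ) • emb b3)
        (by rw [mul_neg, neg_mul, mul_smul_comm, smul_mul_assoc, b3_mul_boostK]; module)
        (by rw [mul_smul_comm, smul_mul_assoc]) (constantCoeff_ra 3) _)).add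
      (show Conj E3 ((1 / 2 : ℝ) • (((-2 : ℝ) • emb b2) ⊠ val (ra 2 ^ 2 * (1 * eyi)))) _ by
        rw [smul_tmul_val]
        exact conj_E3_of (by rw [mul_smul_comm, smul_mul_assoc, hb]) _)).congr ?_)
  simp only [one_mul, smul_ztmul, neg_ztmul, map_smul, ztmul_smul, smul_smul]
  rw [show ra 3 * (ra 2 * eyi) = ra 2 * ra 3 * eyi by ring]
  module

theorem conj_twist_a3 : Conj twist (emb a3 ⊠ val 1)
    (emb a3 ⊠ val eyi - (2 : ℝ) • (emb (rotJ 0) ⊠ val (ra 2 * eyi)) +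
      emb b3 ⊠ val (ra 2 ^ 2 * eyi) - (2 : ℝ) • (emb (boostK 0) ⊠ val (ra 3 * eyi)) -
      (2 : ℝ) • (emb b2 ⊠ val (ra 2 * ra 3 * eyi)) - emb b3 ⊠ val (ra 3 ^ 2 * eyi)) := by
  obtain ⟨-, -, -, hD, -, -, -, hK, -, hb, h2, h3, h22, h23, h32, h33⟩ := emb_null_relations
  refine conj_twist (conj_ED_of hD _) (conj_EK_of_pos hK _)
    (conj_of_nilpotent (d := (2 : ℝ) • emb b3) h23 (by
      rw [mul_neg, neg_mul, mul_smul_comm, smul_mul_assoc, h2]; module)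
      (by rw [mul_smul_comm, smul_mul_assoc, hb]) (constantCoeff_ra 2) _)
    ((((conj_of_nilpotent (d := (-2 : ℝ) • emb b3) h33 (by
      rw [mul_neg, neg_mul, mul_smul_comm, smul_mul_assoc, b3_mul_boostK]; module)
      (by rw [mul_smul_comm, smul_mul_assoc]) (constantCoeff_ra 3) _).add
      (conj_of_nilpotent' (c := (-2 : ℝ) • emb b2)
        (by rw [mul_neg, neg_mul, mul_smul_comm, smul_mul_assoc, h3]; module)
        (by rw [mul_smul_comm, smul_mul_assoc, hb]) (constantCoeff_ra 3) _)).add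
      (show Conj E3 ((1 / 2 : ℝ) • (((2 : ℝ) • emb b3) ⊠ val (ra 2 ^ 2 * (1 * eyi)))) _ by
        rw [smul_tmul_val]
        exact conj_E3_of (by rw [mul_smul_comm, smul_mul_assoc]) _)).congr ?_)
  simp only [one_mul, smul_ztmul, neg_ztmul, map_smul, ztmul_smul, smul_smul]
  rw [show ra 3 * (ra 2 * eyi) = ra 2 * ra 3 * eyi by ring]
  module

/-- The conjugation of `1 ⊗ Y`, in terms of the commutators of `Y` with the translations. -/
theorem conj_twist_one_tmul {Y : Uz} {f0 f1 f2 f3 : Cz} (h0 : Brk Y (cPz 0) f0)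
    (h1 : Brk Y (cPz 1) f1) (h2 : Brk Y (cPz 2) f2) (h3 : Brk Y (cPz 3) f3) :
    Conj twist (1 ⊠ Y) (1 ⊠ Y + emb dil ⊠ val (X * f0) + emb (boostK 0) ⊠ val (X * f1) +
      emb b2 ⊠ val (X * (ey * f2)) + emb b3 ⊠ val (X * (ey * f3))) := by
  obtain ⟨hD2, hD3, -, -, -, -, -, -, -, hb, -⟩ := emb_null_relations
  have hy : Brk Y ey (X * f1 * ey) := Brk.zexp (constantCoeff_X_mul _) h1.X_mul
  have g0 : Brk Y p0 (-(X * f0)) := h0.X_mul.neg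
  have g1 : Brk Y p1 (-(X * f1)) := h1.X_mul.neg
  have g2 : Brk Y (ra 2) (-(X * (X * f1 * ey * cPz 2 + ey * f2))) := (hy.mul h2).X_mul.neg
  have g3 : Brk Y (ra 3) (-(X * (X * f1 * ey * cPz 3 + ey * f3))) := (hy.mul h3).X_mul.neg
  refine conj_twist
    (x₁ := 1 ⊠ Y + emb dil ⊠ val (X * f0))
    (x₂ := 1 ⊠ Y + emb dil ⊠ val (X * f0) + emb (boostK 0) ⊠ val (X * f1))
    (x₃ := 1 ⊠ Y + emb dil ⊠ val (X * f0) + emb (boostK 0) ⊠ val (X * f1) +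
      emb b2 ⊠ val (X * (ey * f2)))
    ((conj_inRight constantCoeff_p0 g0).congr ?_)
    (((conj_inRight constantCoeff_p1 g1).add (conj_EK_of emb_dil_mul_boostK.symm _)).congr ?_)
    ((((conj_inRight (constantCoeff_ra 2) g2).add (conj_E2_of hD2.symm _)).add
      (conj_of_nilpotent' b2_mul_boostK rfl (constantCoeff_ra 2) _)).congr ?_)
    (((((conj_inRight (constantCoeff_ra 3) g3).add (conj_E3_of hD3.symm _)).add
      (conj_of_nilpotent' b3_mul_boostK rfl (constantCoeff_ra 3) _)).add
      (conj_E3_of hb.symm _)).congr ?_)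
  · rw [← neg_tmul_val]; abel
  · rw [← neg_tmul_val]; abel
  · rw [← neg_tmul_val, show X * (X * f1 * ey * cPz 2 + ey * f2) =
      -(ra 2 * (X * f1)) + X * (ey * f2) by rw [ra]; ring, map_add, ztmul_add, ← neg_tmul_val]
    abel
  · rw [← neg_tmul_val, show X * (X * f1 * ey * cPz 3 + ey * f3) =
      -(ra 3 * (X * f1)) + X * (ey * f3) by rw [ra]; ring, map_add, ztmul_add, ← neg_tmul_val]
    abel

/-- The second legs of the twisting element are series in the translations, which commute. -/
theorem conj_twist_one_tmul_val (p : Cz) : Conj twist (1 ⊠ val p) (1 ⊠ val p) :=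
  conj_twist (conj_ED_of (by simp) _) (conj_EK_of (by simp) _) (conj_E2_of (by simp) _)
    (conj_E3_of (by simp) _)

/-! ### Conjugation of the translations in the first factor -/

theorem brk_b2_tP : Brk (emb b2) (tP 0 - tP 1) 0 ∧ Brk (emb b2) (tP 2) (tP 0 - tP 1) ∧
    Brk (emb b2) (tP 3) 0 ∧ Brk (emb b2) (tP 0 + tP 1) (2 * tP 2) := by
  have k := brk_boostK 1
  have r : ∀ μ, Brk (emb (rotJ 2)) (tP μ) (![0, tP 2, -tP 1, 0] μ) := by
    intro μ
    cases μ using Fin.cases with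
    | zero => exact brk_rotJ_zero 2
    | succ j =>
      refine (brk_rotJ 2 j).congr ?_
      fin_cases j <;> simp [eps, Fin.sum_univ_three]
  have h : ∀ μ, Brk (emb b2) (tP μ) _ := fun μ => by
    rw [b2, emb_add]; exact (k μ).add_left (r μ)
  refine ⟨((h 0).sub (h 1)).congr ?_, (h 2).congr ?_, (h 3).congr ?_,
    ((h 0).add (h 1)).congr ?_⟩ <;> simp <;> ring

theorem brk_b3_tP : Brk (emb b3) (tP 0 - tP 1) 0 ∧ Brk (emb b3) (tP 2) 0 ∧
    Brk (emb b3) (tP 3) (tP 0 - tP 1) ∧ Brk (emb b3) (tP 0 + tP 1) (2 * tP 3) := by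
  have k := brk_boostK 2
  have r : ∀ μ, Brk (emb (rotJ 1)) (tP μ) (![0, -tP 3, 0, tP 1] μ) := by
    intro μ
    cases μ using Fin.cases with
    | zero => exact brk_rotJ_zero 1
    | succ j =>
      refine (brk_rotJ 1 j).congr ?_
      fin_cases j <;> simp [eps, Fin.sum_univ_three]
  have h : ∀ μ, Brk (emb b3) (tP μ) _ := fun μ => by
    rw [b3, emb_sub]; exact (k μ).sub_left (r μ)
  refine ⟨((h 0).sub (h 1)).congr ?_, (h 2).congr ?_, (h 3).congr ?_,
    ((h 0).add (h 1)).congr ?_⟩ <;> simp <;> ring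

theorem brk_boostK_zero_tP : Brk (emb (boostK 0)) (tP 0 - tP 1) (-(tP 0 - tP 1)) ∧
    Brk (emb (boostK 0)) (tP 2) 0 ∧ Brk (emb (boostK 0)) (tP 3) 0 ∧
    Brk (emb (boostK 0)) (tP 0 + tP 1) (tP 0 + tP 1) := by
  have h := brk_boostK 0
  refine ⟨((h 0).sub (h 1)).congr ?_, (h 2).congr ?_, (h 3).congr ?_,
    ((h 0).add (h 1)).congr ?_⟩ <;> simp <;> ring

theorem Brk.comm_of_zero {S : Uz} {p : Cz} (h : Brk S p 0) : S * val p = val p * S := by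
  rw [h.mul_comm, map_zero, add_zero]

theorem conj_ED_tmul {p : Cz} (h : Brk (emb dil) p p) (s : Cz) :
    Conj ED (val p ⊠ val s) (val p ⊠ val (s * exi)) :=
  (conj_of_eigen (r := 1) (by rw [h.mul_comm, one_smul]) constantCoeff_p0 s).congr
    (by rw [one_smul, zexp_p0])

theorem conj_twist_tm : Conj twist (val (tP 0 - tP 1) ⊠ val 1)
    (val (tP 0 - tP 1) ⊠ val (exi * ey)) := by
  refine (conj_twist (conj_ED_tmul ((brk_dil 0).sub (brk_dil 1)) _)
    (conj_EK_of_neg (by rw [brk_boostK_zero_tP.1.mul_comm, map_neg, neg_one_smul]) _)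
    (conj_E2_of brk_b2_tP.1.comm_of_zero _) (conj_E3_of brk_b3_tP.1.comm_of_zero _)).congr ?_
  rw [one_mul]

theorem conj_twist_t2 : Conj twist (val (tP 2) ⊠ val 1)
    (val (tP 2) ⊠ val exi + val (tP 0 - tP 1) ⊠ val (ra 2 * exi)) := by
  refine (conj_twist (conj_ED_tmul (brk_dil 2) _)
    (conj_EK_of brk_boostK_zero_tP.2.1.comm_of_zero _)
    (conj_of_nilpotent' brk_b2_tP.2.1.mul_comm brk_b2_tP.1.comm_of_zero (constantCoeff_ra 2) _)
    ((conj_E3_of brk_b3_tP.2.1.comm_of_zero _).add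
      (conj_E3_of brk_b3_tP.1.comm_of_zero _))).congr ?_
  rw [one_mul]

theorem conj_twist_t3 : Conj twist (val (tP 3) ⊠ val 1)
    (val (tP 3) ⊠ val exi + val (tP 0 - tP 1) ⊠ val (ra 3 * exi)) := by
  refine (conj_twist (conj_ED_tmul (brk_dil 3) _)
    (conj_EK_of brk_boostK_zero_tP.2.2.1.comm_of_zero _)
    (conj_E2_of brk_b2_tP.2.2.1.comm_of_zero _)
    (conj_of_nilpotent' brk_b3_tP.2.2.1.mul_comm brk_b3_tP.1.comm_of_zero
      (constantCoeff_ra 3) _)).congr ?_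
  rw [one_mul]

theorem conj_twist_tp : Conj twist (val (tP 0 + tP 1) ⊠ val 1)
    (val (tP 0 + tP 1) ⊠ val (exi * eyi) + val (2 * tP 2) ⊠ val (ra 2 * (exi * eyi)) +
      val (2 * tP 3) ⊠ val (ra 3 * (exi * eyi)) +
      val (tP 0 - tP 1) ⊠ val ((ra 2 ^ 2 + ra 3 ^ 2) * (exi * eyi))) := by
  have two : ∀ {S : Uz} {p d : Cz}, Brk S p d → Brk S (2 * p) (2 * d) := fun {S p d} h =>
    (h.add h).congr' (two_mul p).symm (two_mul d).symm
  refine (conj_twist (conj_ED_tmul ((brk_dil 0).add (brk_dil 1)) _)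
    (conj_EK_of_pos (by rw [brk_boostK_zero_tP.2.2.2.mul_comm, one_smul]) _)
    (conj_of_nilpotent brk_b2_tP.2.2.2.mul_comm (two brk_b2_tP.2.1).mul_comm
      ((two brk_b2_tP.1).congr (mul_zero _)).comm_of_zero (constantCoeff_ra 2) _)
    (((conj_of_nilpotent brk_b3_tP.2.2.2.mul_comm (two brk_b3_tP.2.2.1).mul_comm
      ((two brk_b3_tP.1).congr (mul_zero _)).comm_of_zero (constantCoeff_ra 3) _).add
      (conj_E3_of ((two brk_b3_tP.2.1).congr (mul_zero _)).comm_of_zero _)).add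
      (show Conj E3 ((1 / 2 : ℝ) • (val (2 * (tP 0 - tP 1)) ⊠ val (ra 2 ^ 2 * (1 * exi * eyi)))) _
        by
        rw [smul_tmul_val]
        exact conj_E3_of ((two brk_b3_tP.1).congr (mul_zero _)).comm_of_zero _))).congr ?_
  have h2 : ∀ (p q : Cz), (1 / 2 : ℝ) • (val (2 * p) ⊠ val q) = val p ⊠ val q := by
    intro p q
    rw [two_mul, map_add, add_ztmul]; module
  rw [← smul_tmul_val, h2, h2, one_mul, add_mul, map_add val (ra 2 ^ 2 * _), ztmul_add]
  abel

end TwistConjugation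

/-! ### The twisted coproduct of the Lorentz and dilation generators -/

section Coproduct

open PowerSeries (coeff constantCoeff X mapAlgHom)
open NullPlane

theorem isUnit_twist : IsUnit twist := by
  rw [twist_eq]
  exact (((isUnit_zexp (constantCoeff_tmul_val _ (constantCoeff_ra 3))).mul
    (isUnit_zexp (constantCoeff_tmul_val _ (constantCoeff_ra 2)))).mul
    (isUnit_zexp (constantCoeff_tmul_val _ constantCoeff_p1))).mul
    (isUnit_zexp (constantCoeff_tmul_val _ constantCoeff_p0))

theorem zcomul_emb (x : SO42) : zcomul (emb x) = emb x ⊠ val 1 + 1 ⊠ emb x := by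
  rw [map_one, zcomul, emb, mapAlgHom_C, ztmul_one, one_ztmul, inLeft, inRight, mapAlgHom_C,
    mapAlgHom_C, ← map_add]
  exact congrArg _ (envComul_ι x)

/-- The generators of `so(4,2)` are primitive for the undeformed coproduct, so their twisted
coproduct is the sum of the conjugates of `x ⊗ 1` and `1 ⊗ x`. -/
theorem twComul_emb {x : SO42} {w : Uz₂} (h : Conj twist (emb x ⊠ val 1) w) {f0 f1 f2 f3 : Cz}
    (hf : Brk (emb x) (cPz 0) f0 ∧ Brk (emb x) (cPz 1) f1 ∧ Brk (emb x) (cPz 2) f2 ∧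
      Brk (emb x) (cPz 3) f3) :
    twComul twist (emb x) = w + (1 ⊠ emb x + emb dil ⊠ val (X * f0) +
      emb (boostK 0) ⊠ val (X * f1) + emb b2 ⊠ val (X * (ey * f2)) +
      emb b3 ⊠ val (X * (ey * f3))) := by
  rw [twComul_eq_iff isUnit_twist, zcomul_emb]
  exact h.add (conj_twist_one_tmul hf.1 hf.2.1 hf.2.2.1 hf.2.2.2)

theorem emb_b2 : emb b2 = emb (boostK 1) + emb (rotJ 2) := emb_add _ _
theorem emb_b3 : emb b3 = emb (boostK 2) - emb (rotJ 1) := emb_sub _ _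
theorem emb_a2 : emb a2 = emb (boostK 1) - emb (rotJ 2) := emb_sub _ _
theorem emb_a3 : emb a3 = emb (boostK 2) + emb (rotJ 1) := emb_add _ _

theorem Conj.smul {F x y : Uz₂} (r : ℝ) (h : Conj F x y) : Conj F (r • x) (r • y) := by
  rw [Conj, mul_smul_comm, smul_mul_assoc, h]

/-- `Θ` in the coproducts of `D` and `K₁`. -/
def theta : Uz₂ :=
  z₂ * ((emb (boostK 1) + emb (rotJ 2)) ⊠ val (ex * cPz 2)) +
    z₂ * ((emb (boostK 2) - emb (rotJ 1)) ⊠ val (ex * cPz 3)) +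
    (1 / 2 : ℝ) • (z₂ ^ 2 * ((emb dil + emb (boostK 0)) ⊠
      val (ex * ey * (cPz 2 ^ 2 + cPz 3 ^ 2))))

theorem half_of_two_mul {p q : Cz} (h : 2 * p = q) : p = algebraMap ℝ Cz (1 / 2) * q := by
  linear_combination algebraMap ℝ Cz (1 / 2) * h - p * two_mul_algebraMap_half

theorem twComul_dil : twComul twist (emb dil) =
    emb dil ⊠ val (ex * zcosh (X * cPz 1)) + 1 ⊠ emb dil +
      emb (boostK 0) ⊠ val (ex * zsinh (X * cPz 1)) + theta := by
  have w1 := half_of_two_mul two_mul_X_mul_zdiv_cosh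
  have w2 := half_of_two_mul two_mul_X_mul_zdiv_sinh
  have hc := two_mul_algebraMap_half
  have hy := ey_mul_eyi
  rw [twComul_emb conj_twist_dil brk_dil_cPz, theta, sq z₂, mul_assoc z₂, z₂_mul_tmul_val,
    z₂_mul_tmul_val, z₂_mul_tmul_val, z₂_mul_tmul_val, one_ztmul, emb_b2, emb_b3]
  generalize zdiv (ex * zcosh (X * cPz 1) - 1) = Z₁ at *
  generalize zdiv (ex * zsinh (X * cPz 1)) = Z₂ at *
  rw [zcosh_eq, zsinh_eq]
  simp only [smul_inLeft]
  simp only [map_add, map_sub]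
  match_scalars <;> try simp only [smul_eq_algebraMap_mul]
  all_goals generalize algebraMap ℝ Cz (1 / 2) = c at *
  all_goals first | ring1 | grind

theorem twComul_boostK_zero : twComul twist (emb (boostK 0)) =
    emb (boostK 0) ⊠ val (ex * zcosh (X * cPz 1)) + 1 ⊠ emb (boostK 0) +
      emb dil ⊠ val (ex * zsinh (X * cPz 1)) - theta := by
  have w1 := half_of_two_mul two_mul_X_mul_zdiv_cosh
  have w2 := half_of_two_mul two_mul_X_mul_zdiv_sinh
  have hc := two_mul_algebraMap_half
  have hy := ey_mul_eyi
  rw [twComul_emb conj_twist_boostK_zero brk_boostK_zero_cPz, theta, sq z₂, mul_assoc z₂,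
    z₂_mul_tmul_val, z₂_mul_tmul_val, z₂_mul_tmul_val, z₂_mul_tmul_val, one_ztmul, emb_b2, emb_b3]
  generalize zdiv (ex * zcosh (X * cPz 1) - 1) = Z₁ at *
  generalize zdiv (ex * zsinh (X * cPz 1)) = Z₂ at *
  rw [zcosh_eq, zsinh_eq]
  simp only [smul_inLeft]
  simp only [map_add, map_sub]
  match_scalars <;> try simp only [smul_eq_algebraMap_mul, ra]
  all_goals generalize algebraMap ℝ Cz (1 / 2) = c at *
  all_goals first | ring1 | grind

theorem twComul_rotJ_zero : twComul twist (emb (rotJ 0)) =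
    emb (rotJ 0) ⊠ 1 + 1 ⊠ emb (rotJ 0) := by
  rw [twComul_emb conj_twist_rotJ_zero brk_rotJ_zero_cPz, ← map_one val,
    show X * (ey * cPz 3) = -ra 3 by rw [ra, neg_neg],
    show X * (ey * -cPz 2) = ra 2 by rw [ra]; ring, mul_zero, map_zero, ztmul_zero, ztmul_zero,
    ← neg_tmul_val]
  abel

theorem twComul_rotJ_two : twComul twist (emb (rotJ 2)) =
    emb (rotJ 2) ⊠ val eyi + 1 ⊠ emb (rotJ 2) + z₂ * (emb (rotJ 0) ⊠ val (cPz 3)) := by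
  have w1 := X_mul_zdiv_one_sub
  have hc := two_mul_algebraMap_half
  have hy := ey_mul_eyi
  have hx := ex_mul_exi
  have h : Conj twist (emb (rotJ 2) ⊠ val 1) _ :=
    (((conj_twist_b2.sub conj_twist_a2).smul (1 / 2 : ℝ)).congr' (by
      rw [← sub_ztmul, ← smul_ztmul]; congr 1; rw [emb_b2, emb_a2]
      module))
  rw [twComul_emb h brk_rotJ_two_cPz, z₂_mul_tmul_val,
    one_ztmul, emb_b2, emb_b3, emb_a2]
  generalize zdiv (1 - zexp (-((2 : ℝ) • (X * cPz 1)))) = Z at *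
  simp only [smul_inLeft]
  simp only [map_add, map_sub]
  match_scalars <;> try simp only [smul_eq_algebraMap_mul, map_ofNat, ra]
  all_goals clear * - w1 hc hy hx
  all_goals generalize algebraMap ℝ Cz (1 / 2) = c at *
  all_goals first | ring1 | grind

theorem twComul_rotJ_one : twComul twist (emb (rotJ 1)) =
    emb (rotJ 1) ⊠ val eyi + 1 ⊠ emb (rotJ 1) + z₂ * (emb (rotJ 0) ⊠ val (cPz 2)) := by
  have w1 := X_mul_zdiv_one_sub
  have hc := two_mul_algebraMap_half
  have hy := ey_mul_eyi
  have hx := ex_mul_exi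
  have h : Conj twist (emb (rotJ 1) ⊠ val 1) _ :=
    (((conj_twist_a3.sub conj_twist_b3).smul (1 / 2 : ℝ)).congr' (by
      rw [← sub_ztmul, ← smul_ztmul]; congr 1; rw [emb_a3, emb_b3]
      module))
  rw [twComul_emb h brk_rotJ_one_cPz, z₂_mul_tmul_val,
    one_ztmul, emb_b2, emb_b3, emb_a3]
  generalize zdiv (1 - zexp (-((2 : ℝ) • (X * cPz 1)))) = Z at *
  simp only [smul_inLeft]
  simp only [map_add, map_sub]
  match_scalars <;> try simp only [smul_eq_algebraMap_mul, map_ofNat, ra]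
  all_goals clear * - w1 hc hy hx
  all_goals generalize algebraMap ℝ Cz (1 / 2) = c at *
  all_goals first | ring1 | grind

theorem twComul_boostK_one : twComul twist (emb (boostK 1)) =
    emb (boostK 1) ⊠ val ex + 1 ⊠ emb (boostK 1) + emb (rotJ 2) ⊠ val (ex - eyi) -
      z₂ * (emb (rotJ 0) ⊠ val (cPz 3)) +
      z₂ * ((emb dil + emb (boostK 0)) ⊠ val (ex * ey * cPz 2)) := by
  have w1 := half_of_two_mul two_mul_X_mul_zdiv_sub_cosh
  have hc := two_mul_algebraMap_half
  have hy := ey_mul_eyi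
  have hx := ex_mul_exi
  have h : Conj twist (emb (boostK 1) ⊠ val 1) _ :=
    (((conj_twist_b2.add conj_twist_a2).smul (1 / 2 : ℝ)).congr' (by
      rw [← add_ztmul, ← smul_ztmul]; congr 1; rw [emb_b2, emb_a2]
      module))
  rw [twComul_emb h brk_boostK_one_cPz, z₂_mul_tmul_val,
    z₂_mul_tmul_val, one_ztmul, emb_b2, emb_b3, emb_a2]
  generalize zdiv (eyi * (ex - zcosh (X * cPz 1))) = Z at *
  simp only [smul_inLeft]
  simp only [map_add, map_sub]
  match_scalars <;> try simp only [smul_eq_algebraMap_mul, map_ofNat, ra]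
  all_goals clear * - w1 hc hy hx
  all_goals generalize algebraMap ℝ Cz (1 / 2) = c at *
  all_goals first | ring1 | grind

theorem twComul_boostK_two : twComul twist (emb (boostK 2)) =
    emb (boostK 2) ⊠ val ex + 1 ⊠ emb (boostK 2) - emb (rotJ 1) ⊠ val (ex - eyi) +
      z₂ * (emb (rotJ 0) ⊠ val (cPz 2)) +
      z₂ * ((emb dil + emb (boostK 0)) ⊠ val (ex * ey * cPz 3)) := by
  have w1 := half_of_two_mul two_mul_X_mul_zdiv_sub_cosh
  have hc := two_mul_algebraMap_half
  have hy := ey_mul_eyi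
  have hx := ex_mul_exi
  have h : Conj twist (emb (boostK 2) ⊠ val 1) _ :=
    (((conj_twist_a3.add conj_twist_b3).smul (1 / 2 : ℝ)).congr' (by
      rw [← add_ztmul, ← smul_ztmul]; congr 1; rw [emb_a3, emb_b3]
      module))
  rw [twComul_emb h brk_boostK_two_cPz, z₂_mul_tmul_val,
    z₂_mul_tmul_val, one_ztmul, emb_b2, emb_b3, emb_a3]
  generalize zdiv (eyi * (ex - zcosh (X * cPz 1))) = Z at *
  simp only [smul_inLeft]
  simp only [map_add, map_sub]
  match_scalars <;> try simp only [smul_eq_algebraMap_mul, map_ofNat, ra]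
  all_goals clear * - w1 hc hy hx
  all_goals generalize algebraMap ℝ Cz (1 / 2) = c at *
  all_goals first | ring1 | grind

end Coproduct

/-! ### The twisted coproduct of the translations -/

section TranslationCoproduct

open PowerSeries (coeff constantCoeff X mapAlgHom)
open NullPlane

/-- Formal power series with coefficients in the commutative tensor square of the algebra of
translations. -/
abbrev Cz₂ : Type := PowerSeries (TransAlg ⊗[ℝ] TransAlg)

/-- The inclusion `Cz₂ → Uz₂`. -/
def val₂ : Cz₂ →ₐ[ℝ] Uz₂ := mapAlgHom (Algebra.TensorProduct.map transVal transVal)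

theorem val₂_inLeft (p : Cz) : val₂ (inLeft p) = inLeft (val p) := by
  rw [val₂, inLeft, inLeft, val, mapAlgHom_mapAlgHom, mapAlgHom_mapAlgHom]
  exact mapAlgHom_congr (fun a => by simp) p

theorem val₂_inRight (p : Cz) : val₂ (inRight p) = inRight (val p) := by
  rw [val₂, inRight, inRight, val, mapAlgHom_mapAlgHom, mapAlgHom_mapAlgHom]
  exact mapAlgHom_congr (fun a => by simp) p

theorem val_tmul_val (p q : Cz) : val p ⊠ val q = val₂ (inLeft p * inRight q) := by
  rw [ztmul_def, map_mul, val₂_inLeft, val₂_inRight]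

theorem inLeft_X {A : Type*} [Ring A] [Algebra ℝ A] : inLeft (X : PowerSeries A) = X :=
  mapAlgHom_X _

theorem inRight_X {A : Type*} [Ring A] [Algebra ℝ A] : inRight (X : PowerSeries A) = X :=
  mapAlgHom_X _

theorem constantCoeff_inLeft {A : Type*} [Ring A] [Algebra ℝ A] {f : PowerSeries A}
    (hf : constantCoeff f = 0) : constantCoeff (inLeft f) = 0 := by
  rw [inLeft, constantCoeff_mapAlgHom, hf, map_zero]

theorem constantCoeff_inRight {A : Type*} [Ring A] [Algebra ℝ A] {f : PowerSeries A}
    (hf : constantCoeff f = 0) : constantCoeff (inRight f) = 0 := by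
  rw [inRight, constantCoeff_mapAlgHom, hf, map_zero]

/-- The coproduct `Δ_F` on the translations, with `F` the twisting element. -/
def dl : Cz →ₐ[ℝ] Uz₂ := (twComulHom twist isUnit_twist).comp val

theorem dl_apply (p : Cz) : dl p = twComul twist (val p) := rfl

theorem dl_eq {p : Cz} {w w' : Uz₂} (h : zcomul (val p) = w) (h' : Conj twist w w') :
    dl p = w' := by
  rw [dl_apply, twComul_eq_iff isUnit_twist, h]
  exact h'

theorem dl_X : dl X = X := by
  refine dl_eq (w := X) ?_ (PowerSeries.commute_X twist)
  rw [val_X, z, zcomul, mapAlgHom_X]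

theorem constantCoeff_dl {p : Cz} (hp : constantCoeff p = 0) : constantCoeff (dl p) = 0 := by
  rw [dl_apply, twComul, map_mul, map_mul, zcomul, constantCoeff_mapAlgHom,
    constantCoeff_val hp, map_zero, mul_zero, zero_mul]

theorem dl_zexp {p : Cz} (hp : constantCoeff p = 0) : dl (zexp p) = zexp (dl p) := by
  have h0 : constantCoeff (zcomul (val p)) = 0 := by
    rw [zcomul, constantCoeff_mapAlgHom, constantCoeff_val hp, map_zero]
  refine dl_eq (w := zexp (zcomul (val p))) (by rw [val_zexp, zcomul, map_zexp]) ?_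
  exact Conj.zexp ((twComul_eq_iff isUnit_twist).1 (dl_apply p).symm) h0 (constantCoeff_dl hp)

theorem zcomul_tP (μ : Fin 4) : zcomul (val (tP μ)) = val (tP μ) ⊠ val 1 + 1 ⊠ val (tP μ) := by
  rw [val_tP, zcomul_emb]

/-- The difference `2 T₋` of the undeformed translations. -/
def tm : Cz := tP 0 - tP 1

/-- The sum `2 T₊` of the undeformed translations. -/
def tp : Cz := tP 0 + tP 1

theorem dl_tm : dl tm = val₂ (inLeft tm * inRight (exi * ey) + inRight tm) := by
  rw [map_add, ← val_tmul_val, val₂_inRight, ← one_ztmul]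
  refine dl_eq ?_ (conj_twist_tm.add (conj_twist_one_tmul_val tm))
  rw [tm, map_sub, map_sub, zcomul_tP, zcomul_tP, sub_ztmul, ztmul_sub]; abel

theorem dl_t2 : dl (tP 2) = val₂ (inLeft (tP 2) * inRight exi + inLeft tm * inRight (ra 2 * exi) +
    inRight (tP 2)) := by
  rw [map_add, map_add, ← val_tmul_val, ← val_tmul_val, val₂_inRight, ← one_ztmul]
  exact dl_eq (zcomul_tP 2) (conj_twist_t2.add (conj_twist_one_tmul_val _))

theorem dl_t3 : dl (tP 3) = val₂ (inLeft (tP 3) * inRight exi + inLeft tm * inRight (ra 3 * exi) +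
    inRight (tP 3)) := by
  rw [map_add, map_add, ← val_tmul_val, ← val_tmul_val, val₂_inRight, ← one_ztmul]
  exact dl_eq (zcomul_tP 3) (conj_twist_t3.add (conj_twist_one_tmul_val _))

theorem dl_tp : dl tp = val₂ (inLeft tp * inRight (exi * eyi) +
    inLeft (2 * tP 2) * inRight (ra 2 * (exi * eyi)) +
    inLeft (2 * tP 3) * inRight (ra 3 * (exi * eyi)) +
    inLeft tm * inRight ((ra 2 ^ 2 + ra 3 ^ 2) * (exi * eyi)) + inRight tp) := by
  rw [map_add, map_add, map_add, map_add, ← val_tmul_val, ← val_tmul_val, ← val_tmul_val,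
    ← val_tmul_val, val₂_inRight, ← one_ztmul]
  refine dl_eq ?_ (conj_twist_tp.add (conj_twist_one_tmul_val tp))
  rw [tp, map_add, map_add, zcomul_tP, zcomul_tP, add_ztmul, ztmul_add]; abel

theorem X_mul_tm : X * tm = 1 - exi * ey := by
  have h0 := two_mul_X_mul_tP_zero
  have h1 := two_mul_X_mul_tP_one
  have h : 2 * (X * tm) = 2 * (1 - exi * ey) := by rw [tm]; linear_combination h0 - h1
  linear_combination algebraMap ℝ Cz (1 / 2) * h - (X * tm - 1 + exi * ey) * two_mul_algebraMap_half

theorem X_mul_tp : X * tp = 1 - exi * eyi - X ^ 2 * (exi * ey) * (cPz 2 ^ 2 + cPz 3 ^ 2) := by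
  have h0 := two_mul_X_mul_tP_zero
  have h1 := two_mul_X_mul_tP_one
  have h : 2 * (X * tp) =
      2 * (1 - exi * eyi - X ^ 2 * (exi * ey) * (cPz 2 ^ 2 + cPz 3 ^ 2)) := by
    rw [tp]; linear_combination h0 + h1
  linear_combination algebraMap ℝ Cz (1 / 2) * h - (X * tp - (1 - exi * eyi -
    X ^ 2 * (exi * ey) * (cPz 2 ^ 2 + cPz 3 ^ 2))) * two_mul_algebraMap_half

theorem inLeft_congr {A : Type*} [Ring A] [Algebra ℝ A] {p q : PowerSeries A} (h : p = q) :
    inLeft p = inLeft q := congrArg _ h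

theorem inRight_congr {A : Type*} [Ring A] [Algebra ℝ A] {p q : PowerSeries A} (h : p = q) :
    inRight p = inRight q := congrArg _ h

/-- `e^{σ₋} = 1 - 2 z T₋` is group-like. -/
theorem dl_em : dl (exi * ey) = val₂ (inLeft (exi * ey) * inRight (exi * ey)) := by
  have h1 := inLeft_congr X_mul_tm
  have h2 := inRight_congr X_mul_tm
  rw [map_mul, inLeft_X, map_sub, map_one] at h1
  rw [map_mul, inRight_X, map_sub, map_one] at h2
  rw [show exi * ey = 1 - X * tm by rw [X_mul_tm, sub_sub_cancel], map_sub, map_one, map_mul, dl_X,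
    dl_tm, show (X : Uz₂) = val₂ X from (mapAlgHom_X _).symm, ← map_mul, ← map_one val₂,
    ← map_sub, ← show exi * ey = 1 - X * tm by rw [X_mul_tm, sub_sub_cancel]]
  congr 1
  linear_combination (-inRight (exi * ey)) * h1 - h2

/-- The logarithm of a group-like element is primitive, since the exponential is injective. -/
theorem dl_primitive {p : Cz} (hp : constantCoeff p = 0)
    (h : dl (zexp p) = val₂ (inLeft (zexp p) * inRight (zexp p))) :
    dl p = inLeft (val p) + inRight (val p) := by
  have hl := constantCoeff_inLeft (constantCoeff_val hp)
  have hr := constantCoeff_inRight (constantCoeff_val hp)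
  refine zexp_injective (constantCoeff_dl hp) (by rw [map_add, hl, hr, add_zero]) ?_
  rw [← dl_zexp hp, h, zexp_add hl hr (commute_inLeft_inRight _ _), map_mul, val₂_inLeft,
    val₂_inRight, val_zexp, inLeft, inRight, map_zexp, map_zexp]

theorem dl_cσm : dl cσm = inLeft (val cσm) + inRight (val cσm) :=
  dl_primitive constantCoeff_cσm (by rw [zexp_cσm_eq, dl_em])

theorem dl_em_inv : dl (ex * eyi) = val₂ (inLeft (ex * eyi) * inRight (ex * eyi)) := by
  have h := constantCoeff_val constantCoeff_cσm
  have hl := constantCoeff_inLeft h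
  have hr := constantCoeff_inRight h
  rw [← zexp_neg_cσm_eq, dl_zexp (by rw [map_neg, constantCoeff_cσm, neg_zero]), map_neg, dl_cσm,
    neg_add, zexp_add (by rw [map_neg, hl, neg_zero]) (by rw [map_neg, hr, neg_zero])
      ((commute_inLeft_inRight (val cσm) (val cσm)).neg_left.neg_right), map_mul, val₂_inLeft,
    val₂_inRight, val_zexp, inLeft, inRight, map_zexp, map_zexp, map_neg, map_neg, map_neg]

theorem cPz_two_eq : cPz 2 = tP 2 * (ex * eyi) := by rw [cPz_two, zexp_neg_cσm_eq]

theorem cPz_three_eq : cPz 3 = tP 3 * (ex * eyi) := by rw [cPz_three, zexp_neg_cσm_eq]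

theorem dl_cPz_two : dl (cPz 2) = val₂ (inLeft (cPz 2) * inRight eyi + inRight (cPz 2)) := by
  have h1 := inLeft_congr X_mul_tm
  rw [map_mul, inLeft_X, map_sub, map_one] at h1
  have hx := inRight_congr ex_mul_exi
  have hy := inRight_congr ey_mul_eyi
  have hx' := inLeft_congr ex_mul_exi
  have hy' := inLeft_congr ey_mul_eyi
  rw [cPz_two_eq, map_mul, dl_t2, dl_em_inv, ← map_mul, ← cPz_two_eq, ra, tP_two]
  congr 1
  simp only [map_mul, map_neg, inRight_X, map_one] at *
  grind

theorem dl_cPz_three : dl (cPz 3) = val₂ (inLeft (cPz 3) * inRight eyi + inRight (cPz 3)) := by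
  have h1 := inLeft_congr X_mul_tm
  rw [map_mul, inLeft_X, map_sub, map_one] at h1
  have hx := inRight_congr ex_mul_exi
  have hy := inRight_congr ey_mul_eyi
  have hx' := inLeft_congr ex_mul_exi
  have hy' := inLeft_congr ey_mul_eyi
  rw [cPz_three_eq, map_mul, dl_t3, dl_em_inv, ← map_mul, ← cPz_three_eq, ra, tP_three]
  congr 1
  simp only [map_mul, map_neg, inRight_X, map_one] at *
  grind

/-- `e^{σ₊} = 1 - 2 z T` is group-like: the quadratic term in `T` compensates for the quadratic
terms in the coproduct of `T₊`. -/
theorem dl_ep : dl (exi * eyi) = val₂ (inLeft (exi * eyi) * inRight (exi * eyi)) := by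
  have h1 := inLeft_congr X_mul_tm
  have h2 := inLeft_congr X_mul_tp
  have h3 := inRight_congr X_mul_tp
  have hx := inRight_congr ex_mul_exi
  have hy := inRight_congr ey_mul_eyi
  have hx' := inLeft_congr ex_mul_exi
  have hy' := inLeft_congr ey_mul_eyi
  have h0 : exi * eyi = 1 - X * tp - X ^ 2 * (exi * ey) * (cPz 2 ^ 2 + cPz 3 ^ 2) := by
    rw [X_mul_tp]; ring
  have hX : (X : Uz₂) = val₂ X := (mapAlgHom_X _).symm
  rw [h0, map_sub, map_sub, map_mul, map_mul, map_mul, map_pow, map_add, map_pow, map_pow, dl_X,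
    dl_em, dl_cPz_two, dl_cPz_three, dl_tp, map_one, ← map_one val₂, ← h0, hX]
  simp only [← map_mul, ← map_pow, ← map_add, ← map_sub]
  congr 1
  simp only [map_mul, map_add, map_sub, map_pow, map_neg, inRight_X, inLeft_X, map_one, ra, tP_two,
    tP_three, map_ofNat] at *
  generalize inLeft exi = a, inLeft ey = b, inRight exi = A, inRight ey = B,
    inRight eyi = B', inLeft (cPz 2) = p, inLeft (cPz 3) = q, inRight (cPz 2) = P,
    inRight (cPz 3) = Q at *
  linear_combination (-(A * B')) * h2 - X ^ 2 * B ^ 2 * (P ^ 2 + Q ^ 2) * A * B' * h1 - h3 +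
    X ^ 2 * A * (a * b * B * (P ^ 2 + Q ^ 2) - a * b * B' * (p ^ 2 + q ^ 2) -
      B * (P ^ 2 + Q ^ 2)) * hy

theorem dl_cσp : dl cσp = inLeft (val cσp) + inRight (val cσp) :=
  dl_primitive constantCoeff_cσp (by rw [zexp_cσp_eq, dl_ep])

theorem twComul_val_of_X_mul {p : Cz}
    (h : dl (X * p) = inLeft (val (X * p)) + inRight (val (X * p))) :
    twComul twist (val p) = val p ⊠ 1 + 1 ⊠ val p := by
  rw [map_mul, dl_X, map_mul, map_mul, map_mul, val_X, z, inLeft_X, inRight_X, ← mul_add] at h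
  rw [← dl_apply, ztmul_one, one_ztmul]
  exact X_mul_cancel h

/-- `P₀` is primitive. -/
theorem twComul_cPz_zero :
    twComul twist (val (cPz 0)) = val (cPz 0) ⊠ 1 + 1 ⊠ val (cPz 0) := by
  refine twComul_val_of_X_mul ?_
  rw [X_mul_cPz_zero, map_neg, map_smul, map_add, dl_cσm, dl_cσp]
  simp only [map_neg, map_smul, map_add]; module

/-- `P₁` is primitive. -/
theorem twComul_cPz_one :
    twComul twist (val (cPz 1)) = val (cPz 1) ⊠ 1 + 1 ⊠ val (cPz 1) := by
  refine twComul_val_of_X_mul ?_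
  rw [X_mul_cPz_one, map_neg, map_smul, map_sub, dl_cσm, dl_cσp]
  simp only [map_neg, map_smul, map_sub]; module

theorem twComul_cPz_two :
    twComul twist (val (cPz 2)) = val (cPz 2) ⊠ val eyi + 1 ⊠ val (cPz 2) := by
  rw [← dl_apply, dl_cPz_two, map_add, ← val_tmul_val, val₂_inRight, one_ztmul]

theorem twComul_cPz_three :
    twComul twist (val (cPz 3)) = val (cPz 3) ⊠ val eyi + 1 ⊠ val (cPz 3) := by
  rw [← dl_apply, dl_cPz_three, map_add, ← val_tmul_val, val₂_inRight, one_ztmul]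

end TranslationCoproduct

/-! ### The cocycle identity -/

section Cocycle

open PowerSeries (coeff constantCoeff X mapAlgHom)
open NullPlane

/-- The triple tensors `S ⊗ w`, with `w` in the tensor square of the translations. -/
def tt (S : Uz) (w : Cz₂) : PowerSeries (U42 ⊗[ℝ] (U42 ⊗[ℝ] U42)) := leg1 S * leg23 (val₂ w)

theorem tt_add (S : Uz) (w w' : Cz₂) : tt S (w + w') = tt S w + tt S w' := by
  rw [tt, map_add, map_add, mul_add]; rfl

theorem tt_mul (S S' : Uz) (w w' : Cz₂) : tt S w * tt S' w' = tt (S * S') (w * w') := by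
  rw [tt, tt, tt, map_mul, map_mul, map_mul, mul_assoc, ← mul_assoc (leg23 _),
    ← (commute_leg1_leg23 S' (val₂ w)).eq, mul_assoc, mul_assoc]

theorem commute_tt {S S' : Uz} (h : S * S' = S' * S) (w w' : Cz₂) :
    Commute (tt S w) (tt S' w') := by
  rw [Commute, SemiconjBy, tt_mul, tt_mul, h, mul_comm w]

theorem constantCoeff_tt (S : Uz) {w : Cz₂} (hw : constantCoeff w = 0) :
    constantCoeff (tt S w) = 0 := by
  rw [tt, map_mul, leg23, constantCoeff_mapAlgHom, val₂, constantCoeff_mapAlgHom, hw, map_zero,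
    map_zero, mul_zero]

theorem leg12_tmul_val (S : Uz) (p : Cz) : leg12 (S ⊠ val p) = tt S (inLeft p) := by
  rw [ztmul_def, map_mul, leg12_inLeft, leg12_inRight, tt, val₂_inLeft]

theorem leg13_tmul_val (S : Uz) (p : Cz) : leg13 (S ⊠ val p) = tt S (inRight p) := by
  rw [ztmul_def, map_mul, leg13_inLeft, leg13_inRight, tt, val₂_inRight]

theorem leg12_zexp_tmul_val (S : Uz) (p : Cz) :
    leg12 (zexp (S ⊠ val p)) = zexp (tt S (inLeft p)) := by
  rw [← leg12_tmul_val]; exact map_zexp _ _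

theorem leg13_zexp_tmul_val (S : Uz) (p : Cz) :
    leg13 (zexp (S ⊠ val p)) = zexp (tt S (inRight p)) := by
  rw [← leg13_tmul_val]; exact map_zexp _ _

theorem commute_leg13_leg23 (S S' : Uz) (p p' : Cz) :
    Commute (leg13 (S ⊠ val p)) (leg23 (S' ⊠ val p')) := by
  rw [leg13_tmul_val, tt, val₂_inRight, ztmul_def, map_mul]
  have h : Commute (leg23 (inRight (val p)) : PowerSeries (U42 ⊗[ℝ] (U42 ⊗[ℝ] U42)))
      (leg23 (inRight (val p'))) := ((commute_val p p').map inRight).map leg23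
  have h' : Commute (leg23 (inRight (val p)) : PowerSeries (U42 ⊗[ℝ] (U42 ⊗[ℝ] U42)))
      (leg23 (inLeft S')) := (commute_inLeft_inRight S' (val p)).symm.map leg23
  exact ((commute_leg1_leg23 _ _).mul_right (commute_leg1_leg23 _ _)).mul_left (h'.mul_right h)

/-- `Δ ⊗ id` on the exponential of a tensor with primitive first factor. -/
theorem zcomulLeft_zexp (x : SO42) {p : Cz} (hp : constantCoeff p = 0) :
    zcomulLeft (zexp (emb x ⊠ val p)) =
      leg13 (zexp (emb x ⊠ val p)) * leg23 (zexp (emb x ⊠ val p)) := by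
  have h : zcomulLeft (emb x ⊠ val p) = leg13 (emb x ⊠ val p) + leg23 (emb x ⊠ val p) := by
    rw [ztmul_def, map_mul, map_mul, map_mul, zcomulLeft_inLeft, zcomulLeft_inRight, zcomul_emb,
      map_one, ztmul_one, one_ztmul, map_add, leg12_inLeft, leg12_inRight, leg13_inLeft,
      leg13_inRight, add_mul]
  have h0 := constantCoeff_tmul_val (emb x) hp
  have hl : constantCoeff (leg13 (emb x ⊠ val p)) = 0 := by
    rw [leg13, constantCoeff_mapAlgHom, h0, map_zero]
  have hr : constantCoeff (leg23 (emb x ⊠ val p)) = 0 := by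
    rw [leg23, constantCoeff_mapAlgHom, h0, map_zero]
  calc zcomulLeft (zexp (emb x ⊠ val p)) = zexp (zcomulLeft (emb x ⊠ val p)) := map_zexp _ _
    _ = zexp (leg13 (emb x ⊠ val p)) * zexp (leg23 (emb x ⊠ val p)) := by
        rw [h, zexp_add hl hr (commute_leg13_leg23 _ _ _ _)]
    _ = _ := by rw [leg13, leg23, map_zexp, map_zexp]

theorem commute_leg13_leg23_zexp (S S' : Uz) {p p' : Cz} (hp : constantCoeff p = 0)
    (hp' : constantCoeff p' = 0) :
    leg13 (zexp (S ⊠ val p)) * leg23 (zexp (S' ⊠ val p')) =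
      leg23 (zexp (S' ⊠ val p')) * leg13 (zexp (S ⊠ val p)) := by
  have hl : constantCoeff (leg13 (S ⊠ val p)) = 0 := by
    rw [leg13, constantCoeff_mapAlgHom, constantCoeff_tmul_val S hp, map_zero]
  have hr : constantCoeff (leg23 (S' ⊠ val p')) = 0 := by
    rw [leg23, constantCoeff_mapAlgHom, constantCoeff_tmul_val S' hp', map_zero]
  rw [show leg13 (zexp (S ⊠ val p)) = zexp (leg13 (S ⊠ val p)) from map_zexp _ _,
    show leg23 (zexp (S' ⊠ val p')) = zexp (leg23 (S' ⊠ val p')) from map_zexp _ _]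
  exact (commute_zexp_zexp hl hr (commute_leg13_leg23 _ _ _ _)).eq

/-- `(Δ₀ ⊗ id)F = F₁₃ F₂₃`: the first legs of the exponents are primitive, and the second legs
commute. -/
theorem zcomulLeft_twist : zcomulLeft twist = leg13 twist * leg23 twist := by
  have c := @commute_leg13_leg23_zexp
  have h3 := zcomulLeft_zexp b3 (constantCoeff_ra 3)
  have h2 := zcomulLeft_zexp b2 (constantCoeff_ra 2)
  have h1 := zcomulLeft_zexp (boostK 0) constantCoeff_p1
  have h0 := zcomulLeft_zexp dil constantCoeff_p0
  have c20 := c (emb b2) (emb b3) (constantCoeff_ra 2) (constantCoeff_ra 3)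
  have c10 := c (emb (boostK 0)) (emb b3) constantCoeff_p1 (constantCoeff_ra 3)
  have c11 := c (emb (boostK 0)) (emb b2) constantCoeff_p1 (constantCoeff_ra 2)
  have c00 := c (emb dil) (emb b3) constantCoeff_p0 (constantCoeff_ra 3)
  have c01 := c (emb dil) (emb b2) constantCoeff_p0 (constantCoeff_ra 2)
  have c02 := c (emb dil) (emb (boostK 0)) constantCoeff_p0 constantCoeff_p1
  rw [← E3, ← E2] at c20
  rw [← EK, ← E3] at c10
  rw [← EK, ← E2] at c11
  rw [← ED, ← E3] at c00
  rw [← ED, ← E2] at c01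
  rw [← ED, ← EK] at c02
  rw [← E3] at h3
  rw [← E2] at h2
  rw [← EK] at h1
  rw [← ED] at h0
  rw [twist_eq]
  simp only [map_mul]
  rw [h3, h2, h1, h0]
  simp only [mul_assoc]
  rw [← mul_assoc (leg23 E3) (leg13 E2), ← c20, mul_assoc, ← mul_assoc (leg23 E2) (leg13 EK), ← c11,
    mul_assoc, ← mul_assoc (leg23 E3) (leg13 EK), ← c10, mul_assoc,
    ← mul_assoc (leg23 EK) (leg13 ED), ← c02, mul_assoc, ← mul_assoc (leg23 E2) (leg13 ED), ← c01,
    mul_assoc, ← mul_assoc (leg23 E3) (leg13 ED), ← c00, mul_assoc]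

/-- `F₂₃ (id ⊗ Δ)(S ⊗ p) F₂₃⁻¹ = S ⊗ Δ_F p`. -/
theorem conj_leg23_twist (S : Uz) {p : Cz} {w : Cz₂} (hp : constantCoeff p = 0)
    (hw : constantCoeff w = 0) (h : dl p = val₂ w) :
    Conj (leg23 twist) (zcomulRight (zexp (S ⊠ val p))) (zexp (tt S w)) := by
  have h0 : constantCoeff (zcomulRight (S ⊠ val p)) = 0 := by
    rw [zcomulRight, constantCoeff_mapAlgHom, constantCoeff_tmul_val S hp, map_zero]
  rw [show zcomulRight (zexp (S ⊠ val p)) = zexp (zcomulRight (S ⊠ val p)) from map_zexp _ _]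
  refine Conj.zexp ?_ h0 (constantCoeff_tt S hw)
  have h1 := (twComul_eq_iff isUnit_twist).1 ((dl_apply p).symm.trans h)
  rw [Conj, ztmul_def, map_mul, zcomulRight_inLeft, zcomulRight_inRight, tt, mul_assoc, ← map_mul,
    ← h1, map_mul, ← mul_assoc, ← mul_assoc, (commute_leg1_leg23 S twist).eq]

theorem Conj.mul {R : Type*} [Ring R] {F x y x' y' : R} (h : Conj F x y) (h' : Conj F x' y') :
    Conj F (x * x') (y * y') := by
  rw [Conj, ← mul_assoc, h, mul_assoc, h', mul_assoc]

theorem dl_X_mul_cPz_zero : dl (X * cPz 0) = val₂ (inLeft (X * cPz 0) + inRight (X * cPz 0)) := by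
  rw [map_mul, dl_X, dl_apply, twComul_cPz_zero, ztmul_one, one_ztmul, map_add, val₂_inLeft,
    val₂_inRight, map_mul val, map_mul inLeft, map_mul inRight, val_X, z, inLeft_X,
    inRight_X, mul_add]

theorem dl_X_mul_cPz_one : dl (X * cPz 1) = val₂ (inLeft (X * cPz 1) + inRight (X * cPz 1)) := by
  rw [map_mul, dl_X, dl_apply, twComul_cPz_one, ztmul_one, one_ztmul, map_add, val₂_inLeft,
    val₂_inRight, map_mul val, map_mul inLeft, map_mul inRight, val_X, z, inLeft_X,
    inRight_X, mul_add]

theorem dl_p0 : dl p0 = val₂ (inLeft p0 + inRight p0) := by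
  rw [p0, map_neg, dl_X_mul_cPz_zero, ← map_neg]; congr 1; rw [map_neg, map_neg, neg_add]

theorem dl_p1 : dl p1 = val₂ (inLeft p1 + inRight p1) := by
  rw [p1, map_neg, dl_X_mul_cPz_one, ← map_neg]; congr 1; rw [map_neg, map_neg, neg_add]

theorem dl_ey : dl ey = val₂ (inLeft ey * inRight ey) := by
  have h0 : constantCoeff (X * cPz 1) = 0 := constantCoeff_X_mul _
  rw [ey, dl_zexp h0, dl_X_mul_cPz_one, val₂, ← map_zexp,
    zexp_add (constantCoeff_inLeft h0) (constantCoeff_inRight h0) (Commute.all _ _), inLeft,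
    inRight, map_zexp, map_zexp]

/-- The twisted coproduct of `-z e^{z P₁} Pₐ`, from that of `Pₐ`. -/
theorem dl_ra_of {μ : Fin 4}
    (h : dl (cPz μ) = val₂ (inLeft (cPz μ) * inRight eyi + inRight (cPz μ))) :
    dl (ra μ) = val₂ (inLeft (ra μ) + inLeft ey * inRight (ra μ)) := by
  have hy := inRight_congr ey_mul_eyi
  rw [map_mul, map_one] at hy
  rw [ra, map_neg, map_mul, map_mul, dl_X, dl_ey, h,
    show (X : Uz₂) = val₂ X from (mapAlgHom_X _).symm, ← map_mul, ← map_mul, ← map_neg]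
  congr 1
  simp only [map_neg, map_mul, inLeft_X, inRight_X]
  linear_combination (-X * inLeft ey * inLeft (cPz μ)) * hy

/-- For `b` of weight `-1` under `K₁` and `0` under `D`, conjugation by the `12`-copy of
`exp(-z K₁ ⊗ P₁) exp(-z D ⊗ P₀)` multiplies `b ⊗ 1 ⊗ p` by `1 ⊗ e^{z P₁} ⊗ 1`. -/
theorem conj_leg12_EK_ED {b : Uz} (h : emb dil * b = b * emb dil)
    (h' : emb (boostK 0) * b = b * emb (boostK 0) + (-1 : ℝ) • b) {p : Cz}
    (hp : constantCoeff p = 0) :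
    Conj (leg12 (EK * ED)) (zexp (tt b (inRight p))) (zexp (tt b (inLeft ey * inRight p))) := by
  have hr := constantCoeff_inRight hp
  refine Conj.zexp ?_ (constantCoeff_tt b hr) (constantCoeff_tt b (by
    rw [map_mul, hr, mul_zero]))
  have h1 : Conj (EK * ED) (b ⊠ val 1) (b ⊠ val (1 * ey)) :=
    (conj_EK_of_neg h' 1).comp (conj_ED_of h 1)
  have h2 : ∀ q : Cz, tt b (inLeft q * inRight p) =
      leg12 (b ⊠ val q) * leg23 (inRight (val p)) := fun q => by
    rw [leg12_tmul_val, tt, tt, map_mul, map_mul, val₂_inRight, mul_assoc]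
  have h3 : ∀ (S : Uz) (q : Cz), Commute (leg12 (S ⊠ val q)) (leg23 (inRight (val p))) := by
    intro S q
    rw [leg12_tmul_val, tt, val₂_inLeft]
    exact (commute_leg1_leg23 _ _).mul_left ((commute_inLeft_inRight _ _).map leg23)
  have h4 : ∀ (S : Uz) {q : Cz}, constantCoeff q = 0 →
      Commute (leg12 (zexp (S ⊠ val q))) (leg23 (inRight (val p))) := by
    intro S q hq
    rw [show leg12 (zexp (S ⊠ val q)) = zexp (leg12 (S ⊠ val q)) from map_zexp _ _]
    exact (commute_zexp_right (by
      rw [leg12, constantCoeff_mapAlgHom, constantCoeff_tmul_val S hq, map_zero])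
      (h3 S q).symm).symm
  have h5 : Commute (leg12 (EK * ED)) (leg23 (inRight (val p))) := by
    rw [map_mul]
    exact (h4 _ constantCoeff_p1).mul_left (h4 _ constantCoeff_p0)
  have h6 : tt b (inRight p) = tt b (inLeft 1 * inRight p) := by rw [map_one, one_mul]
  rw [h6, h2, h2]
  refine Conj.mul ?_ h5.eq
  rw [Conj, ← map_mul, h1, one_mul, map_mul]

theorem zexp_tt_add {S S' : Uz} (h : S * S' = S' * S) {w w' : Cz₂} (hw : constantCoeff w = 0)
    (hw' : constantCoeff w' = 0) : zexp (tt S w + tt S' w') = zexp (tt S w) * zexp (tt S' w') :=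
  zexp_add (constantCoeff_tt S hw) (constantCoeff_tt S' hw') (commute_tt h _ _)

theorem commute_zexp_tt {S S' : Uz} (h : S * S' = S' * S) {w w' : Cz₂} (hw : constantCoeff w = 0)
    (hw' : constantCoeff w' = 0) :
    zexp (tt S w) * zexp (tt S' w') = zexp (tt S' w') * zexp (tt S w) :=
  (commute_zexp_zexp (constantCoeff_tt S hw) (constantCoeff_tt S' hw') (commute_tt h _ _)).eq

/-- Since `(Δ₀ ⊗ id)F = F₁₃ F₂₃`, the cocycle identity amounts to `F₂₃ (id ⊗ Δ₀)F F₂₃⁻¹ = F₁₂ F₁₃`.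
The left-hand side has the twisted coproducts of the translations in its exponents, and comparing
the two sides is a rearrangement of exponentials. -/
theorem twist_cocycle : leg12 twist * zcomulLeft twist = leg23 twist * zcomulRight twist := by
  obtain ⟨hD2, hD3, -, -, hK2, hK3, -, -, -, hb, -⟩ := emb_null_relations
  have cl : ∀ {p : Cz}, constantCoeff p = 0 → constantCoeff (inLeft p) = 0 := constantCoeff_inLeft
  have cr : ∀ {p : Cz}, constantCoeff p = 0 → constantCoeff (inRight p) = 0 := constantCoeff_inRight
  have cm : ∀ (q : Cz) {p : Cz}, constantCoeff p = 0 →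
      constantCoeff (inLeft q * inRight p) = 0 := fun q p hp => by
    rw [map_mul, cr hp, mul_zero]
  have r3 := constantCoeff_ra 3
  have r2 := constantCoeff_ra 2
  have g3 := conj_leg23_twist (emb b3) r3 (by rw [map_add, cl r3, cm _ r3, add_zero])
    (dl_ra_of dl_cPz_three)
  have g2 := conj_leg23_twist (emb b2) r2 (by rw [map_add, cl r2, cm _ r2, add_zero])
    (dl_ra_of dl_cPz_two)
  have g1 := conj_leg23_twist (emb (boostK 0)) constantCoeff_p1
    (by rw [map_add, cl constantCoeff_p1, cr constantCoeff_p1, add_zero]) dl_p1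
  have g0 := conj_leg23_twist (emb dil) constantCoeff_p0
    (by rw [map_add, cl constantCoeff_p0, cr constantCoeff_p0, add_zero]) dl_p0
  rw [tt_add, zexp_tt_add rfl (cl r3) (cm _ r3)] at g3
  rw [tt_add, zexp_tt_add rfl (cl r2) (cm _ r2)] at g2
  rw [tt_add, zexp_tt_add rfl (cl constantCoeff_p1) (cr constantCoeff_p1)] at g1
  rw [tt_add, zexp_tt_add rfl (cl constantCoeff_p0) (cr constantCoeff_p0)] at g0
  have k3 : leg12 (EK * ED) * zexp (tt (emb b3) (inRight (ra 3))) = _ * _ :=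
    conj_leg12_EK_ED hD3 hK3 r3
  have k2 : leg12 (EK * ED) * zexp (tt (emb b2) (inRight (ra 2))) = _ * _ :=
    conj_leg12_EK_ED hD2 hK2 r2
  have e1 : zexp (tt (emb b2) (inLeft (ra 2))) * zexp (tt (emb b3) (inLeft ey * inRight (ra 3))) =
      _ * _ := commute_zexp_tt hb (cl r2) (cm _ r3)
  have e2 : zexp (tt (emb dil) (inLeft p0)) * zexp (tt (emb (boostK 0)) (inRight p1)) = _ * _ :=
    commute_zexp_tt emb_dil_mul_boostK (cl constantCoeff_p0) (cr constantCoeff_p1)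
  have hz : zcomulRight twist = zcomulRight (zexp (emb b3 ⊠ val (ra 3))) *
      zcomulRight (zexp (emb b2 ⊠ val (ra 2))) * zcomulRight (zexp (emb (boostK 0) ⊠ val p1)) *
      zcomulRight (zexp (emb dil ⊠ val p0)) := by
    rw [twist_eq, map_mul, map_mul, map_mul]; rfl
  have hG : Conj _ _ _ := ((g3.mul g2).mul g1).mul g0
  rw [← hz] at hG
  have h12 : leg12 twist = zexp (tt (emb b3) (inLeft (ra 3))) *
      zexp (tt (emb b2) (inLeft (ra 2))) * leg12 (EK * ED) := by
    rw [twist_eq, mul_assoc _ EK ED, map_mul, map_mul, ← leg12_zexp_tmul_val,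
      ← leg12_zexp_tmul_val]; rfl
  have hM : leg12 (EK * ED) =
      zexp (tt (emb (boostK 0)) (inLeft p1)) * zexp (tt (emb dil) (inLeft p0)) := by
    rw [map_mul, ← leg12_zexp_tmul_val, ← leg12_zexp_tmul_val]; rfl
  have h13 : leg13 twist = zexp (tt (emb b3) (inRight (ra 3))) *
      zexp (tt (emb b2) (inRight (ra 2))) * zexp (tt (emb (boostK 0)) (inRight p1)) *
      zexp (tt (emb dil) (inRight p0)) := by
    rw [twist_eq, map_mul, map_mul, map_mul, ← leg13_zexp_tmul_val, ← leg13_zexp_tmul_val,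
      ← leg13_zexp_tmul_val, ← leg13_zexp_tmul_val]; rfl
  rw [hG, zcomulLeft_twist, ← mul_assoc, h12, h13]
  congr 1
  have assoc : ∀ {a b c d : PowerSeries (U42 ⊗[ℝ] (U42 ⊗[ℝ] U42))}, a * b = c * d →
      ∀ t, a * (b * t) = c * (d * t) := fun {a b c d} h t => by
    rw [← mul_assoc, h, mul_assoc]
  simp only [mul_assoc]
  -- move the `13`-exponentials of `F₁₃` to the left, through the Cartan factors of `F₁₂`
  rw [assoc k3, assoc k2, hM, assoc e1, mul_assoc (zexp (tt (emb (boostK 0)) (inLeft p1))),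
    assoc e2]

/-! ### The counit axioms -/

theorem zcounit_emb (x : SO42) : zcounit (emb x) = 0 := by
  rw [zcounit, emb, mapAlgHom_C]
  rw [show ((Algebra.ofId ℝ U42).comp (Bialgebra.counitAlgHom ℝ U42)) (toU x) = 0 by
    rw [AlgHom.comp_apply, show Bialgebra.counitAlgHom ℝ U42 (toU x) = 0 from envCounit_ι x,
      map_zero], map_zero]

theorem zcounit_zlog (f : Uz) : zcounit (zlog f) = zlog (zcounit f) := map_zlog _ f

theorem zcounit_tP (μ : Fin 4) : zcounit (val (tP μ)) = 0 := by rw [val_tP, zcounit_emb]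

theorem zcounit_cσm : zcounit (val cσm) = 0 := by
  rw [cσm, val_zlog, zcounit_zlog, cTm]
  simp only [map_neg, map_smul, map_mul, map_sub, zcounit_tP, sub_zero, smul_zero, mul_zero,
    neg_zero, zlog_zero]

theorem zcounit_cσp : zcounit (val cσp) = 0 := by
  rw [cσp, val_zlog, zcounit_zlog, cT, cTp, cT2, cT3]
  simp only [map_neg, map_smul, map_mul, map_sub, map_add, map_pow, zcounit_tP, sub_zero, add_zero,
    smul_zero, mul_zero, zero_mul, neg_zero, zlog_zero, ne_eq, OfNat.ofNat_ne_zero,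
    not_false_eq_true, zero_pow]

theorem zcounit_p0 : zcounit (val p0) = 0 := by
  rw [p0, X_mul_cPz_zero, neg_neg]
  simp only [map_smul, map_add, zcounit_cσm, zcounit_cσp, add_zero, smul_zero]

theorem zcounit_p1 : zcounit (val p1) = 0 := by
  rw [p1, X_mul_cPz_one, neg_neg]
  simp only [map_smul, map_sub, zcounit_cσm, zcounit_cσp, sub_zero, smul_zero]

theorem zcounit_ra {μ : Fin 4} (h : zcounit (val (cPz μ)) = 0) : zcounit (val (ra μ)) = 0 := by
  rw [ra]; simp only [map_neg, map_mul, h, mul_zero, neg_zero]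

theorem zcounit_cPz_two : zcounit (val (cPz 2)) = 0 := by
  rw [cPz_two, map_mul, map_mul, zcounit_tP, zero_mul]

theorem zcounit_cPz_three : zcounit (val (cPz 3)) = 0 := by
  rw [cPz_three, map_mul, map_mul, zcounit_tP, zero_mul]

theorem zcounitLeft_zexp (x : SO42) (p : Cz) : zcounitLeft (zexp (emb x ⊠ val p)) = 1 := by
  rw [show zcounitLeft (zexp (emb x ⊠ val p)) = zexp (zcounitLeft (emb x ⊠ val p)) from
    map_zexp _ _, ztmul_def, map_mul, zcounitLeft_inLeft, zcounit_emb, zero_mul, zexp_zero]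

theorem zcounitRight_zexp (x : SO42) {p : Cz} (hp : zcounit (val p) = 0) :
    zcounitRight (zexp (emb x ⊠ val p)) = 1 := by
  rw [show zcounitRight (zexp (emb x ⊠ val p)) = zexp (zcounitRight (emb x ⊠ val p)) from
    map_zexp _ _, ztmul_def, map_mul, zcounitRight_inRight, hp, mul_zero, zexp_zero]

theorem isTwist_twist : IsTwist twist where
  isUnit := isUnit_twist
  counit_left := by
    rw [twist_eq, map_mul, map_mul, map_mul, E3, E2, EK, ED]
    simp only [zcounitLeft_zexp, mul_one]
  counit_right := by
    rw [twist_eq, map_mul, map_mul, map_mul, E3, E2, EK, ED,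
      zcounitRight_zexp _ (zcounit_ra zcounit_cPz_three),
      zcounitRight_zexp _ (zcounit_ra zcounit_cPz_two), zcounitRight_zexp _ zcounit_p0,
      zcounitRight_zexp _ zcounit_p1]
    simp only [mul_one]
  cocycle := twist_cocycle

theorem coeff_zero_twist : coeff 0 twist = 1 := by
  rw [PowerSeries.coeff_zero_eq_constantCoeff_apply, twist_eq, map_mul, map_mul, map_mul, E3, E2,
    EK, ED]
  simp only [constantCoeff_zexp, mul_one]

/-- The enveloping algebra is cocommutative. -/
theorem comm_comul (a : U42) :
    Algebra.TensorProduct.comm ℝ U42 U42 (Bialgebra.comulAlgHom ℝ U42 a) =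
      Bialgebra.comulAlgHom ℝ U42 a := by
  have h : ((Algebra.TensorProduct.comm ℝ U42 U42).toAlgHom.comp (envComul (R := ℝ) (L := SO42))) =
      envComul := by
    refine env_hom_ext fun x => ?_
    rw [AlgHom.comp_apply, envComul_ι, map_add]
    exact add_comm _ _
  exact DFunLike.congr_fun h a

end Cocycle

/-! ### The Hopf subalgebra of the Weyl–Poincaré algebra -/

section Subalgebra

open PowerSeries (coeff constantCoeff X mapAlgHom)
open NullPlane

/-- `U(𝒲𝒫)`. -/
abbrev UWP : Type := UniversalEnvelopingAlgebra ℝ weylPoincare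

theorem weylPoincareToU_ι (x : weylPoincare) :
    weylPoincareToU (UniversalEnvelopingAlgebra.ι ℝ x) = toU x := by
  rw [weylPoincareToU, UniversalEnvelopingAlgebra.lift_ι_apply]; rfl

theorem weylPoincareToU_comul (u : UWP) :
    Bialgebra.comulAlgHom ℝ U42 (weylPoincareToU u) =
      Algebra.TensorProduct.map weylPoincareToU weylPoincareToU
        (Bialgebra.comulAlgHom ℝ UWP u) := by
  have h : (envComul (R := ℝ) (L := SO42)).comp weylPoincareToU =
      (Algebra.TensorProduct.map weylPoincareToU weylPoincareToU).comp
        (envComul (R := ℝ) (L := weylPoincare)) := by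
    refine env_hom_ext fun x => ?_
    rw [AlgHom.comp_apply, AlgHom.comp_apply, weylPoincareToU_ι, envComul_ι, toU, envComul_ι,
      map_add, Algebra.TensorProduct.map_tmul, Algebra.TensorProduct.map_tmul, map_one,
      weylPoincareToU_ι, toU]
  exact DFunLike.congr_fun h u

theorem weylPoincareToU_antipode (u : UWP) :
    HopfAlgebra.antipode ℝ (weylPoincareToU u) = weylPoincareToU (HopfAlgebra.antipode ℝ u) := by
  change envAntipode (R := ℝ) (weylPoincareToU u) = weylPoincareToU (envAntipode (R := ℝ) u)
  induction u using env_induction (R := ℝ) with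
  | hr r => rw [AlgHom.commutes, envAntipode_algebraMap, envAntipode_algebraMap, AlgHom.commutes]
  | hx x =>
    rw [weylPoincareToU_ι, envAntipode_ι, toU, envAntipode_ι, map_neg, weylPoincareToU_ι, toU]
  | hadd a b ha hb => simp only [map_add, ha, hb]
  | hmul a b ha hb => rw [map_mul, envAntipode_mul, envAntipode_mul, map_mul, ha, hb]

/-- The inclusion `U(𝒲𝒫)[[z]] → U_z(so(4,2))`. -/
def wp : PowerSeries UWP →ₐ[ℝ] Uz := mapAlgHom weylPoincareToU

/-- The inclusion of the completed tensor square of `U(𝒲𝒫)[[z]]`. -/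
def wp₂ : PowerSeries (UWP ⊗[ℝ] UWP) →ₐ[ℝ] Uz₂ :=
  mapAlgHom (Algebra.TensorProduct.map weylPoincareToU weylPoincareToU)

theorem mem_UzWP {f : Uz} : f ∈ UzWP ↔ ∃ f', wp f' = f := Iff.rfl

theorem mem_UzWP₂ {f : Uz₂} : f ∈ UzWP₂ ↔ ∃ f', wp₂ f' = f := Iff.rfl

theorem wp₂_inLeft (f : PowerSeries UWP) : wp₂ (inLeft f) = inLeft (wp f) := by
  rw [wp₂, inLeft, inLeft, wp, mapAlgHom_mapAlgHom, mapAlgHom_mapAlgHom]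
  exact mapAlgHom_congr (fun a => by simp) f

theorem wp₂_inRight (f : PowerSeries UWP) : wp₂ (inRight f) = inRight (wp f) := by
  rw [wp₂, inRight, inRight, wp, mapAlgHom_mapAlgHom, mapAlgHom_mapAlgHom]
  exact mapAlgHom_congr (fun a => by simp) f

theorem wp₂_ztmul (f g : PowerSeries UWP) : wp₂ (f ⊠ g) = wp f ⊠ wp g := by
  rw [ztmul_def, map_mul, wp₂_inLeft, wp₂_inRight]; rfl

theorem wp₂_zcomul (f : PowerSeries UWP) : zcomul (wp f) = wp₂ (zcomul f) := by
  rw [wp₂, wp, zcomul, zcomul, mapAlgHom_mapAlgHom, mapAlgHom_mapAlgHom]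
  exact mapAlgHom_congr weylPoincareToU_comul f

theorem wp₂_zflip (f : PowerSeries (UWP ⊗[ℝ] UWP)) : zflip (wp₂ f) = wp₂ (zflip f) := by
  rw [wp₂, zflip, zflip, mapAlgHom_mapAlgHom, mapAlgHom_mapAlgHom]
  refine mapAlgHom_congr (fun x => ?_) f
  induction x with
  | zero => rw [map_zero, map_zero]
  | tmul a b => rfl
  | add x y hx hy => rw [map_add, map_add, hx, hy]

theorem wp_inverse {f : PowerSeries UWP} (h : IsUnit f) :
    wp (Ring.inverse f) = Ring.inverse (wp f) := map_ringInverse wp.toRingHom h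

theorem wp₂_inverse {F : PowerSeries (UWP ⊗[ℝ] UWP)} (h : IsUnit F) :
    wp₂ (Ring.inverse F) = Ring.inverse (wp₂ F) := map_ringInverse wp₂.toRingHom h

theorem wp_antipode (f : PowerSeries UWP) :
    mapCoeff (HopfAlgebra.antipode ℝ) (wp f) = wp (mapCoeff (HopfAlgebra.antipode ℝ) f) := by
  ext n
  rw [coeff_mapCoeff, wp, coeff_mapAlgHom, coeff_mapAlgHom, coeff_mapCoeff,
    weylPoincareToU_antipode]

theorem wp_twElt (F : PowerSeries (UWP ⊗[ℝ] UWP)) : twElt (wp₂ F) = wp (twElt F) := by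
  ext n
  rw [twElt, twElt, coeff_mapCoeff, wp, wp₂, coeff_mapAlgHom, coeff_mapAlgHom, coeff_mapCoeff]
  induction coeff n F with
  | zero => simp
  | tmul a b =>
    rw [Algebra.TensorProduct.map_tmul, LinearMap.comp_apply, LinearMap.comp_apply,
      LinearMap.lTensor_tmul, LinearMap.lTensor_tmul, LinearMap.mul'_apply, LinearMap.mul'_apply,
      weylPoincareToU_antipode, map_mul]
  | add x y hx hy => simp only [map_add, hx, hy]

theorem emb_mem {x : SO42} (hx : x ∈ weylPoincare) :
    wp (PowerSeries.C (UniversalEnvelopingAlgebra.ι ℝ (⟨x, hx⟩ : weylPoincare))) = emb x := by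
  rw [wp, mapAlgHom_C, weylPoincareToU_ι, emb]

theorem rotJ_mem (i : Fin 3) : rotJ i ∈ weylPoincare :=
  LieSubalgebra.subset_lieSpan (Or.inl (Or.inl (Or.inl ⟨i, rfl⟩)))

theorem boostK_mem (i : Fin 3) : boostK i ∈ weylPoincare :=
  LieSubalgebra.subset_lieSpan (Or.inl (Or.inl (Or.inr ⟨i, rfl⟩)))

theorem transP_mem (μ : Fin 4) : transP μ ∈ weylPoincare :=
  LieSubalgebra.subset_lieSpan (Or.inl (Or.inr ⟨μ, rfl⟩))

theorem dil_mem : dil ∈ weylPoincare := LieSubalgebra.subset_lieSpan (Or.inr rfl)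

/-- The series in the translations belong to `U_z(𝒲𝒫)`. -/
theorem val_mem (p : Cz) : val p ∈ UzWP := by
  have h : transSubalgebra ≤ weylPoincareToU.range := by
    refine Algebra.adjoin_le ?_
    rintro _ ⟨μ, rfl⟩
    exact ⟨_, weylPoincareToU_ι ⟨transP μ, transP_mem μ⟩⟩
  refine mem_UzWP.2 ⟨PowerSeries.mk fun n => (h (coeff n p).2).choose, ?_⟩
  ext n
  rw [wp, coeff_mapAlgHom, PowerSeries.coeff_mk, val, coeff_mapAlgHom]
  exact (h (coeff n p).2).choose_spec

theorem exists_wp_val (p : Cz) (hp : constantCoeff p = 0) :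
    ∃ f, wp f = val p ∧ constantCoeff f = 0 := by
  obtain ⟨f, hf⟩ := mem_UzWP.1 (val_mem (zdiv p))
  refine ⟨X * f, ?_, by simp⟩
  rw [map_mul, hf, wp, mapAlgHom_X, ← X_mul_zdiv p hp, map_mul, val_X, X_mul_zdiv p hp, z]

/-- An element of the image of `(U(𝒲𝒫) ⊗ U(𝒲𝒫))[[z]]` with a preimage `1 + O(z)`. Such a preimage is
invertible, so that the inverse of the element lies in the image as well; injectivity of
`U(𝒲𝒫) → U(so(4,2))` is not needed. -/
def IsUnipotent (F : Uz₂) : Prop := ∃ F', wp₂ F' = F ∧ coeff 0 F' = 1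

theorem IsUnipotent.mul {F G : Uz₂} (hF : IsUnipotent F) (hG : IsUnipotent G) :
    IsUnipotent (F * G) := by
  obtain ⟨F', rfl, h1⟩ := hF
  obtain ⟨G', rfl, h2⟩ := hG
  refine ⟨F' * G', map_mul _ _ _, ?_⟩
  rw [PowerSeries.coeff_zero_eq_constantCoeff_apply] at *
  rw [map_mul, h1, h2, mul_one]

theorem isUnipotent_zexp {x : SO42} (hx : x ∈ weylPoincare) {p : Cz} (hp : constantCoeff p = 0) :
    IsUnipotent (zexp (emb x ⊠ val p)) := by
  obtain ⟨f, hf, -⟩ := exists_wp_val p hp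
  refine ⟨zexp (PowerSeries.C (UniversalEnvelopingAlgebra.ι ℝ (⟨x, hx⟩ : weylPoincare)) ⊠ f),
    ?_, ?_⟩
  · rw [← hf, ← emb_mem hx, ← wp₂_ztmul]; exact map_zexp _ _
  · rw [PowerSeries.coeff_zero_eq_constantCoeff_apply, constantCoeff_zexp]

theorem isUnipotent_twist : IsUnipotent twist := by
  rw [twist_eq]
  exact (((isUnipotent_zexp (sub_mem (boostK_mem 2) (rotJ_mem 1)) (constantCoeff_ra 3)).mul
    (isUnipotent_zexp (add_mem (boostK_mem 1) (rotJ_mem 2)) (constantCoeff_ra 2))).mul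
    (isUnipotent_zexp (boostK_mem 0) constantCoeff_p1)).mul
    (isUnipotent_zexp dil_mem constantCoeff_p0)

theorem twist_mem : twist ∈ UzWP₂ := by
  obtain ⟨F, hF, -⟩ := isUnipotent_twist
  exact ⟨F, hF⟩

theorem twComul_mem {f : Uz} (hf : f ∈ UzWP) : twComul twist f ∈ UzWP₂ := by
  obtain ⟨F, hF, h0⟩ := isUnipotent_twist
  obtain ⟨f, rfl⟩ := mem_UzWP.1 hf
  refine mem_UzWP₂.2 ⟨twComul F f, ?_⟩
  rw [twComul, twComul, map_mul, map_mul, ← wp₂_zcomul,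
    wp₂_inverse (isUnit_of_coeff_zero_eq_one h0), hF]

theorem twAntipode_mem {f : Uz} (hf : f ∈ UzWP) : twAntipode twist f ∈ UzWP := by
  obtain ⟨F, hF, h0⟩ := isUnipotent_twist
  obtain ⟨f, rfl⟩ := mem_UzWP.1 hf
  refine mem_UzWP.2 ⟨twAntipode F f, ?_⟩
  rw [twAntipode, twAntipode, map_mul, map_mul, ← wp_antipode,
    wp_inverse (isUnit_of_coeff_zero_eq_one (twElt_coeff_zero h0)), ← wp_twElt, hF]

theorem rMatrix_mem : zflip twist * Ring.inverse twist ∈ UzWP₂ := by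
  obtain ⟨F, hF, h0⟩ := isUnipotent_twist
  refine mem_UzWP₂.2 ⟨zflip F * Ring.inverse F, ?_⟩
  rw [map_mul, ← wp₂_zflip, wp₂_inverse (isUnit_of_coeff_zero_eq_one h0), hF]

end Subalgebra

/-! ### The change of basis at `z = 0`, and `z`-adic generation -/

section Generation

open PowerSeries (coeff constantCoeff X mapAlgHom)
open NullPlane

theorem emb_A2 : A2 = (1 / 2 : ℝ) • (emb a2 - emb a3) := by
  rw [A2, ← emb_sub, ← emb_smul, a2, a3]; congr 1; module

theorem emb_A3 : A3 = (1 / 2 : ℝ) • (emb a2 + emb a3) := by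
  rw [A3, ← emb_add, ← emb_smul, a2, a3]; congr 1; module

theorem Dz_eq : Dz = emb dil := by rw [Dz, emb_Hp, emb_Hm]; module

theorem Kz_eq (i : Fin 3) : Kz i = emb (boostK i) := by
  fin_cases i
  · change Hp - Hm = emb (boostK 0)
    rw [emb_Hp, emb_Hm]; module
  · change (1 / 2 : ℝ) • (A3 + A2 + B3 + B2) = emb (boostK 1)
    rw [emb_A3, emb_A2, emb_B3, emb_B2, emb_a2, emb_a3, emb_b2, emb_b3]; module
  · change (1 / 2 : ℝ) • (A3 - A2 + B3 - B2) = emb (boostK 2)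
    rw [emb_A3, emb_A2, emb_B3, emb_B2, emb_a2, emb_a3, emb_b2, emb_b3]; module

theorem Jz_eq (i : Fin 3) : Jz i = emb (rotJ i) := by
  fin_cases i
  · rfl
  · change (1 / 2 : ℝ) • (A3 - A2 - B3 + B2) = emb (rotJ 1)
    rw [emb_A3, emb_A2, emb_B3, emb_B2, emb_a2, emb_a3, emb_b2, emb_b3]; module
  · change -((1 / 2 : ℝ) • (A3 + A2 - B3 - B2)) = emb (rotJ 2)
    rw [emb_A3, emb_A2, emb_B3, emb_B2, emb_a2, emb_a3, emb_b2, emb_b3]; module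

theorem coeff_one_zlog {A : Type*} [Ring A] [Algebra ℝ A] (f : PowerSeries A) :
    coeff 1 (zlog f) = coeff 1 f := by
  rw [zlog, PowerSeries.coeff_mk]; simp

theorem coeff_one_zexp {A : Type*} [Ring A] [Algebra ℝ A] (f : PowerSeries A) :
    coeff 1 (zexp f) = coeff 1 f := by
  rw [zexp, PowerSeries.coeff_mk, Finset.sum_range_succ, Finset.sum_range_succ]
  simp [PowerSeries.coeff_one]

theorem coeff_one_X_mul {A : Type*} [Ring A] [Algebra ℝ A] (f : PowerSeries A) :
    coeff 1 (X * f) = constantCoeff f := by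
  rw [← PowerSeries.coeff_zero_eq_constantCoeff_apply]; exact PowerSeries.coeff_succ_X_mul 0 f

theorem coeff_one_cσm : coeff 1 cσm = constantCoeff (tP 1) - constantCoeff (tP 0) := by
  rw [cσm, coeff_one_zlog, map_neg, PowerSeries.coeff_smul, coeff_one_X_mul, cTm,
    PowerSeries.constantCoeff_smul, map_sub]
  module

theorem coeff_one_cσp : coeff 1 cσp = -(constantCoeff (tP 1) + constantCoeff (tP 0)) := by
  rw [cσp, coeff_one_zlog, map_neg, PowerSeries.coeff_smul, coeff_one_X_mul, cT, map_add, map_mul,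
    map_mul, PowerSeries.constantCoeff_X, zero_mul, zero_mul, add_zero, cTp,
    PowerSeries.constantCoeff_smul, map_add]
  module

theorem constantCoeff_cPz (μ : Fin 4) : constantCoeff (cPz μ) = constantCoeff (tP μ) := by
  have h : ∀ {p q : Cz}, X * p = -((1 / 2 : ℝ) • q) →
      constantCoeff p = -((1 / 2 : ℝ) • coeff 1 q) := fun {p q} hpq => by
    rw [← coeff_one_X_mul, hpq, map_neg, PowerSeries.coeff_smul]
  fin_cases μ
  · change constantCoeff (cPz 0) = constantCoeff (tP 0)
    rw [h X_mul_cPz_zero, map_add, coeff_one_cσm, coeff_one_cσp]; module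
  · change constantCoeff (cPz 1) = constantCoeff (tP 1)
    rw [h X_mul_cPz_one, map_sub, coeff_one_cσm, coeff_one_cσp]; module
  · change constantCoeff (cPz 2) = constantCoeff (tP 2)
    rw [cPz_two, map_mul, constantCoeff_zexp, mul_one]
  · change constantCoeff (cPz 3) = constantCoeff (tP 3)
    rw [cPz_three, map_mul, constantCoeff_zexp, mul_one]

theorem constantCoeff_val_cPz (μ : Fin 4) :
    constantCoeff (val (cPz μ)) = toU (transP μ) := by
  have h : constantCoeff (val (tP μ)) = toU (transP μ) := by
    rw [val_tP, emb]; exact PowerSeries.constantCoeff_C _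
  rw [← h, val, constantCoeff_mapAlgHom, constantCoeff_cPz, constantCoeff_mapAlgHom]

theorem constantCoeff_Pz (μ : Fin 4) : constantCoeff (Pz μ) = toU (transP μ) := by
  rw [← val_cPz, constantCoeff_val_cPz]

/-- The generators of `U_z(𝒲𝒫)` other than `z`. -/
def gens : Set Uz := Set.range Jz ∪ Set.range Kz ∪ Set.range Pz ∪ {Dz}

theorem gens_subset : gens ⊆ (UzWP : Set Uz) := by
  rintro f (((⟨i, rfl⟩ | ⟨i, rfl⟩) | ⟨μ, rfl⟩) | rfl)
  · rw [Jz_eq]; exact ⟨_, emb_mem (rotJ_mem i)⟩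
  · rw [Kz_eq]; exact ⟨_, emb_mem (boostK_mem i)⟩
  · rw [← val_cPz]; exact val_mem _
  · rw [Dz_eq]; exact ⟨_, emb_mem dil_mem⟩

theorem adjoin_le : Algebra.adjoin ℝ ({z} ∪ gens) ≤ UzWP := by
  refine Algebra.adjoin_le (Set.union_subset ?_ gens_subset)
  rintro _ rfl
  exact ⟨X, mapAlgHom_X _⟩

/-- At `z = 0` the deformed generators generate `U(𝒲𝒫)`. -/
theorem exists_constantCoeff (u : UWP) :
    ∃ s ∈ Algebra.adjoin ℝ ({z} ∪ gens), constantCoeff s = weylPoincareToU u := by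
  have hL : ∀ x ∈ weylPoincare,
      ∃ s ∈ Algebra.adjoin ℝ ({z} ∪ gens), constantCoeff s = toU x := by
    intro x hx
    induction hx using LieSubalgebra.lieSpan_induction with
    | mem x h =>
      rcases h with ((⟨i, rfl⟩ | ⟨i, rfl⟩) | ⟨μ, rfl⟩) | rfl
      · exact ⟨Jz i, Algebra.subset_adjoin (Or.inr (Or.inl (Or.inl (Or.inl ⟨i, rfl⟩)))), by
          rw [Jz_eq, emb]; exact PowerSeries.constantCoeff_C _⟩
      · exact ⟨Kz i, Algebra.subset_adjoin (Or.inr (Or.inl (Or.inl (Or.inr ⟨i, rfl⟩)))), by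
          rw [Kz_eq, emb]; exact PowerSeries.constantCoeff_C _⟩
      · exact ⟨Pz μ, Algebra.subset_adjoin (Or.inr (Or.inl (Or.inr ⟨μ, rfl⟩))),
          constantCoeff_Pz μ⟩
      · exact ⟨Dz, Algebra.subset_adjoin (Or.inr (Or.inr rfl)), by
          rw [Dz_eq, emb]; exact PowerSeries.constantCoeff_C _⟩
    | zero => exact ⟨0, zero_mem _, by rw [map_zero, toU_zero]⟩
    | add x y _ _ hx hy =>
      obtain ⟨s, hs, h1⟩ := hx
      obtain ⟨t, ht, h2⟩ := hy
      exact ⟨s + t, add_mem hs ht, by rw [map_add, h1, h2, toU_add]⟩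
    | smul r x _ hx =>
      obtain ⟨s, hs, h1⟩ := hx
      exact ⟨r • s, Subalgebra.smul_mem _ hs r, by
        rw [PowerSeries.constantCoeff_smul, h1, toU_smul]⟩
    | lie x y _ _ hx hy =>
      obtain ⟨s, hs, h1⟩ := hx
      obtain ⟨t, ht, h2⟩ := hy
      exact ⟨s * t - t * s, sub_mem (mul_mem hs ht) (mul_mem ht hs), by
        rw [map_sub, map_mul, map_mul, h1, h2, toU_lie]⟩
  induction u using env_induction (R := ℝ) with
  | hr r =>
    refine ⟨algebraMap ℝ Uz r, Subalgebra.algebraMap_mem _ r, ?_⟩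
    rw [AlgHom.commutes, Algebra.algebraMap_eq_smul_one, PowerSeries.constantCoeff_smul, map_one,
      Algebra.algebraMap_eq_smul_one]
  | hx x =>
    rw [weylPoincareToU_ι]
    exact hL x x.2
  | hadd a b ha hb =>
    obtain ⟨s, hs, h1⟩ := ha
    obtain ⟨t, ht, h2⟩ := hb
    exact ⟨s + t, add_mem hs ht, by rw [map_add, h1, h2, map_add]⟩
  | hmul a b ha hb =>
    obtain ⟨s, hs, h1⟩ := ha
    obtain ⟨t, ht, h2⟩ := hb
    exact ⟨s * t, mul_mem hs ht, by rw [map_mul, h1, h2, map_mul]⟩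

/-- The deformed generators and `z` generate `U_z(𝒲𝒫)` `z`-adically: at each step the coefficient of
`zⁿ` in the error is corrected by an element with that constant term. -/
theorem exists_approx {f : Uz} (hf : f ∈ UzWP) (n : ℕ) :
    ∃ g ∈ Algebra.adjoin ℝ ({z} ∪ gens), z ^ n ∣ f - g := by
  induction n with
  | zero => exact ⟨0, zero_mem _, by rw [pow_zero]; exact one_dvd _⟩
  | succ n ih =>
    obtain ⟨g, hg, h, hh⟩ := ih
    obtain ⟨k, hk⟩ := mem_UzWP.1 (sub_mem hf (adjoin_le hg))
    obtain ⟨s, hs, h1⟩ := exists_constantCoeff (coeff n k)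
    have h2 : constantCoeff h = constantCoeff s := by
      have h3 := congrArg (coeff n) (hk.trans hh)
      rw [wp, coeff_mapAlgHom, z, PowerSeries.coeff_X_pow_mul', if_pos le_rfl, Nat.sub_self,
        PowerSeries.coeff_zero_eq_constantCoeff_apply] at h3
      rw [h1, h3]
    have hz : z ∈ Algebra.adjoin ℝ ({z} ∪ gens) :=
      Algebra.subset_adjoin (Set.mem_union_left _ (Set.mem_singleton z))
    refine ⟨g + z ^ n * s, add_mem hg (mul_mem (pow_mem hz n) hs),
      zdiv (h - s), ?_⟩
    rw [← sub_sub, hh, ← mul_sub, pow_succ, mul_assoc]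
    congr 1
    exact (X_mul_zdiv (h - s) (by rw [map_sub, h2, sub_self])).symm

end Generation

/-! ### The classical `r`-matrix -/

section ClassicalLimit

open PowerSeries (coeff constantCoeff X mapAlgHom)
open NullPlane

theorem coeff_one_mul {A : Type*} [Ring A] {F G : PowerSeries A} (hF : coeff 0 F = 1)
    (hG : coeff 0 G = 1) : coeff 1 (F * G) = coeff 1 F + coeff 1 G := by
  rw [PowerSeries.coeff_mul, Finset.Nat.antidiagonal_succ]
  simp [hF, hG, add_comm]

theorem coeff_zero_mul {A : Type*} [Ring A] {F G : PowerSeries A} (hF : coeff 0 F = 1)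
    (hG : coeff 0 G = 1) : coeff 0 (F * G) = 1 := by
  rw [PowerSeries.coeff_mul]; simp [hF, hG]

theorem coeff_one_zexp_tmul (x : SO42) {p : Cz} {y : SO42}
    (h : coeff 1 (val p) = -toU y) :
    coeff 1 (zexp (emb x ⊠ val p)) = -(toU x ⊗ₜ[ℝ] toU y) := by
  rw [coeff_one_zexp, ztmul_def, inLeft, emb, mapAlgHom_C, PowerSeries.coeff_C_mul, inRight,
    coeff_mapAlgHom, h, map_neg, mul_neg]
  simp

theorem coeff_one_val_neg_X_mul (p : Cz) :
    coeff 1 (val (-(X * p))) = -constantCoeff (val p) := by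
  rw [map_neg, map_neg, map_mul, val_X, z, coeff_one_X_mul]

theorem coeff_one_twist : coeff 1 twist =
    -(toU b3 ⊗ₜ[ℝ] toU (transP 3) + toU b2 ⊗ₜ[ℝ] toU (transP 2) +
      toU (boostK 0) ⊗ₜ[ℝ] toU (transP 1) + toU dil ⊗ₜ[ℝ] toU (transP 0)) := by
  have c0 : ∀ f : Uz₂, coeff 0 (zexp f) = 1 := fun f => by
    rw [PowerSeries.coeff_zero_eq_constantCoeff_apply, constantCoeff_zexp]
  have hy : ∀ μ, coeff 1 (val (ra μ)) = -toU (transP μ) := fun μ => by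
    rw [ra, coeff_one_val_neg_X_mul, map_mul, map_mul, constantCoeff_val_cPz, ey, val_zexp,
      constantCoeff_zexp, one_mul]
  have h0 : coeff 1 (val p0) = -toU (transP 0) := by
    rw [p0, coeff_one_val_neg_X_mul, constantCoeff_val_cPz]
  have h1 : coeff 1 (val p1) = -toU (transP 1) := by
    rw [p1, coeff_one_val_neg_X_mul, constantCoeff_val_cPz]
  rw [twist_eq, E3, E2, EK, ED,
    coeff_one_mul (coeff_zero_mul (coeff_zero_mul (c0 _) (c0 _)) (c0 _)) (c0 _),
    coeff_one_mul (coeff_zero_mul (c0 _) (c0 _)) (c0 _), coeff_one_mul (c0 _) (c0 _),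
    coeff_one_zexp_tmul _ (hy 3), coeff_one_zexp_tmul _ (hy 2), coeff_one_zexp_tmul _ h1,
    coeff_one_zexp_tmul _ h0]
  abel

theorem coeff_zero_inverse_twist : coeff 0 (Ring.inverse twist) = 1 := by
  have h := congrArg (coeff 0) (Ring.mul_inverse_cancel twist isUnit_twist)
  have h0 := coeff_zero_twist
  rw [PowerSeries.coeff_zero_eq_constantCoeff_apply] at h h0 ⊢
  rwa [map_mul, h0, one_mul, PowerSeries.coeff_zero_one] at h

theorem coeff_zero_zflip_twist : coeff 0 (zflip twist) = 1 := by
  rw [zflip, coeff_mapAlgHom, coeff_zero_twist, map_one]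

theorem coeff_zero_rMatrix : coeff 0 (zflip twist * Ring.inverse twist) = 1 :=
  coeff_zero_mul coeff_zero_zflip_twist coeff_zero_inverse_twist

theorem coeff_one_rMatrix : coeff 1 (zflip twist * Ring.inverse twist) = classicalR := by
  have h := congrArg (coeff 1) (Ring.mul_inverse_cancel twist isUnit_twist)
  rw [coeff_one_mul coeff_zero_twist coeff_zero_inverse_twist, PowerSeries.coeff_one,
    if_neg one_ne_zero] at h
  rw [coeff_one_mul coeff_zero_zflip_twist coeff_zero_inverse_twist, eq_neg_of_add_eq_zero_right h,
    zflip, coeff_mapAlgHom, coeff_one_twist, classicalR, b2, b3, toU_add, toU_sub]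
  have hc : ∀ a b : U42, (Algebra.TensorProduct.comm ℝ U42 U42).toAlgHom (a ⊗ₜ[ℝ] b) =
    b ⊗ₜ[ℝ] a := fun _ _ => rfl
  simp only [wedge, map_neg, map_add, map_sub, hc, TensorProduct.add_tmul, TensorProduct.sub_tmul,
    TensorProduct.tmul_add, TensorProduct.tmul_sub]
  abel

end ClassicalLimit

/-! ### The relations in the deformed generators -/

section Relations

open PowerSeries (coeff constantCoeff X mapAlgHom)
open NullPlane

theorem z_mul_Pz (μ : Fin 4) : z * Pz μ = val (X * cPz μ) := by
  rw [map_mul, val_X, val_cPz]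

theorem val_ex : zexp (z * Pz 0) = val ex := by rw [z_mul_Pz, ← val_zexp]; rfl

theorem val_exi : zexp (-(z * Pz 0)) = val exi := by rw [z_mul_Pz, ← map_neg, ← val_zexp]; rfl

theorem val_ey : zexp (z * Pz 1) = val ey := by rw [z_mul_Pz, ← val_zexp]; rfl

theorem val_eyi : zexp (-(z * Pz 1)) = val eyi := by rw [z_mul_Pz, ← map_neg, ← val_zexp]; rfl

theorem val_zcosh : zcosh (z * Pz 1) = val (zcosh (X * cPz 1)) := by
  rw [zcosh, val_ey, val_eyi, zcosh_eq, map_smul, map_add]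

theorem val_zsinh : zsinh (z * Pz 1) = val (zsinh (X * cPz 1)) := by
  rw [zsinh, val_ey, val_eyi, zsinh_eq, map_smul, map_sub]

theorem zdiv_half {p q : Cz} (h : 2 * (X * p) = q) : p = (1 / 2 : ℝ) • zdiv q := by
  have h1 : X * ((2 : ℝ) • p) = q := by rw [← h, Algebra.smul_def, map_ofNat]; ring
  rw [zdiv_eq_of_X_mul h1.symm]; module

/-- The first two identities invert the linear definition of `P₀`, `P₁`; the others follow by
exponentiating them. -/
theorem inverse_change :
    σm = -(z * (Pz 0 - Pz 1)) ∧ σp = -(z * (Pz 0 + Pz 1)) ∧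
      Tm = (1 / 2 : ℝ) • zdiv (1 - zexp (-(z * Pz 0)) * zexp (z * Pz 1)) ∧
      T = (1 / 2 : ℝ) • zdiv (1 - zexp (-(z * Pz 0)) * zexp (-(z * Pz 1))) ∧
      T2 = (1 / 2 : ℝ) • (zexp σm * (Pz 2 - Pz 3)) ∧
      T3 = (1 / 2 : ℝ) • (zexp σm * (Pz 2 + Pz 3)) ∧
      Tp = (1 / 2 : ℝ) • zdiv (1 - zexp (-(z * Pz 0)) * zexp (-(z * Pz 1))) -
        (1 / 2 : ℝ) • (z * zexp (-(z * Pz 0)) * zexp (z * Pz 1) * (Pz 2 ^ 2 + Pz 3 ^ 2)) := by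
  have hT : T = (1 / 2 : ℝ) • zdiv (1 - zexp (-(z * Pz 0)) * zexp (-(z * Pz 1))) := by
    rw [val_exi, val_eyi, ← map_mul, ← map_one val, ← map_sub, ← val_zdiv, ← map_smul,
      ← zdiv_half two_mul_X_mul_cT, val_cT]
  refine ⟨?_, ?_, ?_, hT, ?_, ?_, ?_⟩
  · rw [← val_cσm, cσm_eq, map_add, map_neg, ← z_mul_Pz, ← z_mul_Pz, mul_sub]; abel
  · rw [← val_cσp, cσp_eq, map_sub, map_neg, ← z_mul_Pz, ← z_mul_Pz, mul_add]; abel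
  · rw [val_exi, val_ey, ← map_mul, ← map_one val, ← map_sub, ← val_zdiv, ← map_smul,
      ← zdiv_half two_mul_X_mul_cTm, val_cTm]
  · rw [← val_cT2, ← val_cσm, ← val_zexp, ← val_cPz, ← val_cPz, ← map_sub, ← map_mul, ← map_smul,
      zexp_cσm_eq, cT2, tP_two, tP_three]
    congr 2; ring
  · rw [← val_cT3, ← val_cσm, ← val_zexp, ← val_cPz, ← val_cPz, ← map_add, ← map_mul, ← map_smul,
      zexp_cσm_eq, cT3, tP_two, tP_three]
    congr 2; ring
  · rw [← hT, ← val_cTp, cTp_eq, map_sub, val_cT, map_smul, val_exi, val_ey, ← val_cPz, ← val_cPz]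
    simp only [map_mul, map_add, map_pow, val_X, mul_assoc]

theorem tmul_Pz_zero (S : Uz) : z₂ * (S ⊠ Pz 0) = S ⊠ val (X * cPz 0) := by
  rw [← val_cPz, z₂_mul_tmul_val]

theorem tmul_Pz_one (S : Uz) : z₂ * (S ⊠ Pz 1) = S ⊠ val (X * cPz 1) := by
  rw [← val_cPz, z₂_mul_tmul_val]

theorem factors :
    ΦJ = zexp (-((1 / 2 : ℝ) • (z₂ * (Dz ⊠ Pz 0)))) * zexp ((1 / 2 : ℝ) • (z₂ * (Dz ⊠ Pz 1))) *
        zexp ((1 / 2 : ℝ) • (z₂ * (Kz 0 ⊠ Pz 0))) *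
        zexp (-((1 / 2 : ℝ) • (z₂ * (Kz 0 ⊠ Pz 1)))) ∧
      ΦE =
        zexp (-(z₂ * ((Kz 1 + Jz 2) ⊠ (zexp (-((1 / 2 : ℝ) • (z * Pz 0))) *
          zexp ((1 / 2 : ℝ) • (z * Pz 1)) * Pz 2)))) *
        zexp (-(z₂ * ((Kz 2 - Jz 1) ⊠ (zexp (-((1 / 2 : ℝ) • (z * Pz 0))) *
          zexp ((1 / 2 : ℝ) • (z * Pz 1)) * Pz 3)))) ∧
      ΦA = zexp (-((1 / 2 : ℝ) • (z₂ * (Dz ⊠ Pz 0)))) *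
        zexp (-((1 / 2 : ℝ) • (z₂ * (Dz ⊠ Pz 1)))) *
        zexp (-((1 / 2 : ℝ) • (z₂ * (Kz 0 ⊠ Pz 0)))) *
        zexp (-((1 / 2 : ℝ) • (z₂ * (Kz 0 ⊠ Pz 1)))) := by
  have hg : zexp (-((1 / 2 : ℝ) • (z * Pz 0))) * zexp ((1 / 2 : ℝ) • (z * Pz 1)) = val gh := by
    rw [z_mul_Pz, z_mul_Pz, ← map_smul, ← map_smul, ← map_neg, ← val_zexp, ← val_zexp, ← map_mul]
    rfl
  have h0 : constantCoeff (-(X * cPz 0)) = 0 := constantCoeff_p0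
  have h1 := constantCoeff_X_mul (cPz 1)
  refine ⟨?_, ?_, ?_⟩
  · rw [tmul_Pz_zero, tmul_Pz_zero, tmul_Pz_one, tmul_Pz_one, Dz_eq, Kz_eq, ΦJ_eq,
      show Hm = (1 / 2 : ℝ) • (emb dil + (-1 : ℝ) • emb (boostK 0)) by rw [emb_Hm]; module,
      show cσm = -(X * cPz 0) + (1 : ℝ) • (X * cPz 1) by rw [cσm_eq, one_smul],
      zexp_four h0 h1]
    simp only [map_neg, ztmul_neg]
    congr 1
    · congr 1
      · congr 1
        congr 1; module
      · congr 1; module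
    · congr 1; module
  · rw [hg, Kz_eq, Kz_eq, Jz_eq, Jz_eq, ← val_cPz, ← val_cPz, ← map_mul, ← map_mul,
      z₂_mul_tmul_val, z₂_mul_tmul_val, neg_tmul_val, neg_tmul_val, ← emb_b2, ← emb_b3, ΦE_eq]
  · rw [tmul_Pz_zero, tmul_Pz_zero, tmul_Pz_one, tmul_Pz_one, Dz_eq, Kz_eq, ΦA_eq,
      show Hp = (1 / 2 : ℝ) • (emb dil + (1 : ℝ) • emb (boostK 0)) by rw [emb_Hp]; module,
      show cσp = -(X * cPz 0) + (-1 : ℝ) • (X * cPz 1) by rw [cσp_eq]; module,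
      zexp_four h0 h1]
    simp only [map_neg, ztmul_neg]
    congr 1
    · congr 1
      · congr 1
        · congr 1; module
        · congr 1; module
      · congr 1; module
    · congr 1; module

theorem compact_form :
    twist =
      zexp (-(z₂ * ((Kz 2 - Jz 1) ⊠ (zexp (z * Pz 1) * Pz 3)))) *
      zexp (-(z₂ * ((Kz 1 + Jz 2) ⊠ (zexp (z * Pz 1) * Pz 2)))) *
      zexp (-(z₂ * (Kz 0 ⊠ Pz 1))) * zexp (-(z₂ * (Dz ⊠ Pz 0))) := by
  rw [tmul_Pz_zero, tmul_Pz_one, val_ey, Kz_eq, Kz_eq, Kz_eq, Jz_eq, Jz_eq, Dz_eq, ← val_cPz,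
    ← val_cPz, ← map_mul, ← map_mul, z₂_mul_tmul_val, z₂_mul_tmul_val, neg_tmul_val, neg_tmul_val,
    neg_tmul_val, neg_tmul_val, ← emb_b2, ← emb_b3, twist_eq]
  rfl

theorem fin_three_cases {a : Fin 3} (h : a ≠ 0) : a = 1 ∨ a = 2 := by
  revert a; decide

theorem eps_zero_one : eps 0 1 0 = 0 ∧ eps 0 1 1 = 0 ∧ eps 0 1 2 = 1 := by simp [eps]

theorem eps_zero_two : eps 0 2 0 = 0 ∧ eps 0 2 1 = -1 ∧ eps 0 2 2 = 0 := by simp [eps]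

theorem coproducts :
    twComul twist (Pz 0) = Pz 0 ⊠ 1 + 1 ⊠ Pz 0 ∧
      twComul twist (Pz 1) = Pz 1 ⊠ 1 + 1 ⊠ Pz 1 ∧
      (∀ a : Fin 3, a ≠ 0 →
        twComul twist (Pz a.succ) = Pz a.succ ⊠ zexp (-(z * Pz 1)) + 1 ⊠ Pz a.succ) ∧
      twComul twist (Jz 0) = Jz 0 ⊠ 1 + 1 ⊠ Jz 0 ∧
      (∀ a : Fin 3, a ≠ 0 →
        twComul twist (Jz a) =
          Jz a ⊠ zexp (-(z * Pz 1)) + 1 ⊠ Jz a + z₂ * (Jz 0 ⊠ Pz a.succ)) ∧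
      twComul twist Dz =
        Dz ⊠ (zexp (z * Pz 0) * zcosh (z * Pz 1)) + 1 ⊠ Dz +
          Kz 0 ⊠ (zexp (z * Pz 0) * zsinh (z * Pz 1)) +
          z₂ * ((Kz 1 + Jz 2) ⊠ (zexp (z * Pz 0) * Pz 2)) +
          z₂ * ((Kz 2 - Jz 1) ⊠ (zexp (z * Pz 0) * Pz 3)) +
          (1 / 2 : ℝ) • (z₂ ^ 2 * ((Dz + Kz 0) ⊠
            (zexp (z * Pz 0) * zexp (z * Pz 1) * (Pz 2 ^ 2 + Pz 3 ^ 2)))) ∧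
      twComul twist (Kz 0) =
        Kz 0 ⊠ (zexp (z * Pz 0) * zcosh (z * Pz 1)) + 1 ⊠ Kz 0 +
          Dz ⊠ (zexp (z * Pz 0) * zsinh (z * Pz 1)) -
          z₂ * ((Kz 1 + Jz 2) ⊠ (zexp (z * Pz 0) * Pz 2)) -
          z₂ * ((Kz 2 - Jz 1) ⊠ (zexp (z * Pz 0) * Pz 3)) -
          (1 / 2 : ℝ) • (z₂ ^ 2 * ((Dz + Kz 0) ⊠
            (zexp (z * Pz 0) * zexp (z * Pz 1) * (Pz 2 ^ 2 + Pz 3 ^ 2)))) ∧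
      (∀ a : Fin 3, a ≠ 0 →
        twComul twist (Kz a) =
          Kz a ⊠ zexp (z * Pz 0) + 1 ⊠ Kz a +
            ∑ b : Fin 3, eps 0 a b • (Jz b ⊠ (zexp (z * Pz 0) - zexp (-(z * Pz 1)))) -
            z₂ * ∑ b : Fin 3, eps 0 a b • (Jz 0 ⊠ Pz b.succ) +
            z₂ * ((Dz + Kz 0) ⊠ (zexp (z * Pz 0) * zexp (z * Pz 1) * Pz a.succ))) := by
  simp only [val_ex, val_ey, val_eyi, val_zcosh, val_zsinh, Jz_eq, Kz_eq, Dz_eq]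
  simp only [← val_cPz, ← map_mul, ← map_sub, ← map_add, ← map_pow]
  refine ⟨twComul_cPz_zero, twComul_cPz_one, ?_, twComul_rotJ_zero, ?_, ?_, ?_, ?_⟩
  · intro a ha
    rcases fin_three_cases ha with rfl | rfl
    exacts [twComul_cPz_two, twComul_cPz_three]
  · intro a ha
    rcases fin_three_cases ha with rfl | rfl
    exacts [twComul_rotJ_one, twComul_rotJ_two]
  · rw [twComul_dil, theta]; abel
  · rw [twComul_boostK_zero, theta]; abel
  · intro a ha
    rcases fin_three_cases ha with rfl | rfl
    · rw [twComul_boostK_one]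
      simp only [Fin.sum_univ_three, eps_zero_one, zero_smul, zero_add, add_zero, one_smul]
      rfl
    · rw [twComul_boostK_two]
      simp only [Fin.sum_univ_three, eps_zero_two, zero_smul, zero_add, add_zero, neg_smul,
        one_smul, mul_neg, sub_neg_eq_add, sub_eq_add_neg (_ + 1 ⊠ emb (boostK 2))]
      rfl

theorem Brk.lie {S : Uz} {p d : Cz} (h : Brk S p d) : ⁅S, val p⁆ = val d := h

theorem commutators :
    (∀ i j, ⁅Jz i, Jz j⁆ = ∑ k, eps i j k • Jz k) ∧
      (∀ i j, ⁅Jz i, Kz j⁆ = ∑ k, eps i j k • Kz k) ∧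
      (∀ i j, ⁅Kz i, Kz j⁆ = -∑ k, eps i j k • Jz k) ∧
      (∀ j : Fin 3, ⁅Jz 0, Pz j.succ⁆ = ∑ k : Fin 3, eps 0 j k • Pz k.succ) ∧
      (∀ a : Fin 3, a ≠ 0 → ⁅Jz a, Pz 1⁆ = ∑ b : Fin 3, eps a 0 b • Pz b.succ) ∧
      (∀ a b : Fin 3, a ≠ 0 → b ≠ 0 →
        ⁅Jz a, Pz b.succ⁆ =
          eps 0 a b • ((1 / 2 : ℝ) • zdiv (1 - zexp (-((2 : ℝ) • (z * Pz 1)))) +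
            (1 / 2 : ℝ) • (z * (Pz b.succ ^ 2 - Pz a.succ ^ 2))) +
          if a = b then z * ∑ c : Fin 3, eps 0 b c • (Pz b.succ * Pz c.succ) else 0) ∧
      ⁅Kz 0, Pz 0⁆ = zdiv (zexp (z * Pz 0) * zsinh (z * Pz 1)) -
        (1 / 2 : ℝ) • (z * zexp (z * Pz 0) * zexp (z * Pz 1) * (Pz 2 ^ 2 + Pz 3 ^ 2)) ∧
      ⁅Kz 0, Pz 1⁆ = zdiv (zexp (z * Pz 0) * zcosh (z * Pz 1) - 1) -
        (1 / 2 : ℝ) • (z * zexp (z * Pz 0) * zexp (z * Pz 1) * (Pz 2 ^ 2 + Pz 3 ^ 2)) ∧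
      (∀ a : Fin 3, a ≠ 0 →
        ⁅Kz a, Pz 0⁆ = zexp (z * Pz 0) * zexp (z * Pz 1) * Pz a.succ ∧
        ⁅Kz a, Pz 1⁆ = (zexp (z * Pz 0) * zexp (z * Pz 1) - 1) * Pz a.succ ∧
        ⁅Kz 0, Pz a.succ⁆ = (1 - zexp (z * Pz 0) * zexp (-(z * Pz 1))) * Pz a.succ) ∧
      (∀ a b : Fin 3, a ≠ 0 → b ≠ 0 →
        ⁅Kz a, Pz b.succ⁆ =
          (if a = b then
            zdiv (zexp (-(z * Pz 1)) * (zexp (z * Pz 0) - zcosh (z * Pz 1))) +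
              (1 / 2 : ℝ) •
                (z * ∑ c : Fin 3, (eps 0 b c) ^ 2 • (Pz b.succ ^ 2 - Pz c.succ ^ 2))
            else 0) +
          z * (eps 0 a b) ^ 2 • (Pz a.succ * Pz b.succ)) ∧
      ⁅Dz, Pz 0⁆ = zdiv (zexp (z * Pz 0) * zcosh (z * Pz 1) - 1) +
        (1 / 2 : ℝ) • (z * zexp (z * Pz 0) * zexp (z * Pz 1) * (Pz 2 ^ 2 + Pz 3 ^ 2)) ∧
      ⁅Dz, Pz 1⁆ = zdiv (zexp (z * Pz 0) * zsinh (z * Pz 1)) +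
        (1 / 2 : ℝ) • (z * zexp (z * Pz 0) * zexp (z * Pz 1) * (Pz 2 ^ 2 + Pz 3 ^ 2)) ∧
      (∀ a : Fin 3, a ≠ 0 →
        ⁅Dz, Pz a.succ⁆ = zexp (z * Pz 0) * zexp (-(z * Pz 1)) * Pz a.succ) ∧
      (∀ i, ⁅Jz i, Pz 0⁆ = 0) ∧ (∀ i, ⁅Dz, Jz i⁆ = 0) ∧ (∀ i, ⁅Dz, Kz i⁆ = 0) ∧
      (∀ μ ν, ⁅Pz μ, Pz ν⁆ = 0) := by
  have e : ∀ x y : SO42, ⁅emb x, emb y⁆ = emb ⁅x, y⁆ := fun x y => (emb_lie x y).symm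
  have h2 : zexp (-((2 : ℝ) • (z * Pz 1))) = val (zexp (-((2 : ℝ) • (X * cPz 1)))) := by
    rw [z_mul_Pz, ← map_smul, ← map_neg, val_zexp]
  have hz : z = val X := val_X.symm
  have s12 : (1 : Fin 3).succ = 2 := rfl
  have s23 : (2 : Fin 3).succ = 3 := rfl
  simp only [val_ex, val_ey, val_eyi, val_zcosh, val_zsinh, Jz_eq, Kz_eq, Dz_eq, h2]
  rw [hz]
  simp only [← val_cPz, ← map_one val, ← map_mul, ← map_sub, ← map_add, ← map_pow, ← val_zdiv,
    ← map_smul, ← map_sum]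
  obtain ⟨d0, d1, d2, d3⟩ := brk_dil_cPz
  obtain ⟨k0, k1, k2, k3⟩ := brk_boostK_zero_cPz
  obtain ⟨l0, l1, l2, l3⟩ := brk_boostK_one_cPz
  obtain ⟨m0, m1, m2, m3⟩ := brk_boostK_two_cPz
  obtain ⟨j0, j1, j2, j3⟩ := brk_rotJ_zero_cPz
  obtain ⟨r0, r1, r2, r3⟩ := brk_rotJ_one_cPz
  obtain ⟨s0, s1, s2, s3⟩ := brk_rotJ_two_cPz
  refine ⟨?_, ?_, ?_, ?_, ?_, ?_, k0, k1, ?_, ?_, d0, d1, ?_, ?_, ?_, ?_, ?_⟩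
  · intro i j
    rw [e, lie_rotJ_rotJ]
    simp only [Fin.sum_univ_three, emb_add, emb_smul]
  · intro i j
    rw [e, lie_rotJ_boostK]
    simp only [Fin.sum_univ_three, emb_add, emb_smul]
  · intro i j
    rw [e, lie_boostK_boostK, emb_neg]
    simp only [Fin.sum_univ_three, emb_add, emb_smul]
  · intro j
    fin_cases j
    · exact (j1.congr (by simp [Fin.sum_univ_three, eps])).lie
    · exact (j2.congr (by simp [Fin.sum_univ_three, eps])).lie
    · exact (j3.congr (by simp [Fin.sum_univ_three, eps])).lie
  · intro a ha
    rcases fin_three_cases ha with rfl | rfl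
    · exact (r1.congr (by simp [Fin.sum_univ_three, eps])).lie
    · exact (s1.congr (by simp [Fin.sum_univ_three, eps])).lie
  · intro a b ha hb
    rcases fin_three_cases ha with rfl | rfl <;> rcases fin_three_cases hb with rfl | rfl
    · refine r2.lie.trans ?_
      simp [eps, Fin.sum_univ_three, s23, s12, mul_add]
    · refine r3.lie.trans ?_
      simp [eps, Fin.sum_univ_three, s23, s12, mul_add]
    · refine s2.lie.trans ?_
      simp [eps, Fin.sum_univ_three, s23, s12, mul_add]
      module
    · refine s3.lie.trans ?_
      simp [eps, Fin.sum_univ_three, s23, s12, mul_add]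
  · intro a ha
    rcases fin_three_cases ha with rfl | rfl
    exacts [⟨l0, l1, k2⟩, ⟨m0, m1, k3⟩]
  · intro a b ha hb
    rcases fin_three_cases ha with rfl | rfl <;> rcases fin_three_cases hb with rfl | rfl
    · refine l2.lie.trans ?_
      simp [eps, Fin.sum_univ_three, s23, s12, mul_add]
    · refine l3.lie.trans ?_
      simp [eps, Fin.sum_univ_three, s23, s12, mul_add]
    · refine m2.lie.trans ?_
      simp [eps, Fin.sum_univ_three, s23, s12, mul_add]
    · refine m3.lie.trans ?_
      simp [eps, Fin.sum_univ_three, s23, s12, mul_add]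
  · intro a ha
    rcases fin_three_cases ha with rfl | rfl
    exacts [d2, d3]
  · intro i
    fin_cases i
    exacts [(j0.congr rfl).lie.trans (map_zero _), r0.lie.trans (map_zero _),
      s0.lie.trans (map_zero _)]
  · intro i
    rw [e, lie_dil_rotJ, emb_zero]
  · intro i
    rw [e, lie_dil_boostK, emb_zero]
  · intro μ ν
    exact sub_eq_zero.2 (commute_val _ _)

end Relations

end TwistedConformal

end

/-- The twisted Weyl–Poincaré algebra in the conformal basis. Indices `0, 1, 2 : Fin 3` stand for
the spatial labels `1, 2, 3`, so that `a ≠ 0` and `b ≠ 0` below mean `a, b ∈ {2, 3}`. -/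
theorem mainTheorem2 :
    -- `U_z(so(4,2))` is a twisted Hopf algebra, and `U_z(𝒲𝒫)` is a Hopf subalgebra of it
    (IsTwist twist ∧ IsTwistedHopfAlgebra twist ∧ twist ∈ UzWP₂ ∧
      ∀ f ∈ UzWP, twComul twist f ∈ UzWP₂ ∧ twAntipode twist f ∈ UzWP) ∧
    -- the deformed generators belong to `U_z(𝒲𝒫)` and generate it `z`-adically
    (Set.range Jz ∪ Set.range Kz ∪ Set.range Pz ∪ {Dz} ⊆ (UzWP : Set Uz) ∧
      ∀ f ∈ UzWP, ∀ n : ℕ,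
        ∃ g ∈ Algebra.adjoin ℝ ({z} ∪ (Set.range Jz ∪ Set.range Kz ∪ Set.range Pz ∪ {Dz})),
          z ^ n ∣ f - g) ∧
    -- the change of basis reduces to the classical one at `z = 0`
    ((∀ i, Jz i = emb (rotJ i)) ∧ (∀ i, Kz i = emb (boostK i)) ∧ Dz = emb dil ∧
      ∀ μ, PowerSeries.constantCoeff (Pz μ) = toU (transP μ)) ∧
    -- the inverse change of basis
    (σm = -(z * (Pz 0 - Pz 1)) ∧ σp = -(z * (Pz 0 + Pz 1)) ∧
      Tm = (1 / 2 : ℝ) • zdiv (1 - zexp (-(z * Pz 0)) * zexp (z * Pz 1)) ∧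
      T = (1 / 2 : ℝ) • zdiv (1 - zexp (-(z * Pz 0)) * zexp (-(z * Pz 1))) ∧
      T2 = (1 / 2 : ℝ) • (zexp σm * (Pz 2 - Pz 3)) ∧
      T3 = (1 / 2 : ℝ) • (zexp σm * (Pz 2 + Pz 3)) ∧
      Tp = (1 / 2 : ℝ) • zdiv (1 - zexp (-(z * Pz 0)) * zexp (-(z * Pz 1))) -
        (1 / 2 : ℝ) • (z * zexp (-(z * Pz 0)) * zexp (z * Pz 1) * (Pz 2 ^ 2 + Pz 3 ^ 2))) ∧
    -- the coproduct
    (twComul twist (Pz 0) = Pz 0 ⊠ 1 + 1 ⊠ Pz 0 ∧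
      twComul twist (Pz 1) = Pz 1 ⊠ 1 + 1 ⊠ Pz 1 ∧
      (∀ a : Fin 3, a ≠ 0 →
        twComul twist (Pz a.succ) = Pz a.succ ⊠ zexp (-(z * Pz 1)) + 1 ⊠ Pz a.succ) ∧
      twComul twist (Jz 0) = Jz 0 ⊠ 1 + 1 ⊠ Jz 0 ∧
      (∀ a : Fin 3, a ≠ 0 →
        twComul twist (Jz a) =
          Jz a ⊠ zexp (-(z * Pz 1)) + 1 ⊠ Jz a + z₂ * (Jz 0 ⊠ Pz a.succ)) ∧
      twComul twist Dz =
        Dz ⊠ (zexp (z * Pz 0) * zcosh (z * Pz 1)) + 1 ⊠ Dz +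
          Kz 0 ⊠ (zexp (z * Pz 0) * zsinh (z * Pz 1)) +
          z₂ * ((Kz 1 + Jz 2) ⊠ (zexp (z * Pz 0) * Pz 2)) +
          z₂ * ((Kz 2 - Jz 1) ⊠ (zexp (z * Pz 0) * Pz 3)) +
          (1 / 2 : ℝ) • (z₂ ^ 2 * ((Dz + Kz 0) ⊠
            (zexp (z * Pz 0) * zexp (z * Pz 1) * (Pz 2 ^ 2 + Pz 3 ^ 2)))) ∧
      twComul twist (Kz 0) =
        Kz 0 ⊠ (zexp (z * Pz 0) * zcosh (z * Pz 1)) + 1 ⊠ Kz 0 +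
          Dz ⊠ (zexp (z * Pz 0) * zsinh (z * Pz 1)) -
          z₂ * ((Kz 1 + Jz 2) ⊠ (zexp (z * Pz 0) * Pz 2)) -
          z₂ * ((Kz 2 - Jz 1) ⊠ (zexp (z * Pz 0) * Pz 3)) -
          (1 / 2 : ℝ) • (z₂ ^ 2 * ((Dz + Kz 0) ⊠
            (zexp (z * Pz 0) * zexp (z * Pz 1) * (Pz 2 ^ 2 + Pz 3 ^ 2)))) ∧
      (∀ a : Fin 3, a ≠ 0 →
        twComul twist (Kz a) =
          Kz a ⊠ zexp (z * Pz 0) + 1 ⊠ Kz a +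
            ∑ b : Fin 3, eps 0 a b • (Jz b ⊠ (zexp (z * Pz 0) - zexp (-(z * Pz 1)))) -
            z₂ * ∑ b : Fin 3, eps 0 a b • (Jz 0 ⊠ Pz b.succ) +
            z₂ * ((Dz + Kz 0) ⊠ (zexp (z * Pz 0) * zexp (z * Pz 1) * Pz a.succ)))) ∧
    -- the commutation relations
    ((∀ i j, ⁅Jz i, Jz j⁆ = ∑ k, eps i j k • Jz k) ∧
      (∀ i j, ⁅Jz i, Kz j⁆ = ∑ k, eps i j k • Kz k) ∧
      (∀ i j, ⁅Kz i, Kz j⁆ = -∑ k, eps i j k • Jz k) ∧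
      (∀ j : Fin 3, ⁅Jz 0, Pz j.succ⁆ = ∑ k : Fin 3, eps 0 j k • Pz k.succ) ∧
      (∀ a : Fin 3, a ≠ 0 → ⁅Jz a, Pz 1⁆ = ∑ b : Fin 3, eps a 0 b • Pz b.succ) ∧
      (∀ a b : Fin 3, a ≠ 0 → b ≠ 0 →
        ⁅Jz a, Pz b.succ⁆ =
          eps 0 a b • ((1 / 2 : ℝ) • zdiv (1 - zexp (-((2 : ℝ) • (z * Pz 1)))) +
            (1 / 2 : ℝ) • (z * (Pz b.succ ^ 2 - Pz a.succ ^ 2))) +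
          if a = b then z * ∑ c : Fin 3, eps 0 b c • (Pz b.succ * Pz c.succ) else 0) ∧
      ⁅Kz 0, Pz 0⁆ = zdiv (zexp (z * Pz 0) * zsinh (z * Pz 1)) -
        (1 / 2 : ℝ) • (z * zexp (z * Pz 0) * zexp (z * Pz 1) * (Pz 2 ^ 2 + Pz 3 ^ 2)) ∧
      ⁅Kz 0, Pz 1⁆ = zdiv (zexp (z * Pz 0) * zcosh (z * Pz 1) - 1) -
        (1 / 2 : ℝ) • (z * zexp (z * Pz 0) * zexp (z * Pz 1) * (Pz 2 ^ 2 + Pz 3 ^ 2)) ∧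
      (∀ a : Fin 3, a ≠ 0 →
        ⁅Kz a, Pz 0⁆ = zexp (z * Pz 0) * zexp (z * Pz 1) * Pz a.succ ∧
        ⁅Kz a, Pz 1⁆ = (zexp (z * Pz 0) * zexp (z * Pz 1) - 1) * Pz a.succ ∧
        ⁅Kz 0, Pz a.succ⁆ = (1 - zexp (z * Pz 0) * zexp (-(z * Pz 1))) * Pz a.succ) ∧
      (∀ a b : Fin 3, a ≠ 0 → b ≠ 0 →
        ⁅Kz a, Pz b.succ⁆ =
          (if a = b then
            zdiv (zexp (-(z * Pz 1)) * (zexp (z * Pz 0) - zcosh (z * Pz 1))) +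
              (1 / 2 : ℝ) •
                (z * ∑ c : Fin 3, (eps 0 b c) ^ 2 • (Pz b.succ ^ 2 - Pz c.succ ^ 2))
            else 0) +
          z * (eps 0 a b) ^ 2 • (Pz a.succ * Pz b.succ)) ∧
      ⁅Dz, Pz 0⁆ = zdiv (zexp (z * Pz 0) * zcosh (z * Pz 1) - 1) +
        (1 / 2 : ℝ) • (z * zexp (z * Pz 0) * zexp (z * Pz 1) * (Pz 2 ^ 2 + Pz 3 ^ 2)) ∧
      ⁅Dz, Pz 1⁆ = zdiv (zexp (z * Pz 0) * zsinh (z * Pz 1)) +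
        (1 / 2 : ℝ) • (z * zexp (z * Pz 0) * zexp (z * Pz 1) * (Pz 2 ^ 2 + Pz 3 ^ 2)) ∧
      (∀ a : Fin 3, a ≠ 0 →
        ⁅Dz, Pz a.succ⁆ = zexp (z * Pz 0) * zexp (-(z * Pz 1)) * Pz a.succ) ∧
      (∀ i, ⁅Jz i, Pz 0⁆ = 0) ∧ (∀ i, ⁅Dz, Jz i⁆ = 0) ∧ (∀ i, ⁅Dz, Kz i⁆ = 0) ∧
      (∀ μ ν, ⁅Pz μ, Pz ν⁆ = 0)) ∧
    -- the three factors of the twisting element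
    (ΦJ = zexp (-((1 / 2 : ℝ) • (z₂ * (Dz ⊠ Pz 0)))) * zexp ((1 / 2 : ℝ) • (z₂ * (Dz ⊠ Pz 1))) *
        zexp ((1 / 2 : ℝ) • (z₂ * (Kz 0 ⊠ Pz 0))) *
        zexp (-((1 / 2 : ℝ) • (z₂ * (Kz 0 ⊠ Pz 1)))) ∧
      ΦE =
        zexp (-(z₂ * ((Kz 1 + Jz 2) ⊠ (zexp (-((1 / 2 : ℝ) • (z * Pz 0))) *
          zexp ((1 / 2 : ℝ) • (z * Pz 1)) * Pz 2)))) *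
        zexp (-(z₂ * ((Kz 2 - Jz 1) ⊠ (zexp (-((1 / 2 : ℝ) • (z * Pz 0))) *
          zexp ((1 / 2 : ℝ) • (z * Pz 1)) * Pz 3)))) ∧
      ΦA = zexp (-((1 / 2 : ℝ) • (z₂ * (Dz ⊠ Pz 0)))) *
        zexp (-((1 / 2 : ℝ) • (z₂ * (Dz ⊠ Pz 1)))) *
        zexp (-((1 / 2 : ℝ) • (z₂ * (Kz 0 ⊠ Pz 0)))) *
        zexp (-((1 / 2 : ℝ) • (z₂ * (Kz 0 ⊠ Pz 1))))) ∧
    -- the compact form of the twisting element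
    twist =
      zexp (-(z₂ * ((Kz 2 - Jz 1) ⊠ (zexp (z * Pz 1) * Pz 3)))) *
      zexp (-(z₂ * ((Kz 1 + Jz 2) ⊠ (zexp (z * Pz 1) * Pz 2)))) *
      zexp (-(z₂ * (Kz 0 ⊠ Pz 1))) * zexp (-(z₂ * (Dz ⊠ Pz 0))) ∧
    -- the universal `R`-matrix and the underlying classical `r`-matrix
    (IsUniversalRMatrix twist (zflip twist * Ring.inverse twist) ∧
      zflip twist * Ring.inverse twist ∈ UzWP₂ ∧
      PowerSeries.coeff 0 (zflip twist * Ring.inverse twist) = 1 ∧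
      PowerSeries.coeff 1 (zflip twist * Ring.inverse twist) = classicalR) :=
  ⟨⟨isTwist_twist, isTwist_twist.isTwistedHopfAlgebra coeff_zero_twist, twist_mem,
      fun _ hf => ⟨twComul_mem hf, twAntipode_mem hf⟩⟩,
    ⟨gens_subset, fun _ hf n => exists_approx hf n⟩,
    ⟨Jz_eq, Kz_eq, Dz_eq, constantCoeff_Pz⟩,
    inverse_change, coproducts, commutators, factors, compact_form,
    ⟨isTwist_twist.isUniversalRMatrix comm_comul, rMatrix_mem, coeff_zero_rMatrix,
      coeff_one_rMatrix⟩⟩
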